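/- **Theorem (polynomial approximation barrier).** Let $\beta,c>0$ and put $M=\lfloor 2/\beta\rfloor$. *Inputs.* For each $n$ let $\Sigma_n\in\mathbb R^{d_n\times d_n}$ be positive semi-definite with $\|\Sigma_n\|_{\mathrm{op}}=1$, let $r_n=\operatorname{tr}(\Sigma_n)/\|\Sigma_n\|_{\mathrm{op}}$ be its effective dimension, and assume $r_n/n^\beta\to c$. Let $W$ be a random vector in $\mathbb R^{d_n}$ with i.i.d. coordinates whose law is either standard normal or centered with unit variance and supported in $[-B,B]$, with $B$ independent of $n$. The input distribution $P_n$ is either the law of $X=\Sigma_n^{1/2}W$ for all $n$ (covariance model), or the law of $X=\sqrt{r_n}\,Z/\|Z\|$ with $Z=\Sigma_n^{1/2}W$ for all $n$ (sphere model; $0/0=0$). Put $m=2M$ in the covariance model and $m=M$ in the sphere model. *Kernel.* Let $k(x,x')=g(\|x\|^2,\|x'\|^2,x^\top x')$ with $g$ not depending on the dimension $d$. Assume either that $k(x,x')=\exp(-\|x-x'\|^\alpha)$ for some $\alpha\in(0,2)$, or that $k$ is a positive semi-definite kernel on every $\mathbb R^d$ and, in the covariance model, is continuous and satisfies (i)–(iv),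 for some functions $g_j$ and some $\delta>0$: (i) $k(x,x')=\sum_{j\ge 0}g_j(\|x\|^2,\|x'\|^2)(x^\top x')^j$ whenever $\|x\|^2,\|x'\|^2\in[1-\delta,1+\delta]$, and every $g_j$ is a positive semi-definite kernel on $[1-\delta,1+\delta]$; (ii) $x\mapsto k(x,x)$ is Lipschitz on $\{\|x\|^2\in[1-\delta,1+\delta]\}$, with a constant not depending on $d$; (iii) for $i\le M$, $g_i$ is $(M+1-i)$-times continuously differentiable in a neighbourhood of $(1,1)$; (iv) $g_J(1,1)>0$ for some $J>M$. In the sphere model it is enough that the restriction of $k$ to the unit sphere satisfies these conditions, i.e. that $k(x,x')=\sum_{j\ge0}a_j(x^\top x')^j$ for $\|x\|=\|x'\|=1$, with constants $a_j\ge0$ and $a_J>0$ for some $J>M$. *Estimator.* Let $k_n(x,x')=g(\|x\|^2/r_n,\|x'\|^2/r_n,x^\top x'/r_n)$, with reproducing kernel Hilbert space $\mathcal H_n$. For each $n$ let $x_1,\dots,x_n$ be i.i.d. with law $P_n$ (no assumption on the joint law for different $n$), let $y_i$ be drawn independently given the inputs from a conditional law $\mathbb P_n(Y\mid X=x_i)$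 with finite mean, and let $f^*_n(x)=\mathbb E[Y\mid X=x]$ satisfy $|f_n^*|\le A$ $P_n$-almost everywhere, with $A$ independent of $n$. For $\lambda_n\ge0$ let $\hat f_n$ be the minimizer over $\mathcal H_n$ of $\sum_i(y_i-f(x_i))^2+\lambda_n\|f\|_{\mathcal H_n}^2$ if $\lambda_n>0$, and the interpolant of the data of minimal norm in $\mathcal H_n$ if $\lambda_n=0$. Let $\mathbb E_Y\hat f_n$ be its conditional expectation given the inputs. *Conclusions.* 1. Almost surely, for every $\varepsilon>0$ and all sufficiently large $n$, $$\|\mathbb E_Y\hat f_n-f_n^*\|_{L_2(P_n)}^2\;\ge\;\inf_{\deg p\le m}\|f_n^*-p\|_{L_2(P_n)}^2-\varepsilon .$$ 2. If $k_n$ is bounded on the support of $P_n$ uniformly in $n$, then almost surely there are polynomials $p_n$ of degree at most $m$ (depending on the inputs) such that $\|\mathbb E_Y\hat f_n-p_n\|_{L_2(P_n)}\to0$ as $n\to\infty$. -/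

import Mathlib

open Filter Topology MeasureTheory ProbabilityTheory
open scoped NNReal ENNReal Matrix

noncomputable section

namespace PolyBarrier

/-- The input space `ℝ^d` with its Euclidean norm. -/
abbrev E (d : ℕ) : Type := EuclideanSpace ℝ (Fin d)

/-! ### Kernels -/

/-- A real kernel is positive semi-definite on `S` if all kernel matrices at finitely many points
of `S` are (symmetric and) positive semi-definite. -/
def IsPSDKernelOn {α : Type*} (S : Set α) (k : α → α → ℝ) : Prop :=
  ∀ (N : ℕ) (x : Fin N → α), (∀ i, x i ∈ S) →
    (Matrix.of fun i j => k (x i) (x j)).PosSemidef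

/-- The rotationally invariant kernel `k(x, x') = g(‖x‖², ‖x'‖², xᵀx')` on `ℝ^d`; the function `g`
is the same for all dimensions `d`. -/
def rotKernel (g : ℝ → ℝ → ℝ → ℝ) {d : ℕ} (x x' : E d) : ℝ :=
  g (‖x‖ ^ 2) (‖x'‖ ^ 2) (inner ℝ x x')

/-- The rescaled kernel `k_τ(x, x') = g(‖x‖²/τ, ‖x'‖²/τ, xᵀx'/τ)`. -/
def scaledKernel (g : ℝ → ℝ → ℝ → ℝ) (τ : ℝ) {d : ℕ} (x x' : E d) : ℝ :=
  g (‖x‖ ^ 2 / τ) (‖x'‖ ^ 2 / τ) (inner ℝ x x' / τ)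

/-- The assumptions on a rotationally invariant kernel on the whole space, with coefficient
functions `gc j` of the local power series; `M` stands for `⌊2/β⌋`. -/
structure PowerSeriesKernel (g : ℝ → ℝ → ℝ → ℝ) (gc : ℕ → ℝ → ℝ → ℝ) (M : ℕ) : Prop where
  /-- `k` is a continuous kernel on every `ℝ^d`. -/
  continuous : ∀ d : ℕ, Continuous fun p : E d × E d => rotKernel g p.1 p.2
  /-- `k` is a positive semi-definite kernel on every `ℝ^d`. -/
  posSemidef : ∀ d : ℕ, IsPSDKernelOn Set.univ (rotKernel g (d := d))
  /-- Around the unit sphere `k(x, x') = ∑ⱼ gⱼ(‖x‖², ‖x'‖²) (xᵀx')ʲ` with positive semi-definite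
  coefficients `gⱼ`. -/
  expansion : ∃ δ : ℝ, 0 < δ ∧
    (∀ j, IsPSDKernelOn (Set.Icc (1 - δ) (1 + δ)) (gc j)) ∧
    ∀ (d : ℕ) (x x' : E d), ‖x‖ ^ 2 ∈ Set.Icc (1 - δ) (1 + δ) →
      ‖x'‖ ^ 2 ∈ Set.Icc (1 - δ) (1 + δ) →
      HasSum (fun j : ℕ => gc j (‖x‖ ^ 2) (‖x'‖ ^ 2) * (inner ℝ x x') ^ j) (rotKernel g x x')
  /-- Restricted Lipschitz continuity: `x ↦ k(x, x)` is Lipschitz around the unit sphere. -/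
  lipschitz : ∃ δ : ℝ, 0 < δ ∧ ∃ L : ℝ≥0, ∀ d : ℕ,
    LipschitzOnWith L (fun x : E d => rotKernel g x x)
      {x | ‖x‖ ^ 2 ∈ Set.Icc (1 - δ) (1 + δ)}
  /-- `gᵢ` is `(M + 1 - i)`-times continuously differentiable in a neighbourhood of `(1, 1)`. -/
  smooth : ∀ i ≤ M, ∃ U ∈ 𝓝 ((1 : ℝ), (1 : ℝ)),
    ContDiffOn ℝ ((M + 1 - i : ℕ) : WithTop ℕ∞) (fun p : ℝ × ℝ => gc i p.1 p.2) U
  /-- Some coefficient of order larger than `M` is positive at `(1, 1)`. -/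
  pos : ∃ J > M, 0 < gc J 1 1

/-- The same assumptions for the restriction of the kernel to the unit sphere only. There the
coefficients `gⱼ(1, 1)` are numbers `a j`; positive semi-definiteness says `0 ≤ a j`, and
`k(x, x)` being constant, the continuity, Lipschitz and smoothness requirements are automatic.
Nothing is assumed of `k` off the unit sphere except that it is a kernel on `ℝ^d` (a kernel that is
given only on the unit sphere may be extended by zero). -/
structure SpherePowerSeriesKernel (g : ℝ → ℝ → ℝ → ℝ) (a : ℕ → ℝ) (M : ℕ) : Prop where
  posSemidef : ∀ d : ℕ, IsPSDKernelOn Set.univ (rotKernel g (d := d))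
  nonneg : ∀ j, 0 ≤ a j
  expansion : ∀ (d : ℕ) (x x' : E d), ‖x‖ = 1 → ‖x'‖ = 1 →
    HasSum (fun j : ℕ => a j * (inner ℝ x x') ^ j) (rotKernel g x x')
  pos : ∃ J > M, 0 < a J

/-- `k(x, x') = exp(-‖x - x'‖^α)` in every dimension. -/
def IsAlphaExponential (g : ℝ → ℝ → ℝ → ℝ) (α : ℝ) : Prop :=
  ∀ (d : ℕ) (x x' : E d), rotKernel g x x' = Real.exp (-‖x - x'‖ ^ α)

/-! ### Input distributions -/

/-- The spectral norm of a square matrix. -/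
def opNorm {d : ℕ} (S : Matrix (Fin d) (Fin d) ℝ) : ℝ :=
  ‖Matrix.toEuclideanCLM (n := Fin d) (𝕜 := ℝ) S‖

/-- The effective dimension `tr Σ / ‖Σ‖`. -/
def effDim {d : ℕ} (S : Matrix (Fin d) (Fin d) ℝ) : ℝ := S.trace / opNorm S

/-- The admissible laws of the i.i.d. coordinates: standard normal, or supported in `[-B, B]` with
zero mean and unit variance. -/
def IsEntryLaw (B : ℝ) (ν : Measure ℝ) : Prop :=
  ν = gaussianReal 0 1 ∨
    ((∀ᵐ w ∂ν, |w| ≤ B) ∧ ∫ w, w ∂ν = 0 ∧ ∫ w, w ^ 2 ∂ν = 1)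

/-- The law of `Σ^{1/2} W` where `W` has i.i.d. coordinates of law `ν` and `R = Σ^{1/2}`. -/
def covLaw {d : ℕ} (ν : Measure ℝ) (R : Matrix (Fin d) (Fin d) ℝ) : Measure (E d) :=
  (Measure.pi fun _ : Fin d => ν).map fun w => WithLp.toLp 2 (R *ᵥ w)

/-- The law of `√r · Z/‖Z‖` where `Z` has law `Q` (with the convention `0/0 = 0`). -/
def sphereLaw {d : ℕ} (r : ℝ) (Q : Measure (E d)) : Measure (E d) :=
  Q.map fun z => Real.sqrt r • (‖z‖⁻¹ • z)

/-- The two types of input distributions: the covariance model and its projection to the sphere. -/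
inductive DataModel
  | covariance
  | sphere

/-- The input distribution with covariance matrix `S`, whose positive semi-definite square root is
`R`, and coordinate law `ν`. -/
def DataModel.law (model : DataModel) {d : ℕ} (ν : Measure ℝ) (S R : Matrix (Fin d) (Fin d) ℝ) :
    Measure (E d) :=
  match model with
  | .covariance => covLaw ν R
  | .sphere => sphereLaw (effDim S) (covLaw ν R)

/-- The degree of the barrier: `2⌊2/β⌋` in the covariance model, `⌊2/β⌋` on the sphere. -/
def DataModel.degree (model : DataModel) (β : ℝ) : ℕ :=
  match model with
  | .covariance => 2 * ⌊2 / β⌋₊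
  | .sphere => ⌊2 / β⌋₊

/-- The kernel, respectively (sphere model) its restriction to the unit sphere, has the required
local power series, or the kernel is `α`-exponential with `α ∈ (0, 2)`. -/
def DataModel.AdmissibleKernel (model : DataModel) (β : ℝ) (g : ℝ → ℝ → ℝ → ℝ) : Prop :=
  (match model with
    | .covariance => ∃ gc : ℕ → ℝ → ℝ → ℝ, PowerSeriesKernel g gc ⌊2 / β⌋₊
    | .sphere => ∃ a : ℕ → ℝ, SpherePowerSeriesKernel g a ⌊2 / β⌋₊) ∨
  ∃ α : ℝ, 0 < α ∧ α < 2 ∧ IsAlphaExponential g α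

/-! ### Kernel regression -/

/-- A real kernel as a matrix of operators on `ℝ`. -/
def kernelMatrix {X : Type*} (k : X → X → ℝ) : Matrix X X (ℝ →L[ℝ] ℝ) :=
  Matrix.of fun x x' => k x x' • ContinuousLinearMap.id ℝ ℝ

/-- The function `f` is the kernel regression estimate with ridge parameter `lam` for the data
`(xs i, ys i)`: it is an element of the reproducing kernel Hilbert space of `k` which
for `lam > 0` minimizes `∑ᵢ (yᵢ - f(xᵢ))² + lam ‖f‖²`, and
for `lam = 0` has minimal norm among the interpolants of the data. -/
def IsKernelEstimate {X : Type*} (k : X → X → ℝ) (lam : ℝ) {n : ℕ} (xs : Fin n → X)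
    (ys : Fin n → ℝ) (f : X → ℝ) : Prop :=
  ∃ _ : Fact (kernelMatrix k).PosSemidef, ∃ F : RKHS.OfKernel (kernelMatrix k),
    (∀ x, F x = f x) ∧
    ((0 < lam ∧ ∀ G : RKHS.OfKernel (kernelMatrix k),
        ∑ i, (ys i - F (xs i)) ^ 2 + lam * ‖F‖ ^ 2 ≤ ∑ i, (ys i - G (xs i)) ^ 2 + lam * ‖G‖ ^ 2) ∨
     (lam = 0 ∧ (∀ i, F (xs i) = ys i) ∧
        ∀ G : RKHS.OfKernel (kernelMatrix k), (∀ i, G (xs i) = ys i) → ‖F‖ ≤ ‖G‖))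

open Classical in
/-- The kernel regression estimate. (If it does not exist, which can happen only for `lam = 0` and
a singular kernel matrix, the value is `0`.) -/
def kernelEstimate {X : Type*} (k : X → X → ℝ) (lam : ℝ) {n : ℕ} (xs : Fin n → X)
    (ys : Fin n → ℝ) : X → ℝ :=
  if h : ∃ f, IsKernelEstimate k lam xs ys f then h.choose else 0

/-- The ground truth `f*(x) = 𝔼[y | X = x]`, where `κ x` is the law of `y` given `X = x`. -/
def groundTruth {d : ℕ} (κ : Kernel (E d) ℝ) (x : E d) : ℝ := ∫ y, y ∂(κ x)

/-- The averaged estimator: the conditional expectation of the estimate given the inputs `xs`, over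
independent observations `yᵢ` of law `κ (xs i)`. -/
def averagedEstimate {d : ℕ} (k : E d → E d → ℝ) (lam : ℝ) (κ : Kernel (E d) ℝ) {n : ℕ}
    (xs : Fin n → E d) (x : E d) : ℝ :=
  ∫ ys : Fin n → ℝ, kernelEstimate k lam xs ys x ∂(Measure.pi fun i => κ (xs i))

/-- The bias `‖𝔼_Y f̂ - f*‖²` in `L²(P)`. -/
def bias {d : ℕ} (P : Measure (E d)) (k : E d → E d → ℝ) (lam : ℝ) (κ : Kernel (E d) ℝ) {n : ℕ}
    (xs : Fin n → E d) : ℝ≥0∞ :=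
  eLpNorm (fun x => averagedEstimate k lam κ xs x - groundTruth κ x) 2 P ^ 2

/-- The squared `L²(P)`-distance of `f` to the polynomials of degree at most `m`. -/
def polyDistSq {d : ℕ} (P : Measure (E d)) (f : E d → ℝ) (m : ℕ) : ℝ≥0∞ :=
  ⨅ (p : MvPolynomial (Fin d) ℝ) (_ : p.totalDegree ≤ m),
    eLpNorm (fun x => f x - MvPolynomial.eval (fun i => x i) p) 2 P ^ 2

end PolyBarrier

end

noncomputable section

namespace PolyBarrier

/-! ### Moments of sub-Gaussian sums -/

/-! The inputs are nearly orthogonal points on a sphere. With overwhelming probability all `‖xᵢ‖²/r`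
lie within `δ` of `1` and all `xᵢᵀxⱼ/r`, `i ≠ j`, lie within `δ` of `0`, where `δ = n^(-θ)`. The
exponent is chosen in `1/(M+1) < θ < β/2`, an interval that is nonempty because `M = ⌊2/β⌋`. The
upper bound makes `δ² r` a positive power of `n`, so that moment inequalities give failure
probabilities of any polynomial order (`DataModel.exists_concentration`). The lower bound gives `n
δ^(M+1) → 0` (`exists_threshold`).

Only two properties of the kernel matter; they are collected in `BarrierKernel`. First, at typical
points `k(x, xᵢ)` is, up to `O(δ^(M+1))`, a polynomial in `‖x‖² - 1` and `xᵀxᵢ`: Taylor terms `(‖x‖²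
- 1)^l (xᵀxᵢ)^k` with `k + l ≤ M`, hence of degree at most `2M`, and with `l = 0` on the sphere,
hence of degree at most `M`. Second, the kernel matrix is bounded below by a constant. For power
series the terms of order at most `M` are positive semi-definite and can be dropped, while the
remaining matrix has a diagonal of constant order and off-diagonal entries `O(δ^(M+1))`, so that
these perturb the form only by `O(n δ^(M+1))`. The `α`-exponential kernel gets the same lower bound
from a mixture of Gaussian kernels.

By linearity of the estimator, `𝔼_Y f̂ = ∑ αᵢ k(·, xᵢ)` with `α = (K + λ)⁻¹ f*(xs)`
(`exists_averagedEstimate_eq`). The lower bound on `K` and `|f*| ≤ A` give `‖α‖₁ ≤ √n ‖α‖₂ ≤ c⁻¹ A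
n`. Replacing every `k(·, xᵢ)` by its polynomial therefore changes the estimate at typical points by
`O(n δ^(M+1)) → 0` (`BarrierKernel.exists_polynomial`).

Atypical points have mass `O(n^(-7))`. There the polynomial is controlled by moments of `‖x‖²/r`.
For the first conclusion nothing is needed about the estimate on that set, since only `f* - p` is
integrated there (`polyDistSq_le_add`). For the second, boundedness of the kernel gives `|𝔼_Y f̂| =
O(n)`, which the small mass absorbs (`eLpNorm_sub_sq_le`). The almost sure statements come from
Borel–Cantelli, which needs no assumption on the joint law for different `n`. -/

/-- A common sub-Gaussian parameter of the admissible coordinate laws. -/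
def entryParam (B : ℝ) : ℝ≥0 := max 1 ((‖B - -B‖₊ / 2) ^ 2)

lemma HasSubgaussianMGF.mono {Ω : Type*} [MeasurableSpace Ω] {μ : Measure Ω} {X : Ω → ℝ}
    {c c' : ℝ≥0} (h : HasSubgaussianMGF X c μ) (hc : c ≤ c') : HasSubgaussianMGF X c' μ where
  integrable_exp_mul := h.integrable_exp_mul
  mgf_le t := (h.mgf_le t).trans (Real.exp_le_exp.2 (by
    have : (c : ℝ) ≤ c' := by exact_mod_cast hc
    gcongr))

lemma IsEntryLaw.hasSubgaussianMGF {B : ℝ} {ν : Measure ℝ} [IsProbabilityMeasure ν]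
    (h : IsEntryLaw B ν) : HasSubgaussianMGF id (entryParam B) ν := by
  rcases h with rfl | ⟨hb, hm, -⟩
  · refine HasSubgaussianMGF.mono (c := 1) ?_ (le_max_left _ _)
    refine ⟨fun t => integrable_exp_mul_gaussianReal t, fun t => ?_⟩
    rw [mgf_gaussianReal (μ := 0) (v := 1) (by simp)]
    simp
  · refine HasSubgaussianMGF.mono ?_ (le_max_right _ _)
    refine hasSubgaussianMGF_of_mem_Icc_of_integral_eq_zero aemeasurable_id ?_ hm
    filter_upwards [hb] with w hw
    exact ⟨(abs_le.1 hw).1, (abs_le.1 hw).2⟩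

lemma IsEntryLaw.integral_id {B : ℝ} {ν : Measure ℝ} (h : IsEntryLaw B ν) : ∫ w, w ∂ν = 0 := by
  rcases h with rfl | ⟨-, hm, -⟩
  · simp
  · exact hm

lemma IsEntryLaw.integral_sq {B : ℝ} {ν : Measure ℝ} (h : IsEntryLaw B ν) :
    ∫ w, w ^ 2 ∂ν = 1 := by
  rcases h with rfl | ⟨-, -, hv⟩
  · have h1 := variance_fun_id_gaussianReal (μ := 0) (v := 1)
    rw [variance_eq_integral (by fun_prop)] at h1
    simpa using h1
  · exact hv

/-- The constant in the moment bound for sub-Gaussian variables. -/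
def momentConst (q : ℕ) : ℝ := 2 * (2 * q).factorial * Real.exp (1 / 2)

lemma momentConst_pos (q : ℕ) : 0 < momentConst q := by
  unfold momentConst; positivity

lemma one_le_momentConst (q : ℕ) : 1 ≤ momentConst q := by
  unfold momentConst
  have h1 : (1 : ℝ) ≤ (2 * q).factorial := by exact_mod_cast (2 * q).factorial_pos
  have h2 : (1 : ℝ) ≤ Real.exp (1 / 2) := Real.one_le_exp (by norm_num)
  nlinarith

/-- `y^(2q)/(2q)! ≤ e^|y| ≤ e^y + e^(-y)` at `y = X/√c`. This scaling turns the bound on the moment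
generating function into the constant `e^(1/2)`, so `c` enters only through the factor `c^q`. -/
lemma lintegral_even_pow_le {Ω : Type*} [MeasurableSpace Ω] {μ : Measure Ω}
    [IsProbabilityMeasure μ] {X : Ω → ℝ} {c : ℝ≥0} (h : HasSubgaussianMGF X c μ) (q : ℕ) :
    ∫⁻ ω, ENNReal.ofReal (X ω ^ (2 * q)) ∂μ ≤ ENNReal.ofReal (momentConst q * (c : ℝ) ^ q) := by
  rcases eq_or_ne c 0 with rfl | hc
  · have h0 := h.ae_eq_zero_of_hasSubgaussianMGF_zero
    rw [lintegral_congr_ae (g := fun _ => ENNReal.ofReal ((0 : ℝ) ^ (2 * q)))]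
    · rw [lintegral_const, measure_univ, mul_one]
      apply ENNReal.ofReal_le_ofReal
      rcases Nat.eq_zero_or_pos q with rfl | hq
      · simpa using one_le_momentConst 0
      · simp [hq.ne']
    · filter_upwards [h0] with ω hω
      simp [hω]
  · have hc0 : 0 < (c : ℝ) := by positivity
    set s := Real.sqrt c with hs
    have hs0 : 0 < s := Real.sqrt_pos.2 hc0
    have hs2 : s ^ 2 = c := Real.sq_sqrt hc0.le
    have hpt : ∀ ω, X ω ^ (2 * q) ≤ (2 * q).factorial * (c : ℝ) ^ q *
        (Real.exp (s⁻¹ * X ω) + Real.exp (-s⁻¹ * X ω)) := by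
      intro ω
      have h1 := Real.pow_div_factorial_le_exp (|s⁻¹ * X ω|) (abs_nonneg _) (2 * q)
      have h2 : Real.exp |s⁻¹ * X ω| ≤ Real.exp (s⁻¹ * X ω) + Real.exp (-s⁻¹ * X ω) := by
        rcases abs_cases (s⁻¹ * X ω) with ⟨h, -⟩ | ⟨h, -⟩ <;> rw [h]
        · linarith [Real.exp_pos (-s⁻¹ * X ω)]
        · rw [← neg_mul]; linarith [Real.exp_pos (s⁻¹ * X ω)]
      have h3 : |s⁻¹ * X ω| ^ (2 * q) = X ω ^ (2 * q) / (c : ℝ) ^ q := by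
        rw [pow_mul, sq_abs, mul_pow, inv_pow, hs2, mul_pow, pow_mul, inv_pow]; field_simp
      have h4 : (0 : ℝ) < (2 * q).factorial := by positivity
      have h5 : 0 < (c : ℝ) ^ q := by positivity
      rw [h3, div_div, div_le_iff₀ (by positivity)] at h1
      calc X ω ^ (2 * q) ≤ Real.exp |s⁻¹ * X ω| * ((c : ℝ) ^ q * (2 * q).factorial) := h1
        _ ≤ (Real.exp (s⁻¹ * X ω) + Real.exp (-s⁻¹ * X ω)) *
            ((c : ℝ) ^ q * (2 * q).factorial) := by gcongr
        _ = _ := by ring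
    have hi1 := h.integrable_exp_mul s⁻¹
    have hi2 := h.integrable_exp_mul (-s⁻¹)
    have hm1 := h.mgf_le s⁻¹
    have hm2 := h.mgf_le (-s⁻¹)
    have he : (c : ℝ) * s⁻¹ ^ 2 / 2 = 1 / 2 := by rw [inv_pow, hs2]; field_simp
    have he' : (c : ℝ) * (-s⁻¹) ^ 2 / 2 = 1 / 2 := by rw [neg_sq, he]
    rw [he] at hm1
    rw [he'] at hm2
    calc ∫⁻ ω, ENNReal.ofReal (X ω ^ (2 * q)) ∂μ
        ≤ ∫⁻ ω, ENNReal.ofReal ((2 * q).factorial * (c : ℝ) ^ q *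
          (Real.exp (s⁻¹ * X ω) + Real.exp (-s⁻¹ * X ω))) ∂μ :=
          lintegral_mono fun ω => ENNReal.ofReal_le_ofReal (hpt ω)
      _ = ENNReal.ofReal (∫ ω, (2 * q).factorial * (c : ℝ) ^ q *
          (Real.exp (s⁻¹ * X ω) + Real.exp (-s⁻¹ * X ω)) ∂μ) := by
          rw [ofReal_integral_eq_lintegral_ofReal]
          · exact (hi1.add hi2).const_mul _
          · exact ae_of_all _ fun ω => by positivity
      _ ≤ _ := by
          apply ENNReal.ofReal_le_ofReal
          rw [integral_const_mul, integral_add hi1 hi2]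
          have h6 : ∫ ω, Real.exp (s⁻¹ * X ω) ∂μ ≤ Real.exp (1 / 2) := hm1
          have h7 : ∫ ω, Real.exp (-s⁻¹ * X ω) ∂μ ≤ Real.exp (1 / 2) := hm2
          calc _ ≤ (2 * q).factorial * (c : ℝ) ^ q * (Real.exp (1 / 2) + Real.exp (1 / 2)) := by
                gcongr
            _ = _ := by unfold momentConst; ring

section Pi

variable {ι : Type*} [Fintype ι]

lemma hasSubgaussianMGF_sum_pi {ν : Measure ℝ} [IsProbabilityMeasure ν] {c : ℝ≥0}
    (h : HasSubgaussianMGF id c ν) (a : ι → ℝ) :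
    HasSubgaussianMGF (fun w : ι → ℝ => ∑ i, a i * w i) ((∑ i, ‖a i‖₊ ^ 2) * c)
      (Measure.pi fun _ => ν) := by
  rw [Finset.sum_mul]
  refine HasSubgaussianMGF.sum_of_iIndepFun (X := fun i (w : ι → ℝ) => a i * w i)
    (c := fun i => ‖a i‖₊ ^ 2 * c) ?_ fun i _ => ?_
  · exact iIndepFun_pi (X := fun i x => a i * x) fun i => by fun_prop
  · have h1 : HasSubgaussianMGF (fun w : ι → ℝ => w i) c (Measure.pi fun _ => ν) := by
      refine HasSubgaussianMGF.of_map (X := id) (Y := fun w : ι → ℝ => w i)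
        (measurable_pi_apply i).aemeasurable ?_
      rwa [(measurePreserving_eval (fun _ : ι => ν) i).map_eq]
    have he : ‖a i‖₊ ^ 2 = NNReal.mk (a i ^ 2) (sq_nonneg _) := by
      ext
      simp [sq_abs]
    rw [he]
    exact h1.const_mul (a i)

lemma coe_sum_nnnorm_sq (a : ι → ℝ) : ((∑ i, ‖a i‖₊ ^ 2 : ℝ≥0) : ℝ) = ∑ i, a i ^ 2 := by
  push_cast
  simp

lemma lintegral_sum_pi_even_pow_le {ν : Measure ℝ} [IsProbabilityMeasure ν] {c : ℝ≥0}
    (h : HasSubgaussianMGF id c ν) (a : ι → ℝ) (q : ℕ) :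
    ∫⁻ w, ENNReal.ofReal ((∑ i, a i * w i) ^ (2 * q)) ∂(Measure.pi fun _ => ν) ≤
      ENNReal.ofReal (momentConst q * ((∑ i, a i ^ 2) * c) ^ q) := by
  have := lintegral_even_pow_le (hasSubgaussianMGF_sum_pi h a) q
  rwa [NNReal.coe_mul, coe_sum_nnnorm_sq] at this

/-! ### Symmetrization -/

/-- The uniform law on the signs `{1, -1}`. -/
def signLaw : Measure ℝ := (2⁻¹ : ℝ≥0∞) • (Measure.dirac 1 + Measure.dirac (-1))

instance : IsProbabilityMeasure signLaw := ⟨by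
  simp only [signLaw, Measure.smul_apply, Measure.add_apply, measure_univ, smul_eq_mul]
  rw [one_add_one_eq_two]
  exact ENNReal.inv_mul_cancel (by norm_num) (by norm_num)⟩

lemma ae_signLaw : ∀ᵐ e ∂signLaw, e = 1 ∨ e = -1 := by
  have h : ∀ᵐ e ∂(Measure.dirac (1 : ℝ) + Measure.dirac (-1)), e = 1 ∨ e = -1 := by
    rw [ae_add_measure_iff]
    constructor <;> rw [ae_dirac_iff (by measurability)] <;> simp
  exact Measure.ae_smul_measure h _

lemma hasSubgaussianMGF_signLaw : HasSubgaussianMGF id 1 signLaw := by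
  have h := hasSubgaussianMGF_of_mem_Icc_of_integral_eq_zero (μ := signLaw) (X := id) (a := -1)
    (b := 1) aemeasurable_id ?_ ?_
  · convert h using 1
    ext; norm_num
  · filter_upwards [ae_signLaw] with e he
    rcases he with rfl | rfl <;> simp
  · rw [signLaw, integral_smul_measure, integral_add_measure (integrable_dirac (by simp))
      (integrable_dirac (by simp))]
    simp

lemma ae_pi_signLaw : ∀ᵐ e ∂(Measure.pi fun _ : ι => signLaw), ∀ i, e i = 1 ∨ e i = -1 := by
  rw [ae_all_iff]
  intro i
  exact (measurePreserving_eval (fun _ : ι => signLaw) i).quasiMeasurePreserving.ae ae_signLaw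

/-- Exchange of the coordinates in `A` between two vectors. -/
def swapOn (A : ι → Prop) [DecidablePred A] (p : (ι → ℝ) × (ι → ℝ)) : (ι → ℝ) × (ι → ℝ) :=
  (fun i => if A i then p.2 i else p.1 i, fun i => if A i then p.1 i else p.2 i)

/-- On vectors of pairs the map acts coordinatewise, as the swap or as the identity, and both
preserve `ν ⊗ ν`. -/
lemma measurePreserving_swapOn (ν : Measure ℝ) [IsProbabilityMeasure ν] (A : ι → Prop)
    [DecidablePred A] :
    MeasurePreserving (swapOn A) ((Measure.pi fun _ : ι => ν).prod (Measure.pi fun _ : ι => ν))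
      ((Measure.pi fun _ : ι => ν).prod (Measure.pi fun _ : ι => ν)) := by
  have he := measurePreserving_arrowProdEquivProdArrow ℝ ℝ ι (fun _ => ν) (fun _ => ν)
  have hp : MeasurePreserving (fun (p : ι → ℝ × ℝ) i => if A i then (p i).swap else p i)
      (Measure.pi fun _ : ι => ν.prod ν) (Measure.pi fun _ : ι => ν.prod ν) := by
    refine measurePreserving_pi (fun _ : ι => ν.prod ν) (fun _ : ι => ν.prod ν)
      (f := fun i x => if A i then x.swap else x) fun i => ?_
    by_cases h : A i
    · simpa [h] using Measure.measurePreserving_swap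
    · simp only [h, if_false]
      exact MeasurePreserving.id _
  have := (he.comp hp).comp he.symm
  convert this using 1
  funext p
  refine Prod.ext ?_ ?_ <;> funext i <;>
  · simp only [swapOn, Function.comp, MeasurableEquiv.arrowProdEquivProdArrow,
      Equiv.arrowProdEquivProdArrow]
    by_cases h : A i <;> simp [h, MeasurableEquiv.symm]

end Pi

/-! ### Even moments of centered quadratic forms -/

section Quadratic

variable {ι : Type*} [Fintype ι]

/-- Jensen for `t ↦ t^q` with weights `ρᵢ/T` at the points `uᵢ² bᵢ²/ρᵢ`, then `2ab ≤ a² + b²`. The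
second step separates `u` from `b`, which is needed because they will be dependent random variables.
-/
lemma sum_mul_sq_pow_le (u b ρ : ι → ℝ) (hρ : ∀ i, 0 ≤ ρ i) (hb : ∀ i, ρ i = 0 → b i = 0)
    (hT : 0 < ∑ i, ρ i) (q : ℕ) :
    (∑ i, (u i * b i) ^ 2) ^ q ≤ ∑ i, ((∑ j, ρ j) ^ q * (ρ i / ∑ j, ρ j) / 2) *
      (u i ^ (2 * (2 * q)) + b i ^ (2 * (2 * q)) * (ρ i ^ (2 * q))⁻¹) := by
  set T := ∑ i, ρ i
  have h1 : ∑ i, (u i * b i) ^ 2 = T * ∑ i, ρ i / T * (u i ^ 2 * (b i ^ 2 * (ρ i)⁻¹)) := by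
    rw [Finset.mul_sum]
    refine Finset.sum_congr rfl fun i _ => ?_
    rcases eq_or_ne (ρ i) 0 with h | h
    · simp [h, hb i h]
    · field_simp
  have h2 := Real.pow_arith_mean_le_arith_mean_pow Finset.univ (fun i => ρ i / T)
    (fun i => u i ^ 2 * (b i ^ 2 * (ρ i)⁻¹)) (fun i _ => div_nonneg (hρ i) hT.le)
    (by rw [← Finset.sum_div, div_self hT.ne'])
    (fun i _ => mul_nonneg (sq_nonneg _) (mul_nonneg (sq_nonneg _) (inv_nonneg.2 (hρ i)))) q
  rw [h1, mul_pow]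
  calc _ ≤ T ^ q * ∑ i, ρ i / T * (u i ^ 2 * (b i ^ 2 * (ρ i)⁻¹)) ^ q := by gcongr
    _ ≤ _ := by
      rw [Finset.mul_sum]
      refine Finset.sum_le_sum fun i _ => ?_
      have h3 : (u i ^ 2 * (b i ^ 2 * (ρ i)⁻¹)) ^ q ≤
          (u i ^ (2 * (2 * q)) + b i ^ (2 * (2 * q)) * (ρ i ^ (2 * q))⁻¹) / 2 := by
        have := two_mul_le_add_sq ((u i ^ 2) ^ q) ((b i ^ 2 * (ρ i)⁻¹) ^ q)
        have e1 : ((u i ^ 2) ^ q) ^ 2 = u i ^ (2 * (2 * q)) := by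
          rw [← pow_mul, ← pow_mul]; ring_nf
        have e2 : ((b i ^ 2 * (ρ i)⁻¹) ^ q) ^ 2 = b i ^ (2 * (2 * q)) * (ρ i ^ (2 * q))⁻¹ := by
          rw [← pow_mul, mul_pow, ← pow_mul, inv_pow]; ring_nf
        rw [e1, e2] at this
        rw [mul_pow]
        linarith
      have h4 : 0 ≤ T ^ q * (ρ i / T) := mul_nonneg (by positivity) (div_nonneg (hρ i) hT.le)
      calc T ^ q * (ρ i / T * (u i ^ 2 * (b i ^ 2 * (ρ i)⁻¹)) ^ q)
          = T ^ q * (ρ i / T) * (u i ^ 2 * (b i ^ 2 * (ρ i)⁻¹)) ^ q := by ring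
        _ ≤ T ^ q * (ρ i / T) *
          ((u i ^ (2 * (2 * q)) + b i ^ (2 * (2 * q)) * (ρ i ^ (2 * q))⁻¹) / 2) := by gcongr
        _ = _ := by ring

variable {ν : Measure ℝ} [IsProbabilityMeasure ν] {c : ℝ≥0}

/-- Exchanging the `i`-th coordinates of the two vectors flips the sign of their difference and
leaves their sum alone. Signs can thus be inserted in front of the summands without changing the
law. -/
lemma lintegral_signed_sum_eq (S : Matrix ι ι ℝ) (q : ℕ) (e : ι → ℝ)
    (he : ∀ i, e i = 1 ∨ e i = -1) :
    ∫⁻ p, ENNReal.ofReal ((∑ i, ((p.1 i - p.2 i) * ∑ j, S i j * (p.1 j + p.2 j)) * e i) ^ (2 * q))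
      ∂((Measure.pi fun _ : ι => ν).prod (Measure.pi fun _ : ι => ν)) =
    ∫⁻ p, ENNReal.ofReal ((∑ i, (p.1 i - p.2 i) * ∑ j, S i j * (p.1 j + p.2 j)) ^ (2 * q))
      ∂((Measure.pi fun _ : ι => ν).prod (Measure.pi fun _ : ι => ν)) := by
  classical
  rw [← (measurePreserving_swapOn ν fun i => e i = -1).lintegral_comp
    (f := fun p => ENNReal.ofReal ((∑ i, (p.1 i - p.2 i) *
      ∑ j, S i j * (p.1 j + p.2 j)) ^ (2 * q))) (by fun_prop)]
  congr 1
  funext p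
  congr 2
  refine Finset.sum_congr rfl fun i _ => ?_
  have h1 : ∀ j, (swapOn (fun i => e i = -1) p).1 j + (swapOn (fun i => e i = -1) p).2 j =
      p.1 j + p.2 j := by
    intro j
    simp only [swapOn]
    split_ifs <;> ring
  have h2 : (swapOn (fun i => e i = -1) p).1 i - (swapOn (fun i => e i = -1) p).2 i =
      (p.1 i - p.2 i) * e i := by
    simp only [swapOn]
    rcases he i with h | h
    · have h' : e i ≠ -1 := by rw [h]; norm_num
      rw [if_neg h', if_neg h', h, mul_one]
    · rw [if_pos h, if_pos h, h]; ring
  simp_rw [h1, h2]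
  ring

/-- After random signs are inserted, the expression is, for a fixed pair, a sign sum with
coefficients `uᵢ bᵢ`, where `u = w - w'` and `b = S(w + w')`; its moments are bounded by powers of
`∑ (uᵢ bᵢ)²`. The variables `uᵢ` and `bᵢ` are sub-Gaussian with parameters `2c` and `2cρᵢ`, where
`ρᵢ` is the squared norm of row `i`. Using the weights `ρᵢ` in `sum_mul_sq_pow_le` makes all
summands scale alike and yields the Frobenius norm. -/
lemma lintegral_bilinear_even_pow_le (h : HasSubgaussianMGF id c ν) (S : Matrix ι ι ℝ) (q : ℕ) :
    ∫⁻ p, ENNReal.ofReal ((∑ i, (p.1 i - p.2 i) * ∑ j, S i j * (p.1 j + p.2 j)) ^ (2 * q))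
      ∂((Measure.pi fun _ : ι => ν).prod (Measure.pi fun _ : ι => ν)) ≤
    ENNReal.ofReal (momentConst q * (momentConst (2 * q) * (2 * c) ^ (2 * q)) *
      (∑ i, ∑ j, S i j ^ 2) ^ q) := by
  classical
  set π := (Measure.pi fun _ : ι => ν) with hπ
  set T := ∑ i, ∑ j, S i j ^ 2 with hT
  have hT0 : 0 ≤ T := Finset.sum_nonneg fun i _ => Finset.sum_nonneg fun j _ => sq_nonneg _
  have hK1 := one_le_momentConst q
  have hK2 := one_le_momentConst (2 * q)
  rcases hT0.eq_or_lt with hT1 | hT1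
  -- The case `T = 0` is treated apart because the weights `ρᵢ/T` would not sum to one.
  · have hS : ∀ i j, S i j = 0 := by
      intro i j
      have h1 := (Finset.sum_eq_zero_iff_of_nonneg
        (fun i _ => Finset.sum_nonneg fun j _ => sq_nonneg (S i j))).1 hT1.symm i (Finset.mem_univ _)
      have h2 := (Finset.sum_eq_zero_iff_of_nonneg
        (fun j _ => sq_nonneg (S i j))).1 h1 j (Finset.mem_univ _)
      exact pow_eq_zero_iff two_ne_zero |>.1 h2
    simp only [hS, zero_mul, Finset.sum_const_zero, mul_zero, lintegral_const, measure_univ,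
      mul_one, ← hT1]
    apply ENNReal.ofReal_le_ofReal
    rcases Nat.eq_zero_or_pos q with rfl | hq
    · simp only [mul_zero, pow_zero, mul_one]
      simp only [mul_zero] at hK2
      nlinarith
    · simp [hq.ne']
  -- averaging over the signs
  have hsg : ∫⁻ p, ENNReal.ofReal ((∑ i, (p.1 i - p.2 i) *
        ∑ j, S i j * (p.1 j + p.2 j)) ^ (2 * q)) ∂(π.prod π) =
      ∫⁻ e, ∫⁻ p, ENNReal.ofReal ((∑ i, ((p.1 i - p.2 i) *
        ∑ j, S i j * (p.1 j + p.2 j)) * e i) ^ (2 * q)) ∂(π.prod π)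
        ∂(Measure.pi fun _ : ι => signLaw) := by
    have : ∀ᵐ e ∂(Measure.pi fun _ : ι => signLaw),
        ∫⁻ p, ENNReal.ofReal ((∑ i, ((p.1 i - p.2 i) *
        ∑ j, S i j * (p.1 j + p.2 j)) * e i) ^ (2 * q)) ∂(π.prod π) =
        ∫⁻ p, ENNReal.ofReal ((∑ i, (p.1 i - p.2 i) *
        ∑ j, S i j * (p.1 j + p.2 j)) ^ (2 * q)) ∂(π.prod π) := by
      filter_upwards [ae_pi_signLaw] with e he
      exact lintegral_signed_sum_eq S q e he
    rw [lintegral_congr_ae this, lintegral_const, measure_univ, mul_one]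
  rw [hsg, lintegral_lintegral_swap (by fun_prop)]
  set ρ : ι → ℝ := fun i => ∑ j, S i j ^ 2 with hρ
  have hρ0 : ∀ i, 0 ≤ ρ i := fun i => Finset.sum_nonneg fun j _ => sq_nonneg _
  have hstep : ∀ p : (ι → ℝ) × (ι → ℝ), ∫⁻ e, ENNReal.ofReal ((∑ i, ((p.1 i - p.2 i) *
        ∑ j, S i j * (p.1 j + p.2 j)) * e i) ^ (2 * q)) ∂(Measure.pi fun _ : ι => signLaw) ≤
      ∑ i, ENNReal.ofReal (momentConst q * (T ^ q * (ρ i / T) / 2)) *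
        (ENNReal.ofReal ((p.1 i - p.2 i) ^ (2 * (2 * q))) +
          ENNReal.ofReal ((∑ j, S i j * (p.1 j + p.2 j)) ^ (2 * (2 * q))) *
          ENNReal.ofReal ((ρ i ^ (2 * q))⁻¹)) := by
    intro p
    refine (lintegral_sum_pi_even_pow_le hasSubgaussianMGF_signLaw _ q).trans ?_
    simp only [NNReal.coe_one, mul_one]
    have hb : ∀ i, ρ i = 0 → ∑ j, S i j * (p.1 j + p.2 j) = 0 := by
      intro i hi
      refine Finset.sum_eq_zero fun j _ => ?_
      have h2 := (Finset.sum_eq_zero_iff_of_nonneg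
        (fun j _ => sq_nonneg (S i j))).1 hi j (Finset.mem_univ _)
      rw [pow_eq_zero_iff two_ne_zero |>.1 h2, zero_mul]
    have := sum_mul_sq_pow_le (fun i => p.1 i - p.2 i) (fun i => ∑ j, S i j * (p.1 j + p.2 j)) ρ
      hρ0 hb hT1 q
    have hmain := mul_le_mul_of_nonneg_left this (momentConst_pos q).le
    refine (ENNReal.ofReal_le_ofReal hmain).trans ?_
    have hev : ∀ x : ℝ, 0 ≤ x ^ (2 * (2 * q)) := fun x => by rw [pow_mul]; positivity
    have hq0 := (momentConst_pos q).le
    rw [Finset.mul_sum, ENNReal.ofReal_sum_of_nonneg]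
    · refine Finset.sum_le_sum fun i _ => ?_
      rw [← mul_assoc, ENNReal.ofReal_mul, ENNReal.ofReal_add (hev _), ENNReal.ofReal_mul (hev _)]
      · exact mul_nonneg (hev _) (inv_nonneg.2 (pow_nonneg (hρ0 i) _))
      · have := hρ0 i
        positivity
    · intro i _
      have h1 := hρ0 i
      have h2 := hev (p.1 i - p.2 i)
      have h3 := hev (∑ j, S i j * (p.1 j + p.2 j))
      positivity
  refine (lintegral_mono hstep).trans ?_
  rw [lintegral_finsetSum' _ (fun i _ => by fun_prop)]
  have hfst : ∀ a : ι → ℝ, HasSubgaussianMGF (fun p : (ι → ℝ) × (ι → ℝ) => ∑ i, a i * p.1 i)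
      ((∑ i, ‖a i‖₊ ^ 2) * c) (π.prod π) := by
    intro a
    refine HasSubgaussianMGF.of_map (X := fun w : ι → ℝ => ∑ i, a i * w i)
      measurable_fst.aemeasurable ?_
    rw [Measure.map_fst_prod, measure_univ, one_smul]
    exact hasSubgaussianMGF_sum_pi h a
  have hsnd : ∀ a : ι → ℝ, HasSubgaussianMGF (fun p : (ι → ℝ) × (ι → ℝ) => ∑ i, a i * p.2 i)
      ((∑ i, ‖a i‖₊ ^ 2) * c) (π.prod π) := by
    intro a
    refine HasSubgaussianMGF.of_map (X := fun w : ι → ℝ => ∑ i, a i * w i)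
      measurable_snd.aemeasurable ?_
    rw [Measure.map_snd_prod, measure_univ, one_smul]
    exact hasSubgaussianMGF_sum_pi h a
  have hind : ∀ a : ι → ℝ, IndepFun (fun p : (ι → ℝ) × (ι → ℝ) => ∑ i, a i * p.1 i)
      (fun p : (ι → ℝ) × (ι → ℝ) => ∑ i, a i * p.2 i) (π.prod π) := fun a =>
    indepFun_prod (X := fun w : ι → ℝ => ∑ i, a i * w i)
      (Y := fun w : ι → ℝ => ∑ i, a i * w i) (by fun_prop) (by fun_prop)
  have hu : ∀ i, ∫⁻ p, ENNReal.ofReal ((p.1 i - p.2 i) ^ (2 * (2 * q))) ∂(π.prod π) ≤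
      ENNReal.ofReal (momentConst (2 * q) * (2 * c) ^ (2 * q)) := by
    intro i
    have h1 := (hfst (Pi.single i 1)).sub_of_indepFun (hsnd (Pi.single i 1)) (hind _)
    have h2 := lintegral_even_pow_le h1 (2 * q)
    have h3 : ∑ j, ‖(Pi.single i 1 : ι → ℝ) j‖₊ ^ 2 = 1 := by
      rw [Finset.sum_eq_single i]
      · simp
      · intro j _ hj; simp [hj]
      · simp
    rw [h3] at h2
    simpa [Pi.single_apply, two_mul] using h2
  have hv : ∀ i, ∫⁻ p, ENNReal.ofReal ((∑ j, S i j * (p.1 j + p.2 j)) ^ (2 * (2 * q)))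
      ∂(π.prod π) ≤ ENNReal.ofReal (momentConst (2 * q) * (2 * c) ^ (2 * q) * ρ i ^ (2 * q)) := by
    intro i
    have h1 := (hfst (S i)).add_of_indepFun (hsnd (S i)) (hind _)
    have h2 := lintegral_even_pow_le h1 (2 * q)
    rw [NNReal.coe_add, NNReal.coe_mul, coe_sum_nnnorm_sq] at h2
    have h3 : (∑ j, S i j ^ 2) * (c : ℝ) + (∑ j, S i j ^ 2) * c = 2 * c * ρ i := by
      rw [hρ]; ring
    rw [h3, mul_pow _ (ρ i), ← mul_assoc (momentConst _)] at h2
    simpa only [mul_add, Finset.sum_add_distrib] using h2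
  have hterm : ∀ i, ∫⁻ p, ENNReal.ofReal (momentConst q * (T ^ q * (ρ i / T) / 2)) *
        (ENNReal.ofReal ((p.1 i - p.2 i) ^ (2 * (2 * q))) +
          ENNReal.ofReal ((∑ j, S i j * (p.1 j + p.2 j)) ^ (2 * (2 * q))) *
          ENNReal.ofReal ((ρ i ^ (2 * q))⁻¹)) ∂(π.prod π) ≤
      ENNReal.ofReal (momentConst q * (T ^ q * (ρ i / T)) *
        (momentConst (2 * q) * (2 * c) ^ (2 * q))) := by
    intro i
    have hC : 0 ≤ momentConst (2 * q) * (2 * c) ^ (2 * q) :=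
      mul_nonneg (momentConst_pos _).le (by positivity)
    have hA : 0 ≤ momentConst q * (T ^ q * (ρ i / T) / 2) :=
      mul_nonneg (momentConst_pos _).le
        (div_nonneg (mul_nonneg (by positivity) (div_nonneg (hρ0 i) hT0)) (by norm_num))
    rw [lintegral_const_mul' _ _ ENNReal.ofReal_ne_top, lintegral_add_left (by fun_prop),
      lintegral_mul_const' _ _ ENNReal.ofReal_ne_top]
    calc _ ≤ ENNReal.ofReal (momentConst q * (T ^ q * (ρ i / T) / 2)) *
          (ENNReal.ofReal (momentConst (2 * q) * (2 * c) ^ (2 * q)) +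
          ENNReal.ofReal (momentConst (2 * q) * (2 * c) ^ (2 * q) * ρ i ^ (2 * q)) *
          ENNReal.ofReal ((ρ i ^ (2 * q))⁻¹)) := by
          gcongr
          · exact hu i
          · exact hv i
      _ ≤ ENNReal.ofReal (momentConst q * (T ^ q * (ρ i / T) / 2)) *
          (ENNReal.ofReal (momentConst (2 * q) * (2 * c) ^ (2 * q)) +
          ENNReal.ofReal (momentConst (2 * q) * (2 * c) ^ (2 * q))) := by
          gcongr
          rw [← ENNReal.ofReal_mul (mul_nonneg hC (pow_nonneg (hρ0 i) _))]
          apply ENNReal.ofReal_le_ofReal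
          rw [mul_assoc]
          refine mul_le_of_le_one_right hC ?_
          -- An inequality suffices and covers zero rows, where the inverse is `0` by convention.
          exact mul_inv_le_one
      _ = _ := by
          rw [← ENNReal.ofReal_add hC hC, ← ENNReal.ofReal_mul hA]
          congr 1
          ring
  refine (Finset.sum_le_sum fun i _ => hterm i).trans (le_of_eq ?_)
  rw [← ENNReal.ofReal_sum_of_nonneg]
  · congr 1
    rw [← Finset.sum_mul, ← Finset.mul_sum, ← Finset.mul_sum, ← Finset.sum_div,
      div_self hT1.ne']
    ring
  · intro i _
    exact mul_nonneg (mul_nonneg (momentConst_pos _).le (mul_nonneg (by positivity)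
      (div_nonneg (hρ0 i) hT0))) (mul_nonneg (momentConst_pos _).le (by positivity))

lemma ofReal_even_pow (x : ℝ) (q : ℕ) : ENNReal.ofReal (x ^ (2 * q)) = ‖x‖ₑ ^ (2 * q) := by
  rw [Real.enorm_eq_ofReal_abs, ← ENNReal.ofReal_pow (abs_nonneg x), pow_mul, pow_mul, sq_abs]

lemma lintegral_enorm_pow_le {Ω : Type*} [MeasurableSpace Ω] {μ : Measure Ω}
    [IsProbabilityMeasure μ] {f : Ω → ℝ} (hf : AEStronglyMeasurable f μ) (n : ℕ) :
    (∫⁻ ω, ‖f ω‖ₑ ∂μ) ^ n ≤ ∫⁻ ω, ‖f ω‖ₑ ^ n ∂μ := by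
  rcases Nat.eq_zero_or_pos n with rfl | hn
  · simp
  have h1 := eLpNorm_le_eLpNorm_of_exponent_le (p := 1) (q := ((n : ℝ≥0) : ℝ≥0∞)) (μ := μ)
    (by exact_mod_cast hn) hf
  have h2 := eLpNorm_nnreal_pow_eq_lintegral (f := f) (μ := μ) (p := (n : ℝ≥0))
    (by exact_mod_cast hn.ne')
  simp only [NNReal.coe_natCast, ENNReal.rpow_natCast] at h2
  rw [eLpNorm_one_eq_lintegral_enorm] at h1
  rw [← h2]
  gcongr

lemma integral_quadratic {B : ℝ} (h : IsEntryLaw B ν) (S : Matrix ι ι ℝ) :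
    Integrable (fun w : ι → ℝ => ∑ i, w i * ∑ j, S i j * w j) (Measure.pi fun _ => ν) ∧
    ∫ w : ι → ℝ, ∑ i, w i * ∑ j, S i j * w j ∂(Measure.pi fun _ => ν) = S.trace := by
  classical
  have hsub := h.hasSubgaussianMGF
  have hL2 : ∀ i : ι, MemLp (fun w : ι → ℝ => w i) 2 (Measure.pi fun _ : ι => ν) := by
    intro i
    have := hsub.memLp 2
    exact this.comp_measurePreserving (measurePreserving_eval (fun _ : ι => ν) i)
  have hint : ∀ i j : ι, Integrable (fun w : ι → ℝ => S i j * (w i * w j))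
      (Measure.pi fun _ : ι => ν) := fun i j =>
    ((hL2 i).integrable_mul (hL2 j)).const_mul _
  have hval : ∀ i j : ι, ∫ w : ι → ℝ, w i * w j ∂(Measure.pi fun _ : ι => ν) =
      if i = j then 1 else 0 := by
    intro i j
    split_ifs with hij
    · subst hij
      have := integral_comp_eval (μ := fun _ : ι => ν) (i := i) (f := fun x : ℝ => x ^ 2)
        (by fun_prop)
      simp only [← sq]
      rw [this, h.integral_sq]
    · have hi : iIndepFun (fun i (w : ι → ℝ) => w i) (Measure.pi fun _ : ι => ν) :=
        iIndepFun_pi (X := fun _ => id) fun i => aemeasurable_id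
      have hij' := hi.indepFun hij
      have h1 : ∫ w : ι → ℝ, w i ∂(Measure.pi fun _ : ι => ν) = 0 := by
        have := integral_comp_eval (μ := fun _ : ι => ν) (i := i) (f := fun x : ℝ => x)
          (by fun_prop)
        rw [this, h.integral_id]
      have := hij'.integral_mul_eq_mul_integral (hL2 i).1 (hL2 j).1
      simp only [Pi.mul_apply] at this
      rw [show (∫ w : ι → ℝ, w i * w j ∂(Measure.pi fun _ : ι => ν)) = _ from this, h1, zero_mul]
  have heq : (fun w : ι → ℝ => ∑ i, w i * ∑ j, S i j * w j) =
      fun w => ∑ i, ∑ j, S i j * (w i * w j) := by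
    funext w
    refine Finset.sum_congr rfl fun i _ => ?_
    rw [Finset.mul_sum]
    refine Finset.sum_congr rfl fun j _ => by ring
  rw [heq]
  refine ⟨integrable_finsetSum _ fun i _ => integrable_finsetSum _ fun j _ => hint i j, ?_⟩
  rw [integral_finsetSum _ fun i _ => integrable_finsetSum _ fun j _ => hint i j]
  refine Finset.sum_congr rfl fun i _ => ?_
  rw [integral_finsetSum _ fun j _ => hint i j]
  simp [integral_const_mul, hval]

/-- With an independent copy `w'`, the centered form is the mean over `w'` of `Q(w) - Q(w')`, so
Jensen bounds its moments by those of this difference. Symmetry of `S` factors the difference as `(w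
- w')ᵀ S (w + w')`. -/
lemma lintegral_quadratic_even_pow_le {B : ℝ} (h : IsEntryLaw B ν) (S : Matrix ι ι ℝ)
    (hS : S.IsSymm) (q : ℕ) :
    ∫⁻ w : ι → ℝ, ENNReal.ofReal (((∑ i, w i * ∑ j, S i j * w j) - S.trace) ^ (2 * q))
      ∂(Measure.pi fun _ => ν) ≤
    ENNReal.ofReal (momentConst q * (momentConst (2 * q) * (2 * entryParam B) ^ (2 * q)) *
      (∑ i, ∑ j, S i j ^ 2) ^ q) := by
  refine le_trans ?_ (lintegral_bilinear_even_pow_le h.hasSubgaussianMGF S q)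
  obtain ⟨hint, hval⟩ := integral_quadratic h S
  set Q : (ι → ℝ) → ℝ := fun w => ∑ i, w i * ∑ j, S i j * w j with hQ
  have hQm : Measurable Q := by fun_prop
  have hD : ∀ p : (ι → ℝ) × (ι → ℝ),
      ∑ i, (p.1 i - p.2 i) * ∑ j, S i j * (p.1 j + p.2 j) = Q p.1 - Q p.2 := by
    intro p
    have hsym : ∑ i, ∑ j, p.2 i * (S i j * p.1 j) = ∑ i, ∑ j, p.1 i * (S i j * p.2 j) := by
      rw [Finset.sum_comm]
      refine Finset.sum_congr rfl fun i _ => Finset.sum_congr rfl fun j _ => ?_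
      rw [hS.apply i j]; ring
    simp only [hQ, Finset.mul_sum, mul_add, sub_mul, Finset.sum_add_distrib,
      Finset.sum_sub_distrib]
    rw [hsym]
    ring
  simp_rw [hD]
  rw [lintegral_prod _ (by fun_prop)]
  refine lintegral_mono fun w => ?_
  have h1 : Q w - S.trace = ∫ w', (Q w - Q w') ∂(Measure.pi fun _ : ι => ν) := by
    rw [integral_sub (integrable_const _) hint, hval]
    simp
  simp only [ofReal_even_pow]
  change ‖Q w - S.trace‖ₑ ^ (2 * q) ≤ _
  rw [h1]
  refine le_trans ?_ (lintegral_enorm_pow_le (by fun_prop) _)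
  gcongr
  exact enorm_integral_le_lintegral_enorm _

end Quadratic

/-! ### Concentration of the inputs -/

section Matrix

variable {d : ℕ} {S R : Matrix (Fin d) (Fin d) ℝ}

lemma transpose_eq_self_of_posSemidef (hR : R.PosSemidef) : Rᵀ = R := by
  rw [← Matrix.conjTranspose_eq_transpose_of_trivial]
  exact hR.isHermitian

/-- The C*-identity gives `‖R‖² = ‖R * R‖ = ‖S‖ = 1`. -/
lemma sum_mulVec_sq_le (hR : R.PosSemidef) (hRS : R * R = S) (hS : opNorm S = 1)
    (v : Fin d → ℝ) : ∑ i, (R *ᵥ v) i ^ 2 ≤ ∑ i, v i ^ 2 := by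
  have hsa : IsSelfAdjoint (Matrix.toEuclideanCLM (n := Fin d) (𝕜 := ℝ) R) := by
    have : IsSelfAdjoint R := hR.isHermitian
    exact this.map _
  have h1 : ‖Matrix.toEuclideanCLM (n := Fin d) (𝕜 := ℝ) R‖ ^ 2 = 1 := by
    rw [← hS, opNorm, ← hRS, map_mul, sq]
    have := CStarRing.norm_star_mul_self (x := Matrix.toEuclideanCLM (n := Fin d) (𝕜 := ℝ) R)
    rw [hsa.star_eq] at this
    exact this.symm
  have h2 : ‖Matrix.toEuclideanCLM (n := Fin d) (𝕜 := ℝ) R‖ = 1 := by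
    nlinarith [norm_nonneg (Matrix.toEuclideanCLM (n := Fin d) (𝕜 := ℝ) R)]
  have h3 := (Matrix.toEuclideanCLM (n := Fin d) (𝕜 := ℝ) R).le_opNorm (WithLp.toLp 2 v)
  rw [h2, one_mul] at h3
  have h4 := pow_le_pow_left₀ (norm_nonneg _) h3 2
  rw [EuclideanSpace.norm_sq_eq, EuclideanSpace.norm_sq_eq] at h4
  simpa using h4

/-- Row `i` of `S` is `R` applied to row `i` of `R`, and `R` is a contraction; the squared norm of
row `i` of `R` is `S i i`. Hence the squared Frobenius norm is at most `r`, and `‖z‖²` fluctuates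
around `r` only on the scale `√r`. -/
lemma sum_sq_le_trace (hR : R.PosSemidef) (hRS : R * R = S) (hS : opNorm S = 1) :
    ∑ i, ∑ j, S i j ^ 2 ≤ S.trace := by
  have hsym : ∀ i j, R i j = R j i := fun i j => by
    have := hR.isHermitian.apply i j
    simpa using this.symm
  refine Finset.sum_le_sum fun i _ => ?_
  have h1 := sum_mulVec_sq_le hR hRS hS (R i)
  have h2 : ∀ j, (R *ᵥ (R i)) j = S i j := by
    intro j
    rw [← hRS, Matrix.mul_apply, Matrix.mulVec, dotProduct]
    exact Finset.sum_congr rfl fun k _ => by rw [hsym j k, mul_comm]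
  have h3 : ∑ j, R i j ^ 2 = S i i := by
    rw [← hRS, Matrix.mul_apply]
    exact Finset.sum_congr rfl fun k _ => by rw [hsym k i, sq]
  simp only [h2] at h1
  rw [h3] at h1
  exact h1

lemma norm_sq_mulVec (hR : R.PosSemidef) (hRS : R * R = S) (w : Fin d → ℝ) :
    ‖(WithLp.toLp 2 (R *ᵥ w) : E d)‖ ^ 2 = ∑ i, w i * ∑ j, S i j * w j := by
  have hsym := transpose_eq_self_of_posSemidef hR
  rw [EuclideanSpace.norm_sq_eq]
  have : ∑ i, w i * ∑ j, S i j * w j = w ⬝ᵥ (S *ᵥ w) := rfl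
  rw [this, ← hRS, ← Matrix.mulVec_mulVec, Matrix.dotProduct_mulVec, ← Matrix.mulVec_transpose,
    hsym, dotProduct]
  refine Finset.sum_congr rfl fun i _ => ?_
  simp [sq]

lemma inner_mulVec (hR : R.PosSemidef) (w : Fin d → ℝ) (x : E d) :
    inner ℝ (WithLp.toLp 2 (R *ᵥ w) : E d) x = ∑ i, (R *ᵥ x.ofLp) i * w i := by
  have hsym := transpose_eq_self_of_posSemidef hR
  have h1 : inner ℝ (WithLp.toLp 2 (R *ᵥ w) : E d) x = x.ofLp ⬝ᵥ (R *ᵥ w) := by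
    simp [EuclideanSpace.inner_eq_star_dotProduct]
  rw [h1, Matrix.dotProduct_mulVec, ← Matrix.mulVec_transpose, hsym, dotProduct]

end Matrix

lemma measure_abs_gt_le {Ω : Type*} [MeasurableSpace Ω] {μ : Measure Ω} {f : Ω → ℝ} {q : ℕ}
    {K a : ℝ} (ha : 0 < a) (hf : Measurable f)
    (h : ∫⁻ ω, ENNReal.ofReal (f ω ^ (2 * q)) ∂μ ≤ ENNReal.ofReal K) :
    μ {ω | a < |f ω|} ≤ ENNReal.ofReal (K / a ^ (2 * q)) := by
  have hp : 0 < a ^ (2 * q) := by positivity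
  rw [ENNReal.ofReal_div_of_pos hp]
  rw [ENNReal.le_div_iff_mul_le (Or.inl (by simpa using hp)) (Or.inl ENNReal.ofReal_ne_top),
    mul_comm]
  refine le_trans ?_ h
  refine le_trans ?_ (mul_meas_ge_le_lintegral (by fun_prop) (ENNReal.ofReal (a ^ (2 * q))))
  gcongr
  intro hω
  apply ENNReal.ofReal_le_ofReal
  rw [pow_mul, pow_mul, ← sq_abs (f _)]
  exact pow_le_pow_left₀ (by positivity) (pow_le_pow_left₀ ha.le (le_of_lt hω) 2) q

/-- The constant in the moment bound for centered quadratic forms. -/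
def quadConst (B : ℝ) (q : ℕ) : ℝ :=
  momentConst q * (momentConst (2 * q) * (2 * entryParam B) ^ (2 * q))

lemma quadConst_nonneg (B : ℝ) (q : ℕ) : 0 ≤ quadConst B q :=
  mul_nonneg (momentConst_pos _).le (mul_nonneg (momentConst_pos _).le (by positivity))

/-! ### Tail bounds in the covariance model -/

section CovLaw

variable {d : ℕ} {S R : Matrix (Fin d) (Fin d) ℝ} {B : ℝ} {ν : Measure ℝ}
  [IsProbabilityMeasure ν]

lemma measurable_toLp_mulVec (R : Matrix (Fin d) (Fin d) ℝ) :
    Measurable fun w : Fin d → ℝ => (WithLp.toLp 2 (R *ᵥ w) : E d) := by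
  refine (WithLp.measurable_toLp 2 _).comp ?_
  exact measurable_pi_lambda _ fun i => by simp only [Matrix.mulVec, dotProduct]; fun_prop

instance : IsProbabilityMeasure (covLaw ν R) :=
  Measure.isProbabilityMeasure_map (measurable_toLp_mulVec R).aemeasurable

lemma lintegral_covLaw_norm_sq_sub_le (hν : IsEntryLaw B ν) (hR : R.PosSemidef)
    (hRS : R * R = S) (hS : opNorm S = 1) (q : ℕ) :
    ∫⁻ z, ENNReal.ofReal ((‖z‖ ^ 2 - S.trace) ^ (2 * q)) ∂(covLaw ν R) ≤
      ENNReal.ofReal (quadConst B q * S.trace ^ q) := by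
  rw [covLaw, lintegral_map (by fun_prop) (measurable_toLp_mulVec R)]
  simp_rw [norm_sq_mulVec hR hRS]
  have hSs : S.IsSymm := by
    have hsym := transpose_eq_self_of_posSemidef hR
    rw [Matrix.IsSymm, ← hRS, Matrix.transpose_mul, hsym]
  refine (lintegral_quadratic_even_pow_le hν S hSs q).trans (ENNReal.ofReal_le_ofReal ?_)
  rw [quadConst]
  have h0 := sum_sq_le_trace hR hRS hS
  have := quadConst_nonneg B q
  rw [quadConst] at this
  gcongr

lemma lintegral_covLaw_inner_le (hν : IsEntryLaw B ν) (hR : R.PosSemidef)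
    (hRS : R * R = S) (hS : opNorm S = 1) (x : E d) (q : ℕ) :
    ∫⁻ z, ENNReal.ofReal (inner ℝ z x ^ (2 * q)) ∂(covLaw ν R) ≤
      ENNReal.ofReal (momentConst q * (‖x‖ ^ 2 * entryParam B) ^ q) := by
  rw [covLaw, lintegral_map (by fun_prop) (measurable_toLp_mulVec R)]
  simp_rw [inner_mulVec hR]
  refine (lintegral_sum_pi_even_pow_le hν.hasSubgaussianMGF _ q).trans
    (ENNReal.ofReal_le_ofReal ?_)
  have h1 := sum_mulVec_sq_le hR hRS hS x.ofLp
  have h2 : ‖x‖ ^ 2 = ∑ i, x.ofLp i ^ 2 := by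
    rw [EuclideanSpace.norm_sq_eq]; simp
  rw [h2]
  have := (momentConst_pos q).le
  gcongr

/-- The admissible values of `‖x‖² / r`. -/
def DataModel.shells (model : DataModel) : Set ℝ :=
  match model with
  | .covariance => Set.univ
  | .sphere => {1}

lemma measurable_sphereMap (r : ℝ) :
    Measurable fun z : E d => Real.sqrt r • (‖z‖⁻¹ • z) := by fun_prop

instance (model : DataModel) : IsProbabilityMeasure (model.law ν S R) := by
  cases model
  · exact inferInstanceAs (IsProbabilityMeasure (covLaw ν R))
  · exact Measure.isProbabilityMeasure_map (measurable_sphereMap _).aemeasurable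

lemma norm_sq_sphereMap {r : ℝ} (hr : 0 < r) {z : E d} (hz : z ≠ 0) :
    ‖Real.sqrt r • (‖z‖⁻¹ • z)‖ ^ 2 = r := by
  have : ‖z‖ ≠ 0 := norm_ne_zero_iff.2 hz
  rw [norm_smul, norm_smul, norm_inv, norm_norm, inv_mul_cancel₀ this, mul_one, Real.norm_eq_abs,
    sq_abs, Real.sq_sqrt hr.le]

lemma covLaw_norm_sq_gt_le (hν : IsEntryLaw B ν) (hR : R.PosSemidef)
    (hRS : R * R = S) (hS : opNorm S = 1) (q : ℕ) (hr : 0 < S.trace) {δ : ℝ} (hδ : 0 < δ) :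
    covLaw ν R {z | δ < |‖z‖ ^ 2 / S.trace - 1|} ≤
      ENNReal.ofReal (quadConst B q / (δ ^ 2 * S.trace) ^ q) := by
  have h := measure_abs_gt_le (a := δ * S.trace) (by positivity) (by fun_prop)
    (lintegral_covLaw_norm_sq_sub_le hν hR hRS hS q)
  have e1 : {z : E d | δ < |‖z‖ ^ 2 / S.trace - 1|} =
      {z : E d | δ * S.trace < |‖z‖ ^ 2 - S.trace|} := by
    ext z
    have : ‖z‖ ^ 2 / S.trace - 1 = (‖z‖ ^ 2 - S.trace) / S.trace := by field_simp
    simp only [Set.mem_ofPred_eq]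
    rw [this, abs_div, abs_of_pos hr, lt_div_iff₀ hr]
  have e2 : quadConst B q * S.trace ^ q / (δ * S.trace) ^ (2 * q) =
      quadConst B q / (δ ^ 2 * S.trace) ^ q := by
    rw [pow_mul, mul_pow δ, mul_pow (δ ^ 2), mul_pow (δ ^ 2), ← pow_mul S.trace, two_mul, pow_add]
    field_simp
  rwa [e1, ← e2]

lemma covLaw_inner_gt_le (hν : IsEntryLaw B ν) (hR : R.PosSemidef)
    (hRS : R * R = S) (hS : opNorm S = 1) (q : ℕ) (hr : 0 < S.trace) {δ : ℝ} (hδ : 0 < δ)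
    {x : E d} (hx : ‖x‖ ^ 2 / S.trace ≤ 2) :
    covLaw ν R {z | δ < |inner ℝ z x / S.trace|} ≤
      ENNReal.ofReal (momentConst q * (2 * entryParam B) ^ q / (δ ^ 2 * S.trace) ^ q) := by
  have hb := lintegral_covLaw_inner_le hν hR hRS hS x q
  have hx' : ‖x‖ ^ 2 ≤ 2 * S.trace := (div_le_iff₀ hr).1 hx
  have hm := (momentConst_pos q).le
  have hb' := hb.trans (ENNReal.ofReal_le_ofReal
    (show momentConst q * (‖x‖ ^ 2 * entryParam B) ^ q ≤
      momentConst q * (2 * S.trace * entryParam B) ^ q by gcongr))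
  have h := measure_abs_gt_le (a := δ * S.trace) (by positivity) (by fun_prop) hb'
  have e1 : {z : E d | δ < |inner ℝ z x / S.trace|} =
      {z : E d | δ * S.trace < |inner ℝ z x|} := by
    ext z
    simp only [Set.mem_ofPred_eq]
    rw [abs_div, abs_of_pos hr, lt_div_iff₀ hr]
  have e2 : momentConst q * (2 * S.trace * entryParam B) ^ q / (δ * S.trace) ^ (2 * q) =
      momentConst q * (2 * entryParam B) ^ q / (δ ^ 2 * S.trace) ^ q := by
    rw [pow_mul, show 2 * S.trace * (entryParam B : ℝ) = (2 * entryParam B) * S.trace by ring,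
      mul_pow _ S.trace, show (δ * S.trace) ^ 2 = (δ ^ 2 * S.trace) * S.trace by ring,
      mul_pow _ S.trace, ← mul_assoc, mul_div_mul_right _ _ (by positivity)]
  rwa [e1, ← e2]

end CovLaw

/-- Uniform concentration of the input distributions: with overwhelming probability `‖x‖²/r` is
close to `1` and `xᵀx'/r` is close to `0`, and `‖x‖²/r` has bounded moments. -/
theorem DataModel.exists_concentration (B : ℝ) (q : ℕ) : ∃ C : ℝ, 0 ≤ C ∧
    ∀ (model : DataModel) (d : ℕ) (S R : Matrix (Fin d) (Fin d) ℝ) (ν : Measure ℝ)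
      [IsProbabilityMeasure ν], IsEntryLaw B ν → R.PosSemidef → R * R = S → opNorm S = 1 →
      1 ≤ effDim S →
      (∀ δ : ℝ, 0 < δ → δ ≤ 1 / 2 → model.law ν S R {x | ¬ (‖x‖ ^ 2 / effDim S ∈ model.shells ∧
        |‖x‖ ^ 2 / effDim S - 1| ≤ δ)} ≤ ENNReal.ofReal (C / (δ ^ 2 * effDim S) ^ q)) ∧
      (∀ δ : ℝ, 0 < δ → δ ≤ 1 / 2 → ∀ x' : E d, ‖x'‖ ^ 2 / effDim S ≤ 2 →
        model.law ν S R {x | δ < |inner ℝ x x' / effDim S|} ≤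
          ENNReal.ofReal (C / (δ ^ 2 * effDim S) ^ q)) ∧
      ∫⁻ x, ENNReal.ofReal ((1 + ‖x‖ ^ 2 / effDim S) ^ (2 * q)) ∂(model.law ν S R) ≤
        ENNReal.ofReal C := by
  have hQ := quadConst_nonneg B q
  set I := momentConst q * (2 * entryParam B) ^ q with hI
  have hI0 : 0 ≤ I := mul_nonneg (momentConst_pos q).le (by positivity)
  -- The summands serve the shell bound, the inner products (with a loss `2^q` on the sphere) and
  -- the moment bound.
  refine ⟨quadConst B q + 2 ^ q * I + 4 ^ q * (4 ^ q + quadConst B q), by positivity, ?_⟩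
  intro model d S R ν _ hν hR hRS hS hr1
  have htr : effDim S = S.trace := by rw [effDim, hS, div_one]
  rw [htr] at hr1 ⊢
  set r := S.trace with hr
  have hr0 : 0 < r := by linarith
  have hC1 : quadConst B q ≤ quadConst B q + 2 ^ q * I + 4 ^ q * (4 ^ q + quadConst B q) := by
    have : 0 ≤ 2 ^ q * I + 4 ^ q * (4 ^ q + quadConst B q) := by positivity
    linarith
  have h2q : (1 : ℝ) ≤ 2 ^ q := one_le_pow₀ (by norm_num)
  have h4q : (1 : ℝ) ≤ 4 ^ q := one_le_pow₀ (by norm_num)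
  have hI2 : I ≤ 2 ^ q * I := le_mul_of_one_le_left hI0 h2q
  cases model with
  | covariance =>
    change (∀ δ : ℝ, 0 < δ → δ ≤ 1 / 2 → covLaw ν R {x | ¬ (‖x‖ ^ 2 / r ∈ Set.univ ∧
        |‖x‖ ^ 2 / r - 1| ≤ δ)} ≤ _) ∧ (∀ δ : ℝ, 0 < δ → δ ≤ 1 / 2 → ∀ x' : E d,
        ‖x'‖ ^ 2 / r ≤ 2 → covLaw ν R {x | δ < |inner ℝ x x' / r|} ≤ _) ∧
        ∫⁻ x, ENNReal.ofReal ((1 + ‖x‖ ^ 2 / r) ^ (2 * q)) ∂(covLaw ν R) ≤ _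
    refine ⟨fun δ h0 _ => ?_, fun δ h0 _ x' hx' => ?_, ?_⟩
    · have := covLaw_norm_sq_gt_le hν hR hRS hS q hr0 h0
      simp only [Set.mem_univ, true_and, not_le]
      refine this.trans (ENNReal.ofReal_le_ofReal ?_)
      gcongr
    · refine (covLaw_inner_gt_le hν hR hRS hS q hr0 h0 hx').trans (ENNReal.ofReal_le_ofReal ?_)
      have : 0 ≤ 4 ^ q * (4 ^ q + quadConst B q) := by positivity
      gcongr
      linarith
    · have hpt : ∀ x : E d, (1 + ‖x‖ ^ 2 / r) ^ (2 * q) ≤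
          4 ^ q * 4 ^ q + 4 ^ q / r ^ (2 * q) * (‖x‖ ^ 2 - r) ^ (2 * q) := by
        intro x
        -- With `y` the relative deviation, the left side is `(2 + y)² ≤ 4 max(4, y²)`; the maximum
        -- lets `q`-th powers be taken without binomial terms.
        have h1 : (1 + ‖x‖ ^ 2 / r) ^ 2 ≤ 4 * (4 ⊔ ((‖x‖ ^ 2 - r) / r) ^ 2) := by
          set y := (‖x‖ ^ 2 - r) / r with hy
          have : 1 + ‖x‖ ^ 2 / r = 2 + y := by rw [hy]; field_simp; ring
          rw [this]
          rcases le_total 4 (y ^ 2) with h | h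
          · rw [max_eq_right h]; nlinarith [sq_nonneg (y - 2)]
          · rw [max_eq_left h]; nlinarith [sq_nonneg (y - 2)]
        have h2 : (1 + ‖x‖ ^ 2 / r) ^ (2 * q) ≤ (4 * (4 ⊔ ((‖x‖ ^ 2 - r) / r) ^ 2)) ^ q := by
          rw [pow_mul]; exact pow_le_pow_left₀ (by positivity) h1 q
        have h3 : (4 ⊔ ((‖x‖ ^ 2 - r) / r) ^ 2) ^ q ≤ 4 ^ q + (((‖x‖ ^ 2 - r) / r) ^ 2) ^ q := by
          rcases le_total 4 (((‖x‖ ^ 2 - r) / r) ^ 2) with h | h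
          · rw [max_eq_right h]; linarith [h4q]
          · rw [max_eq_left h]
            have : 0 ≤ (((‖x‖ ^ 2 - r) / r) ^ 2) ^ q := by positivity
            linarith
        calc _ ≤ _ := h2
          _ = 4 ^ q * (4 ⊔ ((‖x‖ ^ 2 - r) / r) ^ 2) ^ q := mul_pow _ _ _
          _ ≤ 4 ^ q * (4 ^ q + (((‖x‖ ^ 2 - r) / r) ^ 2) ^ q) := by gcongr
          _ = _ := by rw [← pow_mul, div_pow]; ring
      have hev : ∀ x : ℝ, 0 ≤ x ^ (2 * q) := fun x => by rw [pow_mul]; positivity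
      calc ∫⁻ x, ENNReal.ofReal ((1 + ‖x‖ ^ 2 / r) ^ (2 * q)) ∂(covLaw ν R)
          ≤ ∫⁻ x, (ENNReal.ofReal (4 ^ q * 4 ^ q) + ENNReal.ofReal (4 ^ q / r ^ (2 * q)) *
            ENNReal.ofReal ((‖x‖ ^ 2 - r) ^ (2 * q))) ∂(covLaw ν R) := by
            refine lintegral_mono fun x => ?_
            rw [← ENNReal.ofReal_mul (by positivity), ← ENNReal.ofReal_add (by positivity)
              (mul_nonneg (by positivity) (hev _))]
            exact ENNReal.ofReal_le_ofReal (hpt x)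
        _ = ENNReal.ofReal (4 ^ q * 4 ^ q) + ENNReal.ofReal (4 ^ q / r ^ (2 * q)) *
            ∫⁻ x, ENNReal.ofReal ((‖x‖ ^ 2 - r) ^ (2 * q)) ∂(covLaw ν R) := by
            rw [lintegral_add_left (by fun_prop), lintegral_const, measure_univ, mul_one,
              lintegral_const_mul' _ _ ENNReal.ofReal_ne_top]
        _ ≤ ENNReal.ofReal (4 ^ q * 4 ^ q) + ENNReal.ofReal (4 ^ q / r ^ (2 * q)) *
            ENNReal.ofReal (quadConst B q * r ^ q) := by
            gcongr
            exact lintegral_covLaw_norm_sq_sub_le hν hR hRS hS q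
        _ ≤ _ := by
            rw [← ENNReal.ofReal_mul (by positivity), ← ENNReal.ofReal_add (by positivity)
              (by positivity)]
            apply ENNReal.ofReal_le_ofReal
            have h5 : 4 ^ q / r ^ (2 * q) * (quadConst B q * r ^ q) ≤ 4 ^ q * quadConst B q := by
              have h6 : r ^ q ≤ r ^ (2 * q) := pow_le_pow_right₀ hr1 (by omega)
              rw [div_mul_eq_mul_div, div_le_iff₀ (by positivity), mul_assoc]
              gcongr
            have : 0 ≤ 2 ^ q * I := by positivity
            linarith
  | sphere =>
    have hmeas := measurable_sphereMap (d := d) r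
    -- Projection to the sphere is harmless where `‖z‖² ≥ r/2`: there `z ≠ 0`, so the image lies
    -- exactly on the shell, and inner products grow by a factor of at most `√2`.
    have hsq2 : {z : E d | ¬ (r / 2 ≤ ‖z‖ ^ 2)} ⊆ {z | (1 / 2 : ℝ) < |‖z‖ ^ 2 / r - 1|} := by
      intro z hz
      simp only [Set.mem_ofPred_eq, not_le] at hz ⊢
      have h1 : ‖z‖ ^ 2 / r < 1 / 2 := by rw [div_lt_iff₀ hr0]; linarith
      rw [abs_of_neg (by linarith)]
      linarith
    have hgood : ∀ z : E d, r / 2 ≤ ‖z‖ ^ 2 → z ≠ 0 := by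
      rintro z hz rfl
      simp at hz
      linarith
    have hlaw : DataModel.sphere.law ν S R =
        (covLaw ν R).map fun z => Real.sqrt r • (‖z‖⁻¹ • z) := by
      rw [← htr]; rfl
    -- A deviation of `1/2` is at least as rare as the bound for `δ ≤ 1/2` says.
    have hball : ∀ δ : ℝ, 0 < δ → δ ≤ 1 / 2 → covLaw ν R {z : E d | ¬ (r / 2 ≤ ‖z‖ ^ 2)} ≤
        ENNReal.ofReal (quadConst B q / (δ ^ 2 * r) ^ q) := by
      intro δ h0 h1
      refine (measure_mono hsq2).trans
        ((covLaw_norm_sq_gt_le hν hR hRS hS q hr0 (by norm_num)).trans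
        (ENNReal.ofReal_le_ofReal ?_))
      gcongr
    rw [hlaw]
    change (∀ δ : ℝ, 0 < δ → δ ≤ 1 / 2 → Measure.map _ (covLaw ν R) {x : E d |
        ¬ (‖x‖ ^ 2 / r ∈ ({1} : Set ℝ) ∧ |‖x‖ ^ 2 / r - 1| ≤ δ)} ≤ _) ∧ _
    refine ⟨fun δ h0 h1 => ?_, fun δ h0 h1 x' hx' => ?_, ?_⟩
    · rw [Measure.map_apply hmeas]
      · refine (measure_mono ?_).trans ((hball δ h0 h1).trans (ENNReal.ofReal_le_ofReal ?_))
        · intro z hz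
          simp only [Set.mem_preimage, Set.mem_ofPred_eq] at hz ⊢
          contrapose! hz
          rw [norm_sq_sphereMap hr0 (hgood z hz), div_self hr0.ne']
          simp [h0.le]
        · gcongr
      · refine MeasurableSet.compl (MeasurableSet.inter ?_ ?_)
        · exact (measurableSet_singleton (1 : ℝ)).preimage (by fun_prop)
        · have : Measurable fun x : E d => |‖x‖ ^ 2 / r - 1| := by fun_prop
          exact measurableSet_le this measurable_const
    · have hms : MeasurableSet {x : E d | δ < |inner ℝ x x' / r|} :=
        measurableSet_lt (by fun_prop) (by fun_prop)
      rw [Measure.map_apply hmeas hms]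
      have hs2 : (0 : ℝ) < Real.sqrt 2 := by positivity
      have hsub : (fun z : E d => Real.sqrt r • (‖z‖⁻¹ • z)) ⁻¹' {x | δ < |inner ℝ x x' / r|} ⊆
          {z : E d | ¬ (r / 2 ≤ ‖z‖ ^ 2)} ∪ {z | δ / Real.sqrt 2 < |inner ℝ z x' / r|} := by
        intro z hz
        by_cases hz2 : r / 2 ≤ ‖z‖ ^ 2
        · right
          simp only [Set.mem_preimage, Set.mem_ofPred_eq] at hz ⊢
          have hzpos : 0 < ‖z‖ := norm_pos_iff.2 (hgood z hz2)
          rw [inner_smul_left, inner_smul_left] at hz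
          simp only [conj_trivial] at hz
          have hle : Real.sqrt r * ‖z‖⁻¹ ≤ Real.sqrt 2 := by
            rw [← div_eq_mul_inv, div_le_iff₀ hzpos]
            rw [Real.sqrt_le_left (by positivity), mul_pow, Real.sq_sqrt (by norm_num)]
            linarith
          rw [div_lt_iff₀ hs2]
          calc δ < _ := hz
            _ = (Real.sqrt r * ‖z‖⁻¹) * |inner ℝ z x' / r| := by
              rw [← mul_assoc, mul_div_assoc, abs_mul, abs_of_nonneg (a := Real.sqrt r * ‖z‖⁻¹)
                (by positivity)]
            _ ≤ Real.sqrt 2 * |inner ℝ z x' / r| := by gcongr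
            _ = _ := mul_comm _ _
        · left; exact hz2
      refine (measure_mono hsub).trans ((measure_union_le _ _).trans ?_)
      refine (add_le_add (hball δ h0 h1) (covLaw_inner_gt_le hν hR hRS hS q hr0
        (show 0 < δ / Real.sqrt 2 by positivity) hx')).trans ?_
      rw [← ENNReal.ofReal_add (by positivity) (by positivity)]
      apply ENNReal.ofReal_le_ofReal
      have e : momentConst q * (2 * entryParam B) ^ q / ((δ / Real.sqrt 2) ^ 2 * r) ^ q =
          2 ^ q * I / (δ ^ 2 * r) ^ q := by
        rw [div_pow, Real.sq_sqrt (by norm_num), ← hI, div_mul_eq_mul_div, div_pow]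
        field_simp
      rw [e, ← add_div]
      have : 0 ≤ 4 ^ q * (4 ^ q + quadConst B q) := by positivity
      refine div_le_div_of_nonneg_right ?_ (by positivity)
      linarith
    · rw [lintegral_map (by fun_prop) hmeas]
      have hle : ∀ z : E d, ‖Real.sqrt r • (‖z‖⁻¹ • z)‖ ^ 2 / r ≤ 1 := by
        intro z
        rcases eq_or_ne z 0 with rfl | hz
        · simp
        · rw [norm_sq_sphereMap hr0 hz, div_self hr0.ne']
      calc _ ≤ ∫⁻ _ : E d, ENNReal.ofReal (4 ^ q) ∂(covLaw ν R) := by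
            refine lintegral_mono fun z => ENNReal.ofReal_le_ofReal ?_
            rw [pow_mul]
            have h0 : 0 ≤ ‖Real.sqrt r • (‖z‖⁻¹ • z)‖ ^ 2 / r := by positivity
            refine pow_le_pow_left₀ (by positivity) ?_ q
            nlinarith [hle z]
        _ ≤ _ := by
            rw [lintegral_const, measure_univ, mul_one]
            apply ENNReal.ofReal_le_ofReal
            have h7 : 0 ≤ 2 ^ q * I := by positivity
            have h8 : (4 : ℝ) ^ q ≤ 4 ^ q * (4 ^ q + quadConst B q) :=
              le_mul_of_one_le_right (by positivity) (by linarith)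
            linarith

/-! ### The kernel regression estimate -/

lemma posSemidef_kernelMatrix {X : Type*} {k : X → X → ℝ} (h : IsPSDKernelOn Set.univ k) :
    (kernelMatrix k).PosSemidef := by
  classical
  have hsymm : ∀ x y, k x y = k y x := by
    intro x y
    have := (h 2 ![x, y] (by simp)).isHermitian.apply 0 1
    simpa using this.symm
  have htf := (RKHS.posSemidef_tfae (K := kernelMatrix k)).out 0 2
  refine htf.2 ⟨?_, fun vv => ?_⟩
  · ext x y
    simp [kernelMatrix, hsymm y x, ContinuousLinearMap.star_eq_adjoint,
      ContinuousLinearMap.adjoint_id]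
  · simp only [Finsupp.sum, kernelMatrix, Matrix.of_apply]
    have e := vv.support.equivFin.symm
    have h1 := (h vv.support.card (fun i => (e i : X)) (by simp)).dotProduct_mulVec_nonneg
      (fun i => vv (e i))
    simp only [dotProduct, Matrix.mulVec, Matrix.of_apply, star_trivial] at h1
    rw [← Finset.sum_coe_sort, ← e.sum_comp]
    have h2 : ∀ i : vv.support, ∑ x' ∈ vv.support,
        inner ℝ ((k x' i • ContinuousLinearMap.id ℝ ℝ) (vv i)) (vv x') =
        ∑ j, inner ℝ ((k (e j) i • ContinuousLinearMap.id ℝ ℝ) (vv i)) (vv (e j)) := by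
      intro i
      rw [← Finset.sum_coe_sort, ← e.sum_comp]
    simp only [h2]
    refine h1.trans_eq ?_
    simp only [Finset.mul_sum, map_sum]
    refine Finset.sum_congr rfl fun i _ => Finset.sum_congr rfl fun j _ => ?_
    simp [hsymm (e i) (e j)]
    ring

section RKHS

variable {X : Type*} {k : X → X → ℝ} {lam : ℝ} {n : ℕ} {xs : Fin n → X} {ys α : Fin n → ℝ}

lemma exists_kernel_combination (hk : Fact (kernelMatrix k).PosSemidef) (xs : Fin n → X)
    (α : Fin n → ℝ) : ∃ F : RKHS.OfKernel (kernelMatrix k),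
      (∀ x, F x = ∑ i, α i * k x (xs i)) ∧
      ∀ G : RKHS.OfKernel (kernelMatrix k), inner ℝ F G = ∑ i, α i * G (xs i) := by
  refine ⟨∑ i, α i • RKHS.kerFun (RKHS.OfKernel (kernelMatrix k)) (xs i) (1 : ℝ), fun x => ?_,
    fun G => ?_⟩
  · rw [← RKHS.coeCLM_apply, map_sum, Finset.sum_apply]
    refine Finset.sum_congr rfl fun i _ => ?_
    rw [RKHS.coeCLM_apply, RKHS.coe_smul, Pi.smul_apply, RKHS.kerFun_apply,
      RKHS.OfKernel.kernel_ofKernel]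
    simp [kernelMatrix]
  · rw [sum_inner]
    refine Finset.sum_congr rfl fun i _ => ?_
    rw [inner_smul_left, RKHS.kerFun_inner]
    simp

/-- Let `F₀ = ∑ αᵢ k(·, xᵢ)`. The reproducing property gives `⟨F₀, G - F₀⟩ = ∑ αᵢ (G - F₀)(xᵢ)`, and
the linear system says that the residuals of `F₀` are `λ αᵢ`. In the objective at `G` the cross
terms cancel, leaving the value at `F₀` plus `∑ (G - F₀)(xᵢ)² + λ ‖G - F₀‖²`. For `λ = 0` the same
expansion of `‖G‖²` is Pythagoras among the interpolants. Both cases yield existence and uniqueness.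
-/
lemma isKernelEstimate_iff (hk : (kernelMatrix k).PosSemidef) (hlam : 0 ≤ lam)
    (hα : ∀ i, ∑ j, α j * k (xs i) (xs j) + lam * α i = ys i) (f : X → ℝ) :
    IsKernelEstimate k lam xs ys f ↔ f = fun x => ∑ i, α i * k x (xs i) := by
  have hfact : Fact (kernelMatrix k).PosSemidef := ⟨hk⟩
  obtain ⟨F₀, hF₀, hin⟩ := exists_kernel_combination hfact xs α
  have hnorm : ∀ G : RKHS.OfKernel (kernelMatrix k),
      ‖G‖ ^ 2 = ‖F₀‖ ^ 2 + ‖G - F₀‖ ^ 2 + 2 * ∑ i, α i * (G (xs i) - F₀ (xs i)) := by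
    intro G
    have h1 : G = F₀ + (G - F₀) := by abel
    have h2 : ∑ i, α i * (G (xs i) - F₀ (xs i)) = inner ℝ F₀ (G - F₀) := by
      rw [hin]; simp
    rw [h2]
    conv_lhs => rw [h1]
    rw [norm_add_sq_real]
    ring
  have hobj : ∀ G : RKHS.OfKernel (kernelMatrix k),
      ∑ i, (ys i - G (xs i)) ^ 2 + lam * ‖G‖ ^ 2 =
        (∑ i, (ys i - F₀ (xs i)) ^ 2 + lam * ‖F₀‖ ^ 2) +
        (∑ i, (G (xs i) - F₀ (xs i)) ^ 2 + lam * ‖G - F₀‖ ^ 2) := by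
    intro G
    have h3 : ∀ i, ys i - F₀ (xs i) = lam * α i := by
      intro i; rw [hF₀, ← hα i]; ring
    have h4 : ∑ i, (ys i - G (xs i)) ^ 2 = ∑ i, (ys i - F₀ (xs i)) ^ 2 +
        ∑ i, (G (xs i) - F₀ (xs i)) ^ 2 - 2 * lam * ∑ i, α i * (G (xs i) - F₀ (xs i)) := by
      rw [Finset.mul_sum, ← Finset.sum_add_distrib, ← Finset.sum_sub_distrib]
      refine Finset.sum_congr rfl fun i _ => ?_
      have h5 : ys i - G (xs i) = (ys i - F₀ (xs i)) - (G (xs i) - F₀ (xs i)) := by ring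
      rw [h5, sub_sq, h3 i]
      ring
    rw [h4, hnorm G]
    ring
  have hint : lam = 0 → ∀ i, F₀ (xs i) = ys i := by
    intro h0 i
    rw [hF₀, ← hα i, h0, zero_mul, add_zero]
  constructor
  · rintro ⟨hk', F, hFf, hF⟩
    have hFF : F = F₀ := by
      rcases hF with ⟨hpos, hF⟩ | ⟨h0, hFi, hF⟩
      · have h1 := hF F₀
        rw [hobj F] at h1
        have h2 : 0 ≤ ∑ i, (F (xs i) - F₀ (xs i)) ^ 2 :=
          Finset.sum_nonneg fun i _ => sq_nonneg _
        have h3 : ‖F - F₀‖ ^ 2 ≤ 0 := by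
          by_contra h
          have := mul_pos hpos (not_le.1 h)
          linarith
        have h4 : ‖F - F₀‖ = 0 := by
          have := sq_nonneg ‖F - F₀‖
          exact pow_eq_zero_iff two_ne_zero |>.1 (le_antisymm h3 this)
        exact sub_eq_zero.1 (norm_eq_zero.1 h4)
      · have h1 := hF F₀ (hint h0)
        have h2 := hnorm F
        have h3 : ∑ i, α i * (F (xs i) - F₀ (xs i)) = 0 :=
          Finset.sum_eq_zero fun i _ => by rw [hFi i, hint h0 i]; ring
        rw [h3] at h2
        have h4 : ‖F - F₀‖ ^ 2 ≤ 0 := by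
          have := pow_le_pow_left₀ (norm_nonneg F) h1 2
          linarith
        have h5 : ‖F - F₀‖ = 0 := by
          have := sq_nonneg ‖F - F₀‖
          exact pow_eq_zero_iff two_ne_zero |>.1 (le_antisymm h4 this)
        exact sub_eq_zero.1 (norm_eq_zero.1 h5)
    funext x
    rw [← hFf, hFF, hF₀]
  · rintro rfl
    refine ⟨hfact, F₀, hF₀, ?_⟩
    rcases hlam.eq_or_lt with h0 | hpos
    · refine Or.inr ⟨h0.symm, hint h0.symm, fun G hG => ?_⟩
      have h2 := hnorm G
      have h3 : ∑ i, α i * (G (xs i) - F₀ (xs i)) = 0 :=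
        Finset.sum_eq_zero fun i _ => by rw [hG i, hint h0.symm i]; ring
      rw [h3] at h2
      refine le_of_sq_le_sq ?_ (norm_nonneg _)
      nlinarith [sq_nonneg ‖G - F₀‖]
    · refine Or.inl ⟨hpos, fun G => ?_⟩
      rw [hobj G]
      have h2 : 0 ≤ ∑ i, (G (xs i) - F₀ (xs i)) ^ 2 :=
        Finset.sum_nonneg fun i _ => sq_nonneg _
      have h3 : 0 ≤ lam * ‖G - F₀‖ ^ 2 := by positivity
      linarith

lemma kernelEstimate_eq (hk : (kernelMatrix k).PosSemidef) (hlam : 0 ≤ lam)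
    (hα : ∀ i, ∑ j, α j * k (xs i) (xs j) + lam * α i = ys i) :
    kernelEstimate k lam xs ys = fun x => ∑ i, α i * k x (xs i) := by
  have hiff := isKernelEstimate_iff hk hlam hα
  have hex : ∃ f, IsKernelEstimate k lam xs ys f := ⟨_, (hiff _).2 rfl⟩
  rw [kernelEstimate, dif_pos hex]
  exact (hiff _).1 hex.choose_spec

end RKHS

/-- If the kernel matrix of the inputs is bounded below by `c`, the averaged estimate is a linear
combination of the functions `k(·, xᵢ)` with coefficients of norm at most `c⁻¹ ‖f*(xs)‖`. -/
theorem exists_averagedEstimate_eq {d n : ℕ} {k : E d → E d → ℝ}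
    (hk : IsPSDKernelOn Set.univ k) {lam : ℝ} (hlam : 0 ≤ lam) (κ : Kernel (E d) ℝ)
    [IsMarkovKernel κ] {xs : Fin n → E d}
    (hint : ∀ i, Integrable (fun y : ℝ => y) (κ (xs i))) {c : ℝ} (hc : 0 < c)
    (hlow : ∀ v : Fin n → ℝ, c * ∑ i, v i ^ 2 ≤ ∑ i, ∑ j, v i * v j * k (xs i) (xs j)) :
    ∃ α : Fin n → ℝ, (∀ x, averagedEstimate k lam κ xs x = ∑ i, α i * k x (xs i)) ∧
      c ^ 2 * ∑ i, α i ^ 2 ≤ ∑ i, groundTruth κ (xs i) ^ 2 := by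
  classical
  set A : Matrix (Fin n) (Fin n) ℝ := Matrix.of (fun i j => k (xs i) (xs j)) + lam • 1 with hA
  have hAv : ∀ v i, (A *ᵥ v) i = ∑ j, v j * k (xs i) (xs j) + lam * v i := by
    intro v i
    rw [hA, Matrix.add_mulVec, Matrix.smul_mulVec, Matrix.one_mulVec]
    simp [Matrix.mulVec, dotProduct, mul_comm]
  have hcoer : ∀ v, c * ∑ i, v i ^ 2 ≤ ∑ i, v i * (A *ᵥ v) i := by
    intro v
    have h1 : ∑ i, v i * (A *ᵥ v) i = ∑ i, ∑ j, v i * v j * k (xs i) (xs j) +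
        lam * ∑ i, v i ^ 2 := by
      simp only [hAv, mul_add, Finset.sum_add_distrib, Finset.mul_sum]
      congr 1
      · exact Finset.sum_congr rfl fun i _ => Finset.sum_congr rfl fun j _ => by ring
      · exact Finset.sum_congr rfl fun i _ => by ring
    have h2 : 0 ≤ lam * ∑ i, v i ^ 2 :=
      mul_nonneg hlam (Finset.sum_nonneg fun i _ => sq_nonneg _)
    linarith [hlow v]
  have hinj : Function.Injective A.mulVec := by
    rw [← Matrix.coe_mulVecLin, ← LinearMap.ker_eq_bot, LinearMap.ker_eq_bot']
    intro v hv
    have h1 := hcoer v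
    have h2 : A *ᵥ v = 0 := hv
    rw [h2] at h1
    simp only [Pi.zero_apply, mul_zero, Finset.sum_const_zero] at h1
    have h0 : 0 ≤ ∑ i, v i ^ 2 := Finset.sum_nonneg fun i _ => sq_nonneg _
    have h3 : ∑ i, v i ^ 2 = 0 := by nlinarith
    funext i
    have := (Finset.sum_eq_zero_iff_of_nonneg fun i _ => sq_nonneg (v i)).1 h3 i
      (Finset.mem_univ _)
    exact pow_eq_zero_iff two_ne_zero |>.1 this
  have hunit : IsUnit A.det := (Matrix.isUnit_iff_isUnit_det A).1
    (Matrix.mulVec_injective_iff_isUnit.1 hinj)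
  have hsol : ∀ y, A *ᵥ (A⁻¹ *ᵥ y) = y := by
    intro y
    rw [Matrix.mulVec_mulVec, Matrix.mul_nonsing_inv _ hunit, Matrix.one_mulVec]
  set m : Fin n → ℝ := fun i => groundTruth κ (xs i) with hm
  -- The estimate is linear in the observations, so averaging replaces `ys` by its mean `m`.
  refine ⟨A⁻¹ *ᵥ m, fun x => ?_, ?_⟩
  · have h1 : ∀ ys : Fin n → ℝ, kernelEstimate k lam xs ys x =
        ∑ i, ∑ j, (A⁻¹ i j * k x (xs i)) * ys j := by
      intro ys
      rw [kernelEstimate_eq (α := A⁻¹ *ᵥ ys) (posSemidef_kernelMatrix hk) hlam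
        (fun i => by rw [← hAv, hsol])]
      refine Finset.sum_congr rfl fun i _ => ?_
      rw [Matrix.mulVec, dotProduct, Finset.sum_mul]
      exact Finset.sum_congr rfl fun j _ => by ring
    have hi : ∀ j, Integrable (fun ys : Fin n → ℝ => ys j) (Measure.pi fun i => κ (xs i)) :=
      fun j => integrable_comp_eval (μ := fun i => κ (xs i)) (i := j) (f := fun y : ℝ => y) (hint j)
    have hv : ∀ j, ∫ ys : Fin n → ℝ, ys j ∂(Measure.pi fun i => κ (xs i)) = m j := fun j =>
      integral_comp_eval (μ := fun i => κ (xs i)) (f := fun y : ℝ => y) (by fun_prop)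
    rw [averagedEstimate]
    simp only [h1]
    rw [integral_finsetSum _ fun i _ => integrable_finsetSum _ fun j _ => (hi j).const_mul _]
    refine Finset.sum_congr rfl fun i _ => ?_
    rw [integral_finsetSum _ fun j _ => (hi j).const_mul _]
    simp only [integral_const_mul, hv]
    rw [Matrix.mulVec, dotProduct, Finset.sum_mul]
    exact Finset.sum_congr rfl fun j _ => by ring
  · set α := A⁻¹ *ᵥ m
    -- Coercivity and Cauchy–Schwarz: `c ‖α‖² ≤ ⟨α, m⟩ ≤ ‖α‖ ‖m‖`.
    have h1 := hcoer α
    rw [hsol m] at h1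
    have h2 := Finset.sum_mul_sq_le_sq_mul_sq Finset.univ α m
    set a := ∑ i, α i ^ 2
    have ha : 0 ≤ a := Finset.sum_nonneg fun i _ => sq_nonneg _
    have hb : 0 ≤ ∑ i, m i ^ 2 := Finset.sum_nonneg fun i _ => sq_nonneg _
    rcases ha.eq_or_lt with h0 | h0
    · rw [← h0, mul_zero]; exact hb
    · have h3 : (c * a) ^ 2 ≤ a * ∑ i, m i ^ 2 := (pow_le_pow_left₀ (by positivity) h1 2).trans h2
      have h4 : a * (c ^ 2 * a) ≤ a * ∑ i, m i ^ 2 := by nlinarith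
      exact le_of_mul_le_mul_left h4 h0

/-! ### Kernels close to low-degree polynomials with coercive kernel matrices -/

/-- The two properties of a rotationally invariant kernel that cause the polynomial barrier: around
orthogonal points of the shells `‖x‖² ∈ T` it is approximated to order `M + 1` by a polynomial in
`‖x‖²` and `xᵀx'` of degree at most `m` in `x`, and its matrices at nearly orthogonal points are
bounded below. -/
structure BarrierKernel (g : ℝ → ℝ → ℝ → ℝ) (M m : ℕ) (T : Set ℝ) : Prop where
  posSemidef : ∀ d : ℕ, IsPSDKernelOn Set.univ (rotKernel g (d := d))
  approx : ∃ (a : ℕ → ℕ → ℝ → ℝ) (C : ℝ), 0 ≤ C ∧ (∀ k l t, a k l t ≠ 0 → k + 2 * l ≤ m) ∧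
    ∀ᶠ δ in 𝓝[>] (0 : ℝ), (∀ k ≤ M, ∀ l ≤ M, ∀ t, |t - 1| ≤ δ → |a k l t| ≤ C) ∧
      ∀ (d : ℕ) (x x' : E d), ‖x‖ ^ 2 ∈ T → ‖x'‖ ^ 2 ∈ T → |‖x‖ ^ 2 - 1| ≤ δ →
        |‖x'‖ ^ 2 - 1| ≤ δ → |inner ℝ x x'| ≤ δ →
        |rotKernel g x x' - ∑ k ∈ Finset.range (M + 1), ∑ l ∈ Finset.range (M + 1),
          a k l (‖x'‖ ^ 2) * (‖x‖ ^ 2 - 1) ^ l * (inner ℝ x x') ^ k| ≤ C * δ ^ (M + 1)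
  coercive : ∃ c η : ℝ, 0 < c ∧ 0 < η ∧ ∀ᶠ δ in 𝓝[>] (0 : ℝ),
    ∀ (d N : ℕ) (x : Fin N → E d), N * δ ^ (M + 1) ≤ η →
      (∀ i, ‖x i‖ ^ 2 ∈ T ∧ |‖x i‖ ^ 2 - 1| ≤ δ) →
      (∀ i j, i ≠ j → |inner ℝ (x i) (x j)| ≤ δ) → ∀ v : Fin N → ℝ,
        c * ∑ i, v i ^ 2 ≤ ∑ i, ∑ j, v i * v j * rotKernel g (x i) (x j)

/-! ### Calculus of positive semi-definite kernels -/

section Forms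

variable {α : Type*} {A : Set α} {k l : α → α → ℝ}

lemma IsPSDKernelOn.sum_nonneg (h : IsPSDKernelOn A k) {N : ℕ} {x : Fin N → α}
    (hx : ∀ i, x i ∈ A) (v : Fin N → ℝ) : 0 ≤ ∑ i, ∑ j, v i * v j * k (x i) (x j) := by
  have h1 := (h N x hx).dotProduct_mulVec_nonneg v
  simp only [dotProduct, Matrix.mulVec, Matrix.of_apply, star_trivial, Finset.mul_sum] at h1
  refine h1.trans_eq (Finset.sum_congr rfl fun i _ => Finset.sum_congr rfl fun j _ => by ring)

lemma IsPSDKernelOn.symm (h : IsPSDKernelOn A k) {x y : α} (hx : x ∈ A) (hy : y ∈ A) :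
    k x y = k y x := by
  have := (h 2 ![x, y] (by simp [Fin.forall_fin_two, hx, hy])).isHermitian.apply 0 1
  simpa using this.symm

lemma isPSDKernelOn_of_sum_nonneg (hs : ∀ x ∈ A, ∀ y ∈ A, k x y = k y x)
    (h : ∀ (N : ℕ) (x : Fin N → α), (∀ i, x i ∈ A) → ∀ v : Fin N → ℝ,
      0 ≤ ∑ i, ∑ j, v i * v j * k (x i) (x j)) : IsPSDKernelOn A k := by
  intro N x hx
  refine Matrix.PosSemidef.of_dotProduct_mulVec_nonneg ?_ fun v => ?_
  · ext i j
    simpa using hs _ (hx j) _ (hx i)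
  · refine (h N x hx v).trans_eq ?_
    simp only [dotProduct, Matrix.mulVec, Matrix.of_apply, star_trivial, Finset.mul_sum]
    exact Finset.sum_congr rfl fun i _ => Finset.sum_congr rfl fun j _ => by ring

lemma IsPSDKernelOn.apply_self_nonneg (h : IsPSDKernelOn A k) {x : α} (hx : x ∈ A) :
    0 ≤ k x x := by
  simpa using h.sum_nonneg (x := fun _ : Fin 1 => x) (fun _ => hx) 1

/-- The form is nonnegative at the vectors `(1, 1)` and `(1, -1)`. -/
lemma IsPSDKernelOn.abs_le (h : IsPSDKernelOn A k) {x y : α} (hx : x ∈ A) (hy : y ∈ A) :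
    |k x y| ≤ (k x x + k y y) / 2 := by
  have hxy : ∀ i, ![x, y] i ∈ A := by simp [Fin.forall_fin_two, hx, hy]
  have h1 := h.sum_nonneg hxy ![1, 1]
  have h2 := h.sum_nonneg hxy ![1, -1]
  have h3 := h.symm hx hy
  simp [Fin.sum_univ_two] at h1 h2
  refine _root_.abs_le.2 ⟨?_, ?_⟩ <;> linarith

lemma IsPSDKernelOn.mul (hk : IsPSDKernelOn A k) (hl : IsPSDKernelOn A l) :
    IsPSDKernelOn A fun x y => k x y * l x y := by
  intro N x hx
  exact (hk N x hx).hadamard (hl N x hx)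

lemma isPSDKernelOn_const {c : ℝ} (hc : 0 ≤ c) : IsPSDKernelOn A fun _ _ => c := by
  refine isPSDKernelOn_of_sum_nonneg (fun _ _ _ _ => rfl) fun N x _ v => ?_
  have : ∑ i, ∑ j, v i * v j * c = (∑ i, v i) ^ 2 * c := by
    rw [sq, Finset.sum_mul_sum, Finset.sum_mul]
    exact Finset.sum_congr rfl fun i _ => by rw [Finset.sum_mul]
  rw [this]
  positivity

lemma IsPSDKernelOn.pow (hk : IsPSDKernelOn A k) (n : ℕ) :
    IsPSDKernelOn A fun x y => k x y ^ n := by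
  induction n with
  | zero => simpa using isPSDKernelOn_const (A := A) zero_le_one
  | succ n ih => simpa only [pow_succ] using ih.mul hk

lemma IsPSDKernelOn.comp {β : Type*} (hk : IsPSDKernelOn A k) (f : β → α) :
    IsPSDKernelOn (f ⁻¹' A) fun x y => k (f x) (f y) := fun N x hx => hk N (fun i => f (x i)) hx

lemma IsPSDKernelOn.mono {A' : Set α} (hk : IsPSDKernelOn A k) (h : A' ⊆ A) :
    IsPSDKernelOn A' k := fun N x hx => hk N x fun i => h (hx i)

lemma isPSDKernelOn_inner {V : Type*} [NormedAddCommGroup V] [InnerProductSpace ℝ V] (A : Set V) :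
    IsPSDKernelOn A fun x y => inner ℝ x y := by
  refine isPSDKernelOn_of_sum_nonneg (fun x _ y _ => real_inner_comm y x) fun N x _ v => ?_
  have : ∑ i, ∑ j, v i * v j * inner ℝ (x i) (x j) =
      inner ℝ (∑ i, v i • x i) (∑ i, v i • x i) := by
    rw [sum_inner]
    refine Finset.sum_congr rfl fun i _ => ?_
    rw [inner_sum]
    refine Finset.sum_congr rfl fun j _ => ?_
    rw [inner_smul_left, inner_smul_right]
    simp [mul_assoc]
  rw [this]
  exact real_inner_self_nonneg

/-- The off-diagonal part costs at most `e (∑ |vᵢ|)² ≤ N e ∑ vᵢ²`. This is the origin of the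
condition that `N δ^(M+1)` be small. -/
lemma le_form_of_diag_offDiag {N : ℕ} {K : Fin N → Fin N → ℝ} {D e : ℝ} (he : 0 ≤ e)
    (hd : ∀ i, D ≤ K i i) (ho : ∀ i j, i ≠ j → |K i j| ≤ e) (v : Fin N → ℝ) :
    (D - N * e) * ∑ i, v i ^ 2 ≤ ∑ i, ∑ j, v i * v j * K i j := by
  have h1 : ∀ i j, (if i = j then D * v i ^ 2 else 0) - e * (|v i| * |v j|) ≤
      v i * v j * K i j := by
    intro i j
    split_ifs with hij
    · subst hij
      have h2 : D * v i ^ 2 ≤ v i * v i * K i i := by nlinarith [hd i, sq_nonneg (v i)]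
      have : 0 ≤ e * (|v i| * |v i|) := by positivity
      linarith
    · have h2 : |v i * v j * K i j| ≤ |v i| * |v j| * e := by
        rw [abs_mul, abs_mul]
        gcongr
        exact ho i j hij
      linarith [neg_abs_le (v i * v j * K i j)]
  have h2 : (∑ i, |v i|) ^ 2 ≤ N * ∑ i, v i ^ 2 := by
    have := sq_sum_le_card_mul_sum_sq (s := Finset.univ) (f := fun i => |v i|)
    simpa using this
  calc (D - N * e) * ∑ i, v i ^ 2 = D * ∑ i, v i ^ 2 - e * (N * ∑ i, v i ^ 2) := by ring
    _ ≤ D * ∑ i, v i ^ 2 - e * (∑ i, |v i|) ^ 2 := by gcongr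
    _ = ∑ i, ∑ j, ((if i = j then D * v i ^ 2 else 0) - e * (|v i| * |v j|)) := by
      rw [sq (∑ i, |v i|), Finset.sum_mul_sum]
      simp only [Finset.sum_sub_distrib, Finset.sum_ite_eq, Finset.mem_univ, if_true,
        Finset.mul_sum]
    _ ≤ _ := Finset.sum_le_sum fun i _ => Finset.sum_le_sum fun j _ => h1 i j

end Forms

/-! ### Kernels with positive semi-definite coefficients: tails and lower bounds -/

section Series

variable {g : ℝ → ℝ → ℝ → ℝ} {gc : ℕ → ℝ → ℝ → ℝ} {T : Set ℝ} {M : ℕ} {C : ℝ}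

/-- Positive semi-definiteness bounds `|gⱼ(s, t)|` by the mean of `gⱼ(s, s)` and `gⱼ(t, t)`, and on
the diagonal `∑ gⱼ(s, s) s^j` is at most `C`. Since `s ≥ 1/2`, `δ^j ≤ (2δ)^(M+1) s^j` for `j > M`,
so the tail off the diagonal is dominated termwise by the diagonal series. No bound on individual
coefficients is needed. -/
lemma abs_series_tail_le (hT : ∀ s ∈ T, 1 / 2 ≤ s) (hgc : ∀ j, IsPSDKernelOn T (gc j))
    (hexp : ∀ (d : ℕ) (x x' : E d), ‖x‖ ^ 2 ∈ T → ‖x'‖ ^ 2 ∈ T →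
      HasSum (fun j : ℕ => gc j (‖x‖ ^ 2) (‖x'‖ ^ 2) * (inner ℝ x x') ^ j) (rotKernel g x x'))
    (hC : ∀ (d : ℕ) (x : E d), ‖x‖ ^ 2 ∈ T → rotKernel g x x ≤ C)
    {d : ℕ} {x x' : E d} (hx : ‖x‖ ^ 2 ∈ T) (hx' : ‖x'‖ ^ 2 ∈ T) {δ : ℝ} (hδ : δ ≤ 1 / 2)
    (hw : |inner ℝ x x'| ≤ δ) :
    |rotKernel g x x' - ∑ j ∈ Finset.range (M + 1),
      gc j (‖x‖ ^ 2) (‖x'‖ ^ 2) * (inner ℝ x x') ^ j| ≤ C * (2 * δ) ^ (M + 1) := by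
  have hδ0 : 0 ≤ δ := (abs_nonneg _).trans hw
  have hdiag : ∀ y : E d, ‖y‖ ^ 2 ∈ T → HasSum (fun j => gc j (‖y‖ ^ 2) (‖y‖ ^ 2) *
      (‖y‖ ^ 2) ^ j) (rotKernel g y y) := by
    intro y hy
    have := hexp d y y hy hy
    simpa only [real_inner_self_eq_norm_sq] using this
  have hpos : ∀ y : E d, ‖y‖ ^ 2 ∈ T → ∀ j, 0 ≤ gc j (‖y‖ ^ 2) (‖y‖ ^ 2) * (‖y‖ ^ 2) ^ j :=
    fun y hy j => mul_nonneg ((hgc j).apply_self_nonneg hy) (by positivity)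
  have htail := (hasSum_nat_add_iff' (M + 1)).2 (hexp d x x' hx hx')
  have h1 := (hasSum_nat_add_iff' (M + 1)).2 (hdiag x hx)
  have h2 := (hasSum_nat_add_iff' (M + 1)).2 (hdiag x' hx')
  have h3 := ((h1.add h2).mul_left ((2 * δ) ^ (M + 1) / 2))
  have hb : ∀ j, ‖gc (j + (M + 1)) (‖x‖ ^ 2) (‖x'‖ ^ 2) * (inner ℝ x x') ^ (j + (M + 1))‖ ≤
      (2 * δ) ^ (M + 1) / 2 * (gc (j + (M + 1)) (‖x‖ ^ 2) (‖x‖ ^ 2) * (‖x‖ ^ 2) ^ (j + (M + 1)) +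
        gc (j + (M + 1)) (‖x'‖ ^ 2) (‖x'‖ ^ 2) * (‖x'‖ ^ 2) ^ (j + (M + 1))) := by
    intro j
    set k := j + (M + 1) with hk
    have hp : ∀ s ∈ T, δ ^ k ≤ (2 * δ) ^ (M + 1) * s ^ k := by
      intro s hs
      have hs' := hT s hs
      calc δ ^ k ≤ (2 * δ * s) ^ k := by
            apply pow_le_pow_left₀ hδ0
            nlinarith
        _ = (2 * δ) ^ k * s ^ k := mul_pow _ _ _
        _ ≤ (2 * δ) ^ (M + 1) * s ^ k := by
            have : (2 * δ) ^ k ≤ (2 * δ) ^ (M + 1) :=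
              pow_le_pow_of_le_one (by positivity) (by linarith) (by omega)
            have : 0 ≤ s ^ k := by positivity
            gcongr
    rw [Real.norm_eq_abs, abs_mul, abs_pow]
    have ha := (hgc k).abs_le hx hx'
    have hg1 := (hgc k).apply_self_nonneg hx
    have hg2 := (hgc k).apply_self_nonneg hx'
    calc _ ≤ (gc k (‖x‖ ^ 2) (‖x‖ ^ 2) + gc k (‖x'‖ ^ 2) (‖x'‖ ^ 2)) / 2 * δ ^ k := by gcongr
      _ = gc k (‖x‖ ^ 2) (‖x‖ ^ 2) / 2 * δ ^ k + gc k (‖x'‖ ^ 2) (‖x'‖ ^ 2) / 2 * δ ^ k := by ring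
      _ ≤ gc k (‖x‖ ^ 2) (‖x‖ ^ 2) / 2 * ((2 * δ) ^ (M + 1) * (‖x‖ ^ 2) ^ k) +
          gc k (‖x'‖ ^ 2) (‖x'‖ ^ 2) / 2 * ((2 * δ) ^ (M + 1) * (‖x'‖ ^ 2) ^ k) := by
          gcongr
          · exact hp _ hx
          · exact hp _ hx'
      _ = _ := by ring
  have h4 := tsum_of_norm_bounded h3 hb
  rw [htail.tsum_eq, Real.norm_eq_abs] at h4
  refine h4.trans ?_
  have e1 : rotKernel g x x - ∑ j ∈ Finset.range (M + 1), gc j (‖x‖ ^ 2) (‖x‖ ^ 2) *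
      (‖x‖ ^ 2) ^ j ≤ C := by
    linarith [hC d x hx, Finset.sum_nonneg fun j (_ : j ∈ Finset.range (M + 1)) => hpos x hx j]
  have e2 : rotKernel g x' x' - ∑ j ∈ Finset.range (M + 1), gc j (‖x'‖ ^ 2) (‖x'‖ ^ 2) *
      (‖x'‖ ^ 2) ^ j ≤ C := by
    linarith [hC d x' hx', Finset.sum_nonneg fun j (_ : j ∈ Finset.range (M + 1)) => hpos x' hx' j]
  calc _ ≤ (2 * δ) ^ (M + 1) / 2 * (C + C) := by gcongr
    _ = _ := by ring

/-- By the Schur product theorem the terms of order at most `M` contribute a nonnegative form and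
can be discarded. What remains has diagonal at least `c` and off-diagonal entries bounded by
`abs_series_tail_le`. -/
lemma series_coercive (hT : ∀ s ∈ T, 1 / 2 ≤ s) (hgc : ∀ j, IsPSDKernelOn T (gc j))
    (hexp : ∀ (d : ℕ) (x x' : E d), ‖x‖ ^ 2 ∈ T → ‖x'‖ ^ 2 ∈ T →
      HasSum (fun j : ℕ => gc j (‖x‖ ^ 2) (‖x'‖ ^ 2) * (inner ℝ x x') ^ j) (rotKernel g x x'))
    (hC : ∀ (d : ℕ) (x : E d), ‖x‖ ^ 2 ∈ T → rotKernel g x x ≤ C) (hC0 : 0 ≤ C)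
    {c : ℝ} (hc : ∀ (d : ℕ) (x : E d), ‖x‖ ^ 2 ∈ T → c ≤ rotKernel g x x -
      ∑ j ∈ Finset.range (M + 1), gc j (‖x‖ ^ 2) (‖x‖ ^ 2) * (‖x‖ ^ 2) ^ j)
    {d N : ℕ} {x : Fin N → E d} (hx : ∀ i, ‖x i‖ ^ 2 ∈ T) {δ : ℝ} (hδ0 : 0 ≤ δ) (hδ : δ ≤ 1 / 2)
    (hw : ∀ i j, i ≠ j → |inner ℝ (x i) (x j)| ≤ δ) (v : Fin N → ℝ) :
    (c - N * (C * (2 * δ) ^ (M + 1))) * ∑ i, v i ^ 2 ≤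
      ∑ i, ∑ j, v i * v j * rotKernel g (x i) (x j) := by
  set K : Fin N → Fin N → ℝ := fun i j => rotKernel g (x i) (x j) -
    ∑ k ∈ Finset.range (M + 1), gc k (‖x i‖ ^ 2) (‖x j‖ ^ 2) * (inner ℝ (x i) (x j)) ^ k with hK
  have h1 := le_form_of_diag_offDiag (K := K) (D := c) (e := C * (2 * δ) ^ (M + 1))
    (by positivity) (fun i => by
      simp only [hK, real_inner_self_eq_norm_sq]
      exact hc d (x i) (hx i))
    (fun i j hij => abs_series_tail_le hT hgc hexp hC (hx i) (hx j) hδ (hw i j hij)) v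
  refine h1.trans ?_
  have h2 : ∑ i, ∑ j, v i * v j * rotKernel g (x i) (x j) = ∑ i, ∑ j, v i * v j * K i j +
      ∑ k ∈ Finset.range (M + 1), ∑ i, ∑ j, v i * v j *
        (gc k (‖x i‖ ^ 2) (‖x j‖ ^ 2) * (inner ℝ (x i) (x j)) ^ k) := by
    rw [Finset.sum_comm (s := Finset.range (M + 1)), ← Finset.sum_add_distrib]
    have : ∀ i, ∑ k ∈ Finset.range (M + 1), ∑ j, v i * v j *
        (gc k (‖x i‖ ^ 2) (‖x j‖ ^ 2) * (inner ℝ (x i) (x j)) ^ k) = ∑ j, v i * v j *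
        ∑ k ∈ Finset.range (M + 1), (gc k (‖x i‖ ^ 2) (‖x j‖ ^ 2) * (inner ℝ (x i) (x j)) ^ k) := by
      intro i
      rw [Finset.sum_comm]
      exact Finset.sum_congr rfl fun j _ => by rw [Finset.mul_sum]
    refine Finset.sum_congr rfl fun i _ => ?_
    rw [this, ← Finset.sum_add_distrib]
    exact Finset.sum_congr rfl fun j _ => by simp only [hK]; ring
  rw [h2, le_add_iff_nonneg_right]
  refine Finset.sum_nonneg fun k _ => ?_
  have hpsd := ((hgc k).comp fun y : E d => ‖y‖ ^ 2).mul ((isPSDKernelOn_inner _).pow k)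
  exact hpsd.sum_nonneg (x := x) hx v

end Series

/-! ### Power series kernels -/

lemma eventually_box {p : ℝ × ℝ → Prop} (h : ∀ᶠ z in 𝓝 ((1 : ℝ), (1 : ℝ)), p z) :
    ∀ᶠ δ in 𝓝[>] (0 : ℝ), ∀ s t, |s - 1| ≤ δ → |t - 1| ≤ δ → p (s, t) := by
  obtain ⟨ε, hε, hb⟩ := Metric.eventually_nhds_iff.1 h
  filter_upwards [Ioo_mem_nhdsGT hε] with δ hδ s t hs ht
  apply hb
  rw [Prod.dist_eq, max_lt_iff, Real.dist_eq, Real.dist_eq]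
  exact ⟨hs.trans_lt hδ.2, ht.trans_lt hδ.2⟩

lemma eventually_box_bounded {f : ℝ × ℝ → ℝ} (h : ContinuousAt f (1, 1)) :
    ∀ᶠ δ in 𝓝[>] (0 : ℝ), ∀ s t, |s - 1| ≤ δ → |t - 1| ≤ δ → |f (s, t)| ≤ |f (1, 1)| + 1 := by
  refine eventually_box (p := fun z => |f z| ≤ |f (1, 1)| + 1) ?_
  have := (continuous_abs.continuousAt.comp h).eventually_lt_const (lt_add_one _)
  filter_upwards [this] with z hz using hz.le

/-- Taylor expansion in the first variable, locally uniformly in the second one. -/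
lemma exists_taylor_fst (m : ℕ) : ∀ f : ℝ × ℝ → ℝ, ContDiffAt ℝ m f (1, 1) →
    ∃ (a : ℕ → ℝ → ℝ) (C : ℝ), 0 ≤ C ∧ ∀ᶠ δ in 𝓝[>] (0 : ℝ),
      (∀ l t, |t - 1| ≤ δ → |a l t| ≤ C) ∧ ∀ s t, |s - 1| ≤ δ → |t - 1| ≤ δ →
        |f (s, t) - ∑ l ∈ Finset.range m, a l t * (s - 1) ^ l| ≤ C * |s - 1| ^ m := by
  induction m with
  | zero =>
    intro f hf
    refine ⟨fun _ _ => 0, |f (1, 1)| + 1, by positivity, ?_⟩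
    filter_upwards [eventually_box_bounded hf.continuousAt] with δ hδ
    refine ⟨fun _ _ _ => by simp; positivity, fun s t hs ht => by simpa using hδ s t hs ht⟩
  | succ m ih =>
    intro f hf
    have hf' : ContDiffAt ℝ m (fun p => fderiv ℝ f p (1, 0)) (1, 1) :=
      (hf.fderiv_right (m := m) (by norm_cast)).clm_apply contDiffAt_const
    obtain ⟨a, C, hC, h⟩ := ih _ hf'
    have hd : ∀ᶠ z in 𝓝 ((1 : ℝ), (1 : ℝ)), DifferentiableAt ℝ f z := by
      have h1 : ContDiffAt ℝ 1 f (1, 1) := hf.of_le (by norm_cast; omega)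
      filter_upwards [h1.eventually (by simp)] with z hz
      exact hz.differentiableAt (by simp)
    -- Induction through `∂₁f`: integrating its expansion from `1` to `s` shifts the index and
    -- divides by `l`, while `f(1, t)` becomes the constant term.
    refine ⟨fun l t => if l = 0 then f (1, t) else a (l - 1) t / l,
      C + (|f (1, 1)| + 1), by positivity, ?_⟩
    filter_upwards [h, eventually_box hd, eventually_box_bounded hf.continuousAt,
      self_mem_nhdsWithin] with δ h1 h2 h3 hδ0
    have hδ : 0 < δ := hδ0
    refine ⟨fun l t ht => ?_, fun s t hs ht => ?_⟩
    · split_ifs with hl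
      · have := h3 1 t (by simpa using hδ.le) ht
        linarith
      · have hl1 : (1 : ℝ) ≤ l := by exact_mod_cast Nat.one_le_iff_ne_zero.2 hl
        rw [abs_div, abs_of_pos (by linarith : (0 : ℝ) < l), div_le_iff₀ (by linarith)]
        have := h1.1 (l - 1) t ht
        have h5 := abs_nonneg (f (1, 1))
        nlinarith
    · rw [Finset.sum_range_succ']
      simp only [Nat.add_eq_zero_iff, one_ne_zero, and_false, if_false, Nat.add_sub_cancel,
        if_true, pow_zero, mul_one]
      set H : ℝ → ℝ := fun u => f (u, t) -
        ∑ l ∈ Finset.range m, a l t / ((l + 1 : ℕ) : ℝ) * (u - 1) ^ (l + 1) with hH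
      have hder : ∀ u ∈ Set.uIcc 1 s, HasDerivWithinAt H (fderiv ℝ f (u, t) (1, 0) -
          ∑ l ∈ Finset.range m, a l t * (u - 1) ^ l) (Set.uIcc 1 s) u := by
        intro u hu
        have hu1 : |u - 1| ≤ δ := (Set.abs_sub_left_of_mem_uIcc hu).trans hs
        refine HasDerivAt.hasDerivWithinAt (HasDerivAt.sub ?_ ?_)
        · have e1 := (h2 u t hu1 ht).hasFDerivAt
          have e2 : HasDerivAt (fun u : ℝ => (u, t)) ((1 : ℝ), (0 : ℝ)) u :=
            (hasDerivAt_id u).prodMk (hasDerivAt_const u t)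
          exact e1.comp_hasDerivAt u e2
        · refine HasDerivAt.fun_sum fun l _ => ?_
          have hl : ((l + 1 : ℕ) : ℝ) ≠ 0 := by positivity
          have e3 : HasDerivAt (fun u : ℝ => a l t / ((l + 1 : ℕ) : ℝ) * (u - 1) ^ (l + 1))
              (a l t / ((l + 1 : ℕ) : ℝ) * (((l + 1 : ℕ) : ℝ) * (u - 1) ^ (l + 1 - 1) * 1)) u :=
            (((hasDerivAt_id u).sub_const 1).pow (l + 1)).const_mul _
          have e5 : a l t / ((l + 1 : ℕ) : ℝ) * (((l + 1 : ℕ) : ℝ) * (u - 1) ^ (l + 1 - 1) * 1) =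
              a l t * (u - 1) ^ l := by
            rw [Nat.add_sub_cancel]
            field_simp
          rw [← e5]
          exact e3
      have hbound : ∀ u ∈ Set.uIcc 1 s, ‖fderiv ℝ f (u, t) (1, 0) -
          ∑ l ∈ Finset.range m, a l t * (u - 1) ^ l‖ ≤ C * |s - 1| ^ m := by
        intro u hu
        have hus := Set.abs_sub_left_of_mem_uIcc hu
        refine (h1.2 u t (hus.trans hs) ht).trans ?_
        gcongr
      -- The mean value inequality for the remainder `H` supplies the additional factor `|s - 1|`.
      have := Convex.norm_image_sub_le_of_norm_hasDerivWithin_le hder hbound (convex_uIcc 1 s)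
        Set.left_mem_uIcc Set.right_mem_uIcc
      have hH1 : H 1 = f (1, t) := by
        simp only [hH, sub_self]
        rw [Finset.sum_eq_zero fun l _ => by simp, sub_zero]
      rw [hH1, Real.norm_eq_abs, Real.norm_eq_abs] at this
      have e4 : f (s, t) - (∑ l ∈ Finset.range m, a l t / ((l + 1 : ℕ) : ℝ) * (s - 1) ^ (l + 1) +
          f (1, t)) = H s - f (1, t) := by simp only [hH]; ring
      rw [e4]
      refine this.trans ?_
      rw [mul_assoc, ← pow_succ]
      gcongr
      have := abs_nonneg (f (1, 1))
      linarith

/-- On the unit sphere the coefficients are constant, so no Taylor expansion is needed and only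
powers of the inner product up to `M` occur; this is why the degree is `M` and not `2M`. -/
theorem SpherePowerSeriesKernel.barrierKernel {g : ℝ → ℝ → ℝ → ℝ} {a : ℕ → ℝ} {M : ℕ}
    (h : SpherePowerSeriesKernel g a M) : BarrierKernel g M M {1} := by
  have hT : ∀ s ∈ ({1} : Set ℝ), (1 / 2 : ℝ) ≤ s := by
    intro s hs; rw [Set.mem_singleton_iff.1 hs]; norm_num
  have hone : ∀ {d : ℕ} {x : E d}, ‖x‖ ^ 2 ∈ ({1} : Set ℝ) → ‖x‖ = 1 := by
    intro d x hx
    have := Set.mem_singleton_iff.1 hx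
    nlinarith [norm_nonneg x]
  have hgc : ∀ j, IsPSDKernelOn ({1} : Set ℝ) (fun _ _ : ℝ => a j) := fun j =>
    isPSDKernelOn_const (h.nonneg j)
  have hexp : ∀ (d : ℕ) (x x' : E d), ‖x‖ ^ 2 ∈ ({1} : Set ℝ) → ‖x'‖ ^ 2 ∈ ({1} : Set ℝ) →
      HasSum (fun j : ℕ => (fun _ _ : ℝ => a j) (‖x‖ ^ 2) (‖x'‖ ^ 2) * (inner ℝ x x') ^ j)
        (rotKernel g x x') := fun d x x' hx hx' => h.expansion d x x' (hone hx) (hone hx')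
  have hval : ∀ (d : ℕ) (x : E d), ‖x‖ ^ 2 ∈ ({1} : Set ℝ) → rotKernel g x x = g 1 1 1 := by
    intro d x hx
    rw [rotKernel, real_inner_self_eq_norm_sq, Set.mem_singleton_iff.1 hx]
  have hC : ∀ (d : ℕ) (x : E d), ‖x‖ ^ 2 ∈ ({1} : Set ℝ) → rotKernel g x x ≤ |g 1 1 1| :=
    fun d x hx => (hval d x hx).le.trans (le_abs_self _)
  refine ⟨h.posSemidef, ?_, ?_⟩
  · refine ⟨fun k l _ => if l = 0 ∧ k ≤ M then a k else 0,
      |g 1 1 1| * 2 ^ (M + 1) + ∑ k ∈ Finset.range (M + 1), a k, ?_, ?_, ?_⟩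
    · exact add_nonneg (by positivity) (Finset.sum_nonneg fun k _ => h.nonneg k)
    · intro k l t hne
      by_contra hcon
      exact hne (if_neg (by omega))
    · filter_upwards [Ioo_mem_nhdsGT (show (0 : ℝ) < 1 / 2 by norm_num)] with δ hδ
      have hsum : 0 ≤ ∑ k ∈ Finset.range (M + 1), a k := Finset.sum_nonneg fun k _ => h.nonneg k
      refine ⟨fun k hk l _ t _ => ?_, fun d x x' hx hx' _ _ hw => ?_⟩
      · split_ifs
        · rw [abs_of_nonneg (h.nonneg k)]
          have := Finset.single_le_sum (f := a) (fun k _ => h.nonneg k)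
            (Finset.mem_range.2 (Nat.lt_succ_of_le hk))
          have : 0 ≤ |g 1 1 1| * 2 ^ (M + 1) := by positivity
          linarith
        · rw [abs_zero]
          positivity
      · have h1 := abs_series_tail_le (M := M) hT hgc hexp hC hx hx' hδ.2.le hw
        have h2 : ∀ k ∈ Finset.range (M + 1), ∑ l ∈ Finset.range (M + 1),
            (if l = 0 ∧ k ≤ M then a k else 0) * (‖x‖ ^ 2 - 1) ^ l * (inner ℝ x x') ^ k =
            a k * (inner ℝ x x') ^ k := by
          intro k hk
          rw [Finset.sum_eq_single 0]
          · simp [Nat.lt_succ_iff.1 (Finset.mem_range.1 hk)]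
          · intro l _ hl; simp [hl]
          · simp
        rw [Finset.sum_congr rfl h2]
        refine h1.trans ?_
        rw [mul_pow, ← mul_assoc]
        have : 0 ≤ δ ^ (M + 1) := pow_nonneg hδ.1.le _
        gcongr
        linarith
  · obtain ⟨J, hJ, hJpos⟩ := h.pos
    -- The tail of the diagonal series has nonnegative terms, one of which is `a J`, at position `J
    -- - (M + 1)`.
    have hc : ∀ (d : ℕ) (x : E d), ‖x‖ ^ 2 ∈ ({1} : Set ℝ) → a J ≤ rotKernel g x x -
        ∑ j ∈ Finset.range (M + 1), a j * (‖x‖ ^ 2) ^ j := by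
      intro d x hx
      have h1 := hexp d x x hx hx
      simp only [real_inner_self_eq_norm_sq, Set.mem_singleton_iff.1 hx, one_pow, mul_one] at h1 ⊢
      have h2 := (hasSum_nat_add_iff' (M + 1)).2 h1
      have h3 := le_hasSum h2 (J - (M + 1)) fun j _ => h.nonneg _
      rwa [Nat.sub_add_cancel hJ] at h3
    set D := |g 1 1 1| * 2 ^ (M + 1) + 1 with hD
    have hD0 : 0 < D := by positivity
    refine ⟨a J / 2, a J / (2 * D), by positivity, by positivity, ?_⟩
    filter_upwards [Ioo_mem_nhdsGT (show (0 : ℝ) < 1 / 2 by norm_num)] with δ hδ d N x hN hx hw v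
    have h1 := series_coercive (M := M) hT hgc hexp hC (abs_nonneg _) hc (fun i => (hx i).1)
      hδ.1.le hδ.2.le hw v
    refine le_trans ?_ h1
    have h2 : N * (|g 1 1 1| * (2 * δ) ^ (M + 1)) ≤ a J / 2 := by
      have h3 : 0 ≤ N * δ ^ (M + 1) := mul_nonneg (by positivity) (pow_nonneg hδ.1.le _)
      calc N * (|g 1 1 1| * (2 * δ) ^ (M + 1)) =
          (N * δ ^ (M + 1)) * (|g 1 1 1| * 2 ^ (M + 1)) := by rw [mul_pow]; ring
        _ ≤ (N * δ ^ (M + 1)) * D := by gcongr; rw [hD]; linarith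
        _ ≤ a J / (2 * D) * D := by gcongr
        _ = a J / 2 := by field_simp
    have h3 : 0 ≤ ∑ i, v i ^ 2 := Finset.sum_nonneg fun i _ => sq_nonneg _
    have h4 : a J / 2 ≤ a J - N * (|g 1 1 1| * (2 * δ) ^ (M + 1)) := by linarith
    gcongr

lemma norm_sq_sqrt_smul_single {s : ℝ} (hs : 0 ≤ s) :
    ‖(Real.sqrt s • EuclideanSpace.single 0 1 : E 1)‖ ^ 2 = s := by
  rw [norm_smul, PiLp.norm_single, norm_one, mul_one, Real.norm_eq_abs, sq_abs,
    Real.sq_sqrt hs]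

/-- Continuity of the kernel on `ℝ¹`, along the points `√s · e`. -/
lemma PowerSeriesKernel.continuousAt_diag {g : ℝ → ℝ → ℝ → ℝ} {gc : ℕ → ℝ → ℝ → ℝ} {M : ℕ}
    (h : PowerSeriesKernel g gc M) : ContinuousAt (fun s => g s s s) 1 := by
  have h1 : Continuous fun s : ℝ => rotKernel g (Real.sqrt s • EuclideanSpace.single 0 1 : E 1)
      (Real.sqrt s • EuclideanSpace.single 0 1 : E 1) :=
    (h.continuous 1).comp (f := fun s : ℝ => ((Real.sqrt s • EuclideanSpace.single 0 1 : E 1),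
      (Real.sqrt s • EuclideanSpace.single 0 1 : E 1))) (by fun_prop)
  refine h1.continuousAt.congr ?_
  filter_upwards [Ioi_mem_nhds (show (0 : ℝ) < 1 by norm_num)] with s hs
  rw [rotKernel, real_inner_self_eq_norm_sq, norm_sq_sqrt_smul_single (le_of_lt hs)]

/-- The series is cut after order `M`, and each coefficient `g_k`, `k ≤ M`, is expanded in its first
argument to order `M + 1 - k`. Multiplied by the `k`-th power of the inner product, every remainder
is of order `δ^(M+1)`. Coercivity follows from `series_coercive`. -/
theorem PowerSeriesKernel.barrierKernel {g : ℝ → ℝ → ℝ → ℝ} {gc : ℕ → ℝ → ℝ → ℝ} {M : ℕ}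
    (h : PowerSeriesKernel g gc M) : BarrierKernel g M (2 * M) Set.univ := by
  obtain ⟨δ₁, hδ₁, hgc, hexp⟩ := h.expansion
  have hsm : ∀ k ≤ M, ContDiffAt ℝ ((M + 1 - k : ℕ) : WithTop ℕ∞)
      (fun p : ℝ × ℝ => gc k p.1 p.2) (1, 1) := by
    intro k hk
    obtain ⟨U, hU, hc⟩ := h.smooth k hk
    exact hc.contDiffAt hU
  -- `τ` is the diagonal of the tail. It is continuous at `1` as a difference of continuous
  -- functions, although coefficients of order above `M` need not be continuous; hence `τ(1) ≥
  -- g_J(1, 1) > 0` persists, up to a factor `1/2`, on a neighbourhood `T`.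
  set τ : ℝ → ℝ := fun s => g s s s - ∑ k ∈ Finset.range (M + 1), gc k s s * s ^ k with hτ
  have hτc : ContinuousAt τ 1 := by
    refine h.continuousAt_diag.sub ?_
    refine tendsto_finsetSum _ fun k hk => ?_
    have h1 := (hsm k (Nat.lt_succ_iff.1 (Finset.mem_range.1 hk))).continuousAt
    have h2 : ContinuousAt (fun s : ℝ => gc k s s) 1 :=
      ContinuousAt.comp (f := fun s : ℝ => (s, s)) (g := fun p : ℝ × ℝ => gc k p.1 p.2) h1
        (by fun_prop)
    exact h2.mul (continuousAt_id.pow k)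
  obtain ⟨J, hJ, hJpos⟩ := h.pos
  have hτ1 : gc J 1 1 ≤ τ 1 := by
    have hn := norm_sq_sqrt_smul_single (zero_le_one (α := ℝ))
    have hmem : ‖(Real.sqrt 1 • EuclideanSpace.single 0 1 : E 1)‖ ^ 2 ∈
        Set.Icc (1 - δ₁) (1 + δ₁) := by rw [hn]; constructor <;> linarith
    have h1 := hexp 1 _ _ hmem hmem
    rw [rotKernel] at h1
    simp only [real_inner_self_eq_norm_sq, hn] at h1
    have h2 := (hasSum_nat_add_iff' (M + 1)).2 h1
    have h3 := le_hasSum h2 (J - (M + 1)) fun j _ => mul_nonneg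
      ((hgc _).apply_self_nonneg (by constructor <;> linarith)) (by positivity)
    simpa [hτ, Nat.sub_add_cancel (show M + 1 ≤ J from hJ)] using h3
  have hev : ∀ᶠ s in 𝓝 (1 : ℝ), gc J 1 1 / 2 < τ s ∧ g s s s < |g 1 1 1| + 1 ∧
      s ∈ Set.Icc (1 - δ₁) (1 + δ₁) ∧ 1 / 2 < s := by
    refine (hτc.eventually_const_lt (by linarith)).and
      ((h.continuousAt_diag.eventually_lt_const ?_).and
      ((Filter.Eventually.and (p := fun s => s ∈ Set.Icc (1 - δ₁) (1 + δ₁))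
      (Icc_mem_nhds (by linarith) (by linarith)) (lt_mem_nhds (by norm_num)))))
    linarith [le_abs_self (g 1 1 1)]
  obtain ⟨ε, hε, hball⟩ := Metric.eventually_nhds_iff.1 hev
  set T : Set ℝ := Metric.ball 1 ε with hTdef
  have hTs : ∀ s ∈ T, gc J 1 1 / 2 < τ s ∧ g s s s < |g 1 1 1| + 1 ∧
      s ∈ Set.Icc (1 - δ₁) (1 + δ₁) ∧ 1 / 2 < s := fun s hs => hball hs
  have hT : ∀ s ∈ T, (1 / 2 : ℝ) ≤ s := fun s hs => (hTs s hs).2.2.2.le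
  have hgcT : ∀ j, IsPSDKernelOn T (gc j) := fun j => (hgc j).mono fun s hs => (hTs s hs).2.2.1
  have hexpT : ∀ (d : ℕ) (x x' : E d), ‖x‖ ^ 2 ∈ T → ‖x'‖ ^ 2 ∈ T →
      HasSum (fun j : ℕ => gc j (‖x‖ ^ 2) (‖x'‖ ^ 2) * (inner ℝ x x') ^ j) (rotKernel g x x') :=
    fun d x x' hx hx' => hexp d x x' (hTs _ hx).2.2.1 (hTs _ hx').2.2.1
  set C₀ := |g 1 1 1| + 1 with hC₀
  have hC₀0 : 0 ≤ C₀ := by positivity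
  have hC : ∀ (d : ℕ) (x : E d), ‖x‖ ^ 2 ∈ T → rotKernel g x x ≤ C₀ := by
    intro d x hx
    rw [rotKernel, real_inner_self_eq_norm_sq]
    exact (hTs _ hx).2.1.le
  have hc : ∀ (d : ℕ) (x : E d), ‖x‖ ^ 2 ∈ T → gc J 1 1 / 2 ≤ rotKernel g x x -
      ∑ j ∈ Finset.range (M + 1), gc j (‖x‖ ^ 2) (‖x‖ ^ 2) * (‖x‖ ^ 2) ^ j := by
    intro d x hx
    rw [rotKernel, real_inner_self_eq_norm_sq]
    exact (hTs _ hx).1.le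
  have hmemT : ∀ {δ s : ℝ}, δ < ε → |s - 1| ≤ δ → s ∈ T := fun h1 h2 => by
    rw [hTdef, Metric.mem_ball, Real.dist_eq]; linarith
  refine ⟨h.posSemidef, ?_, ?_⟩
  · have hex : ∀ k, ∃ (a : ℕ → ℝ → ℝ) (C : ℝ), 0 ≤ C ∧ (k ≤ M → ∀ᶠ δ in 𝓝[>] (0 : ℝ),
        (∀ l t, |t - 1| ≤ δ → |a l t| ≤ C) ∧ ∀ s t, |s - 1| ≤ δ → |t - 1| ≤ δ →
        |gc k s t - ∑ l ∈ Finset.range (M + 1 - k), a l t * (s - 1) ^ l| ≤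
          C * |s - 1| ^ (M + 1 - k)) := by
      intro k
      by_cases hk : k ≤ M
      · obtain ⟨a, C, h0, h1⟩ := exists_taylor_fst _ _ (hsm k hk)
        exact ⟨a, C, h0, fun _ => h1⟩
      · exact ⟨fun _ _ => 0, 0, le_rfl, fun h => absurd h hk⟩
    choose a C hC0 ha using hex
    have hall : ∀ᶠ δ in 𝓝[>] (0 : ℝ), ∀ k ∈ Finset.range (M + 1),
        (∀ l t, |t - 1| ≤ δ → |a k l t| ≤ C k) ∧ ∀ s t, |s - 1| ≤ δ → |t - 1| ≤ δ →
        |gc k s t - ∑ l ∈ Finset.range (M + 1 - k), a k l t * (s - 1) ^ l| ≤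
          C k * |s - 1| ^ (M + 1 - k) :=
      (Filter.eventually_all_finset _).2 fun k hk => ha k (Nat.lt_succ_iff.1 (Finset.mem_range.1 hk))
    have hCs : 0 ≤ ∑ k ∈ Finset.range (M + 1), C k := Finset.sum_nonneg fun k _ => hC0 k
    -- The cutoff `k + l ≤ M` implies `k + 2l ≤ 2M`.
    refine ⟨fun k l t => if k + l ≤ M then a k l t else 0,
      C₀ * 2 ^ (M + 1) + ∑ k ∈ Finset.range (M + 1), C k, by positivity, ?_, ?_⟩
    · intro k l t hne
      by_contra hcon
      exact hne (if_neg (by omega))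
    · filter_upwards [hall, Ioo_mem_nhdsGT (show (0 : ℝ) < 1 / 2 by norm_num),
        Ioo_mem_nhdsGT hε] with δ hδa hδ hδε
      refine ⟨fun k hk l _ t ht => ?_, fun d x x' _ _ hs ht hw => ?_⟩
      · split_ifs
        · have h1 := (hδa k (Finset.mem_range.2 (Nat.lt_succ_of_le hk))).1 l t ht
          have h2 := Finset.single_le_sum (f := C) (fun k _ => hC0 k)
            (Finset.mem_range.2 (Nat.lt_succ_of_le hk))
          have : 0 ≤ C₀ * 2 ^ (M + 1) := by positivity
          linarith
        · rw [abs_zero]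
          positivity
      · have h1 := abs_series_tail_le (M := M) hT hgcT hexpT hC (hmemT hδε.2 hs)
          (hmemT hδε.2 ht) hδ.2.le hw
        set s := ‖x‖ ^ 2
        set t := ‖x'‖ ^ 2
        set w : ℝ := inner ℝ x x'
        have h2 : ∀ k ∈ Finset.range (M + 1), ∑ l ∈ Finset.range (M + 1),
            (if k + l ≤ M then a k l t else 0) * (s - 1) ^ l * w ^ k =
            (∑ l ∈ Finset.range (M + 1 - k), a k l t * (s - 1) ^ l) * w ^ k := by
          intro k _
          rw [Finset.sum_mul]
          symm
          refine Finset.sum_subset_zero_on_sdiff (fun l hl => ?_) (fun l hl => ?_) fun l hl => ?_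
          · rw [Finset.mem_range] at hl ⊢; omega
          · rw [Finset.mem_sdiff, Finset.mem_range, Finset.mem_range] at hl
            rw [if_neg (by omega)]
            ring
          · rw [Finset.mem_range] at hl
            rw [if_pos (by omega)]
        rw [Finset.sum_congr rfl h2]
        have h3 : |∑ k ∈ Finset.range (M + 1), gc k s t * w ^ k - ∑ k ∈ Finset.range (M + 1),
            (∑ l ∈ Finset.range (M + 1 - k), a k l t * (s - 1) ^ l) * w ^ k| ≤
            (∑ k ∈ Finset.range (M + 1), C k) * δ ^ (M + 1) := by
          rw [← Finset.sum_sub_distrib, Finset.sum_mul]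
          refine (Finset.abs_sum_le_sum_abs _ _).trans (Finset.sum_le_sum fun k hk => ?_)
          rw [← sub_mul, abs_mul, abs_pow]
          have h4 := (hδa k hk).2 s t hs ht
          have h5 : k ≤ M + 1 := (Finset.mem_range.1 hk).le
          have := hC0 k
          have hδ0 := hδ.1.le
          calc _ ≤ C k * |s - 1| ^ (M + 1 - k) * |w| ^ k := by gcongr
            _ ≤ C k * δ ^ (M + 1 - k) * δ ^ k := by gcongr
            _ = C k * δ ^ (M + 1) := by rw [mul_assoc, ← pow_add, Nat.sub_add_cancel h5]
        calc _ ≤ _ := abs_sub_le _ (∑ k ∈ Finset.range (M + 1), gc k s t * w ^ k) _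
          _ ≤ C₀ * (2 * δ) ^ (M + 1) + (∑ k ∈ Finset.range (M + 1), C k) * δ ^ (M + 1) :=
            add_le_add h1 h3
          _ = _ := by rw [mul_pow]; ring
  · set D := C₀ * 2 ^ (M + 1) with hD
    have hD0 : 0 < D := by positivity
    set c := gc J 1 1 / 2 with hcdef
    have hc0 : 0 < c := by positivity
    refine ⟨c / 2, c / (2 * D), by positivity, by positivity, ?_⟩
    filter_upwards [Ioo_mem_nhdsGT (show (0 : ℝ) < 1 / 2 by norm_num),
      Ioo_mem_nhdsGT hε] with δ hδ hδε d N x hN hx hw v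
    have h1 := series_coercive (M := M) hT hgcT hexpT hC hC₀0 hc
      (fun i => hmemT hδε.2 (hx i).2) hδ.1.le hδ.2.le hw v
    refine le_trans ?_ h1
    have h2 : N * (C₀ * (2 * δ) ^ (M + 1)) ≤ c / 2 := by
      calc N * (C₀ * (2 * δ) ^ (M + 1)) = (N * δ ^ (M + 1)) * D := by rw [mul_pow]; ring
        _ ≤ c / (2 * D) * D := by gcongr
        _ = c / 2 := by field_simp
    have h3 : 0 ≤ ∑ i, v i ^ 2 := Finset.sum_nonneg fun i _ => sq_nonneg _
    have h4 : c / 2 ≤ c - N * (C₀ * (2 * δ) ^ (M + 1)) := by linarith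
    gcongr

/-! ### The `α`-exponential kernel -/

/-- On the shell `‖x‖² = 1` all terms with `l ≥ 1` vanish, and what remains has degree `k ≤ M`. -/
lemma BarrierKernel.sphere {g : ℝ → ℝ → ℝ → ℝ} {M m : ℕ} (h : BarrierKernel g M m Set.univ) :
    BarrierKernel g M M {1} := by
  refine ⟨h.posSemidef, ?_, ?_⟩
  · obtain ⟨a, C, hC, -, ha⟩ := h.approx
    refine ⟨fun k l t => if l = 0 ∧ k ≤ M then a k 0 t else 0, C, hC, ?_, ?_⟩
    · intro k l t hne
      by_contra hcon
      exact hne (if_neg (by omega))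
    · filter_upwards [ha] with δ hδ
      refine ⟨fun k hk l _ t ht => ?_, fun d x x' hx hx' hs ht hw => ?_⟩
      · split_ifs
        · exact hδ.1 k hk 0 (Nat.zero_le _) t ht
        · simpa using hC
      · convert hδ.2 d x x' (Set.mem_univ _) (Set.mem_univ _) hs ht hw using 5 with k hk l hl
        have hk' := Nat.lt_succ_iff.1 (Finset.mem_range.1 hk)
        rw [Set.mem_singleton_iff.1 hx, sub_self]
        rcases eq_or_ne l 0 with rfl | h
        · simp [hk']
        · simp [h]
  · obtain ⟨c, η, hc, hη, hev⟩ := h.coercive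
    refine ⟨c, η, hc, hη, ?_⟩
    filter_upwards [hev] with δ hδ d N x hN hx
    exact hδ d N x hN fun i => ⟨Set.mem_univ _, (hx i).2⟩

/-! ### Exponentials of positive semi-definite kernels -/

section ExpForm

variable {α : Type*} {A : Set α} {k : α → α → ℝ}

/-- The exponential of a positive semi-definite kernel dominates each term of its series. -/
lemma IsPSDKernelOn.le_exp_sub_one (hk : IsPSDKernelOn A k) {N : ℕ} {x : Fin N → α}
    (hx : ∀ i, x i ∈ A) (v : Fin N → ℝ) {n : ℕ} (hn : n ≠ 0) :
    ∑ i, ∑ j, v i * v j * (k (x i) (x j) ^ n / n.factorial) ≤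
      ∑ i, ∑ j, v i * v j * (Real.exp (k (x i) (x j)) - 1) := by
  have h1 : HasSum (fun m : ℕ => ∑ i, ∑ j, v i * v j * (k (x i) (x j) ^ m / m.factorial))
      (∑ i, ∑ j, v i * v j * Real.exp (k (x i) (x j))) := by
    refine hasSum_sum fun i _ => hasSum_sum fun j _ => HasSum.mul_left _ ?_
    rw [Real.exp_eq_exp_ℝ]
    exact NormedSpace.expSeries_div_hasSum_exp (k (x i) (x j))
  have h2 : ∀ m : ℕ, 0 ≤ ∑ i, ∑ j, v i * v j * (k (x i) (x j) ^ m / m.factorial) := by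
    intro m
    have := ((hk.pow m).mul (isPSDKernelOn_const (A := A)
      (show (0 : ℝ) ≤ (m.factorial : ℝ)⁻¹ by positivity))).sum_nonneg hx v
    simpa only [div_eq_mul_inv] using this
  have h3 := sum_le_hasSum {0, n} (fun m _ => h2 m) h1
  rw [Finset.sum_pair (Ne.symm hn)] at h3
  simp only [mul_sub, Finset.sum_sub_distrib]
  simp only [pow_zero, Nat.factorial_zero, Nat.cast_one, div_one] at h3
  linarith

lemma IsPSDKernelOn.le_exp (hk : IsPSDKernelOn A k) {N : ℕ} {x : Fin N → α}
    (hx : ∀ i, x i ∈ A) (v : Fin N → ℝ) :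
    ∑ i, ∑ j, v i * v j * k (x i) (x j) ≤ ∑ i, ∑ j, v i * v j * Real.exp (k (x i) (x j)) := by
  have h1 := hk.le_exp_sub_one hx v one_ne_zero
  have h2 := (isPSDKernelOn_const (A := A) zero_le_one).sum_nonneg hx v
  simp only [mul_sub, Finset.sum_sub_distrib, pow_one, Nat.factorial_one, Nat.cast_one,
    div_one] at h1
  linarith

end ExpForm

/-! ### Powers `y^γ`, `0 < γ < 1`, as integrals of `1 - e^(-uy)` -/

section Stable

variable {γ : ℝ}

/-- Near `0` the integrand is at most `y u^(-γ)`, integrable as `γ < 1`; beyond `1` it is at most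
`u^(-1-γ)`, integrable as `γ > 0`. -/
lemma integrableOn_one_sub_exp (h0 : 0 < γ) (h1 : γ < 1) {y : ℝ} (hy : 0 ≤ y) :
    IntegrableOn (fun u : ℝ => (1 - Real.exp (-(u * y))) * u ^ (-1 - γ)) (Set.Ioi 0) := by
  have hmeas : Measurable fun u : ℝ => (1 - Real.exp (-(u * y))) * u ^ (-1 - γ) := by fun_prop
  have hle : ∀ u : ℝ, 0 < u → 0 ≤ 1 - Real.exp (-(u * y)) := fun u hu => by
    have : Real.exp (-(u * y)) ≤ 1 := Real.exp_le_one_iff.2 (by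
      have := mul_nonneg hu.le hy
      linarith)
    linarith
  rw [← Set.Ioc_union_Ioi_eq_Ioi (zero_le_one (α := ℝ))]
  refine IntegrableOn.union ?_ ?_
  · have hi : IntegrableOn (fun u : ℝ => y * u ^ (-γ)) (Set.Ioc 0 1) := by
      have := (intervalIntegral.intervalIntegrable_rpow' (a := 0) (b := 1)
        (show -1 < -γ by linarith)).const_mul y
      rwa [intervalIntegrable_iff_integrableOn_Ioc_of_le zero_le_one] at this
    refine Integrable.mono' hi hmeas.aestronglyMeasurable ?_
    refine (ae_restrict_iff' measurableSet_Ioc).2 (ae_of_all _ fun u hu => ?_)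
    rw [Real.norm_eq_abs, abs_of_nonneg (mul_nonneg (hle u hu.1) (Real.rpow_nonneg hu.1.le _))]
    have h2 : u ^ (-γ) = u * u ^ (-1 - γ) := by
      rw [show -γ = 1 + (-1 - γ) by ring, Real.rpow_add hu.1, Real.rpow_one]
    rw [h2, ← mul_assoc]
    refine mul_le_mul_of_nonneg_right ?_ (Real.rpow_nonneg hu.1.le _)
    linarith [Real.add_one_le_exp (-(u * y))]
  · have hi : IntegrableOn (fun u : ℝ => u ^ (-1 - γ)) (Set.Ioi 1) :=
      integrableOn_Ioi_rpow_of_lt (by linarith) zero_lt_one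
    refine Integrable.mono' hi hmeas.aestronglyMeasurable ?_
    refine (ae_restrict_iff' measurableSet_Ioi).2 (ae_of_all _ fun u hu => ?_)
    have hu0 : (0 : ℝ) < u := zero_lt_one.trans hu
    rw [Real.norm_eq_abs, abs_of_nonneg (mul_nonneg (hle u hu0) (Real.rpow_nonneg hu0.le _))]
    refine mul_le_of_le_one_left (Real.rpow_nonneg hu0.le _) ?_
    linarith [Real.exp_pos (-(u * y))]

/-- The normalizing constant `∫ (1 - e⁻ᵘ) u^(-1-γ) du`. -/
def stableConst (γ : ℝ) : ℝ := ∫ u in Set.Ioi (0 : ℝ), (1 - Real.exp (-(u * 1))) * u ^ (-1 - γ)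

lemma stableConst_pos (h0 : 0 < γ) (h1 : γ < 1) : 0 < stableConst γ := by
  have hpos : ∀ u ∈ Set.Ioi (0 : ℝ), 0 < (1 - Real.exp (-(u * 1))) * u ^ (-1 - γ) := by
    intro u hu
    have hu : (0 : ℝ) < u := hu
    refine mul_pos ?_ (Real.rpow_pos_of_pos hu _)
    have : Real.exp (-(u * 1)) < 1 := by
      have := Real.exp_lt_exp.2 (show -(u * 1) < 0 by linarith)
      rwa [Real.exp_zero] at this
    linarith
  rw [stableConst, setIntegral_pos_iff_support_of_nonneg_ae
    ((ae_restrict_iff' measurableSet_Ioi).2 (ae_of_all _ fun u hu => (hpos u hu).le))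
    (integrableOn_one_sub_exp h0 h1 zero_le_one)]
  have : Set.Ioi (0 : ℝ) ⊆ (Function.support fun u : ℝ => (1 - Real.exp (-(u * 1))) *
      u ^ (-1 - γ)) ∩ Set.Ioi 0 := fun u hu => ⟨(hpos u hu).ne', hu⟩
  refine lt_of_lt_of_le ?_ (measure_mono this)
  simp

/-- Substitution `u ↦ y u`. -/
lemma integral_one_sub_exp (h0 : 0 < γ) {y : ℝ} (hy : 0 ≤ y) :
    ∫ u in Set.Ioi (0 : ℝ), (1 - Real.exp (-(u * y))) * u ^ (-1 - γ) = stableConst γ * y ^ γ := by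
  rcases hy.eq_or_lt with rfl | hy
  · simp [Real.zero_rpow h0.ne']
  · have h := integral_comp_mul_left_Ioi
      (fun u : ℝ => (1 - Real.exp (-(u * 1))) * u ^ (-1 - γ)) 0 hy
    rw [mul_zero, smul_eq_mul] at h
    change _ = y⁻¹ * stableConst γ at h
    have h2 : ∀ u ∈ Set.Ioi (0 : ℝ), (1 - Real.exp (-(u * y))) * u ^ (-1 - γ) =
        y ^ (1 + γ) * ((1 - Real.exp (-(y * u * 1))) * (y * u) ^ (-1 - γ)) := by
      intro u hu
      rw [Real.mul_rpow hy.le (le_of_lt hu), show -1 - γ = -(1 + γ) by ring,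
        Real.rpow_neg hy.le, mul_one, mul_comm y u]
      have : y ^ (1 + γ) ≠ 0 := (Real.rpow_pos_of_pos hy _).ne'
      field_simp
    rw [setIntegral_congr_fun measurableSet_Ioi h2, integral_const_mul, h, Real.rpow_add hy,
      Real.rpow_one]
    field_simp

end Stable

/-! ### The energy kernel and the lower bound for the `α`-exponential kernel -/

section Alpha

variable {γ : ℝ} {d : ℕ}

/-- The positive semi-definite kernel `‖x‖^{2γ} + ‖x'‖^{2γ} - ‖x - x'‖^{2γ}`. -/
def energyKernel (γ : ℝ) (x x' : E d) : ℝ :=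
  (‖x‖ ^ 2) ^ γ + (‖x'‖ ^ 2) ^ γ - (‖x - x'‖ ^ 2) ^ γ

/-- The integrand in the representation of `energyKernel`. -/
def energyIntegrand (u : ℝ) (x x' : E d) : ℝ :=
  (1 - Real.exp (-(u * ‖x‖ ^ 2))) + (1 - Real.exp (-(u * ‖x'‖ ^ 2))) -
    (1 - Real.exp (-(u * ‖x - x'‖ ^ 2)))

/-- The Gaussian factor of `x - x'` splits off `e^(2u xᵀx')`. Both resulting summands are visibly
positive semi-definite: a rank-one kernel, and a rescaled exponential of the inner product minus
`1`. -/
lemma energyIntegrand_eq (u : ℝ) (x x' : E d) : energyIntegrand u x x' =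
    (1 - Real.exp (-(u * ‖x‖ ^ 2))) * (1 - Real.exp (-(u * ‖x'‖ ^ 2))) +
    Real.exp (-(u * ‖x‖ ^ 2)) * Real.exp (-(u * ‖x'‖ ^ 2)) *
      (Real.exp (2 * u * inner ℝ x x') - 1) := by
  have h : Real.exp (-(u * ‖x - x'‖ ^ 2)) = Real.exp (-(u * ‖x‖ ^ 2)) *
      Real.exp (-(u * ‖x'‖ ^ 2)) * Real.exp (2 * u * inner ℝ x x') := by
    rw [← Real.exp_add, ← Real.exp_add, norm_sub_sq_real]
    congr 1
    ring
  rw [energyIntegrand, h]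
  ring

/-- Only the `n`-th term of the exponential series is kept; the rank-one square and the other terms
are nonnegative. -/
lemma le_energyIntegrand_form {u : ℝ} (hu : 0 ≤ u) {N : ℕ} (x : Fin N → E d) (a : Fin N → ℝ)
    {n : ℕ} (hn : n ≠ 0) :
    (2 * u) ^ n / n.factorial * ∑ i, ∑ j, (a i * Real.exp (-(u * ‖x i‖ ^ 2))) *
      (a j * Real.exp (-(u * ‖x j‖ ^ 2))) * inner ℝ (x i) (x j) ^ n ≤
    ∑ i, ∑ j, a i * a j * energyIntegrand u (x i) (x j) := by
  set e : Fin N → ℝ := fun i => Real.exp (-(u * ‖x i‖ ^ 2)) with he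
  have hpsd : IsPSDKernelOn (Set.univ : Set (E d)) fun x x' => 2 * u * inner ℝ x x' :=
    (isPSDKernelOn_const (by positivity)).mul (isPSDKernelOn_inner _)
  have h1 := hpsd.le_exp_sub_one (x := x) (fun i => Set.mem_univ _) (fun i => a i * e i) hn
  have h2 : ∑ i, ∑ j, a i * a j * energyIntegrand u (x i) (x j) =
      (∑ i, a i * (1 - e i)) ^ 2 + ∑ i, ∑ j, a i * e i * (a j * e j) *
        (Real.exp (2 * u * inner ℝ (x i) (x j)) - 1) := by
    rw [sq, Finset.sum_mul_sum, ← Finset.sum_add_distrib]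
    refine Finset.sum_congr rfl fun i _ => ?_
    rw [← Finset.sum_add_distrib]
    refine Finset.sum_congr rfl fun j _ => ?_
    rw [energyIntegrand_eq]
    ring
  have h3 : (2 * u) ^ n / n.factorial * ∑ i, ∑ j, (a i * e i) * (a j * e j) *
      inner ℝ (x i) (x j) ^ n = ∑ i, ∑ j, a i * e i * (a j * e j) *
      ((2 * u * inner ℝ (x i) (x j)) ^ n / n.factorial) := by
    simp only [Finset.mul_sum]
    refine Finset.sum_congr rfl fun i _ => Finset.sum_congr rfl fun j _ => ?_
    rw [mul_pow]
    ring
  rw [h2, h3]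
  exact h1.trans (le_add_of_nonneg_left (sq_nonneg _))

lemma energyIntegrand_form_nonneg {u : ℝ} (hu : 0 ≤ u) {N : ℕ} (x : Fin N → E d)
    (a : Fin N → ℝ) : 0 ≤ ∑ i, ∑ j, a i * a j * energyIntegrand u (x i) (x j) := by
  refine le_trans (mul_nonneg (by positivity) ?_) (le_energyIntegrand_form hu x a one_ne_zero)
  simp only [pow_one]
  exact (isPSDKernelOn_inner Set.univ).sum_nonneg (fun i => Set.mem_univ _) _

lemma energyKernel_form_eq (h0 : 0 < γ) (h1 : γ < 1) {N : ℕ} (x : Fin N → E d) (a : Fin N → ℝ) :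
    IntegrableOn (fun u => (∑ i, ∑ j, a i * a j * energyIntegrand u (x i) (x j)) *
      u ^ (-1 - γ)) (Set.Ioi 0) ∧
    stableConst γ * ∑ i, ∑ j, a i * a j * energyKernel γ (x i) (x j) =
      ∫ u in Set.Ioi (0 : ℝ), (∑ i, ∑ j, a i * a j * energyIntegrand u (x i) (x j)) *
        u ^ (-1 - γ) := by
  have hf : ∀ i j, (fun u => a i * a j * (energyIntegrand u (x i) (x j) * u ^ (-1 - γ))) =
      fun u => a i * a j * ((1 - Real.exp (-(u * ‖x i‖ ^ 2))) * u ^ (-1 - γ) +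
        (1 - Real.exp (-(u * ‖x j‖ ^ 2))) * u ^ (-1 - γ) -
        (1 - Real.exp (-(u * ‖x i - x j‖ ^ 2))) * u ^ (-1 - γ)) := by
    intro i j
    funext u
    rw [energyIntegrand]
    ring
  have hint : ∀ i j, IntegrableOn
      (fun u => a i * a j * (energyIntegrand u (x i) (x j) * u ^ (-1 - γ))) (Set.Ioi 0) := by
    intro i j
    rw [hf]
    exact (((integrableOn_one_sub_exp h0 h1 (by positivity)).add
      (integrableOn_one_sub_exp h0 h1 (by positivity))).sub
      (integrableOn_one_sub_exp h0 h1 (by positivity))).const_mul _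
  have hval : ∀ i j, ∫ u in Set.Ioi (0 : ℝ),
      a i * a j * (energyIntegrand u (x i) (x j) * u ^ (-1 - γ)) =
      stableConst γ * (a i * a j * energyKernel γ (x i) (x j)) := by
    intro i j
    have i1 := integrableOn_one_sub_exp h0 h1 (y := ‖x i‖ ^ 2) (by positivity)
    have i2 := integrableOn_one_sub_exp h0 h1 (y := ‖x j‖ ^ 2) (by positivity)
    have i3 := integrableOn_one_sub_exp h0 h1 (y := ‖x i - x j‖ ^ 2) (by positivity)
    have i12 : IntegrableOn (fun u => (1 - Real.exp (-(u * ‖x i‖ ^ 2))) * u ^ (-1 - γ) +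
        (1 - Real.exp (-(u * ‖x j‖ ^ 2))) * u ^ (-1 - γ)) (Set.Ioi 0) := i1.add i2
    rw [hf, integral_const_mul, integral_sub i12 i3, integral_add i1 i2,
      integral_one_sub_exp h0 (by positivity), integral_one_sub_exp h0 (by positivity),
      integral_one_sub_exp h0 (by positivity), energyKernel]
    ring
  have hsum : (fun u : ℝ => (∑ i, ∑ j, a i * a j * energyIntegrand u (x i) (x j)) *
      u ^ (-1 - γ)) = fun u => ∑ i, ∑ j, a i * a j *
        (energyIntegrand u (x i) (x j) * u ^ (-1 - γ)) := by
    funext u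
    rw [Finset.sum_mul]
    refine Finset.sum_congr rfl fun i _ => ?_
    rw [Finset.sum_mul]
    exact Finset.sum_congr rfl fun j _ => by ring
  rw [hsum]
  refine ⟨integrable_finsetSum _ fun i _ => integrable_finsetSum _ fun j _ => hint i j, ?_⟩
  rw [integral_finsetSum _ fun i _ => integrable_finsetSum _ fun j _ => hint i j, Finset.mul_sum]
  refine Finset.sum_congr rfl fun i _ => ?_
  rw [integral_finsetSum _ fun j _ => hint i j, Finset.mul_sum]
  exact Finset.sum_congr rfl fun j _ => (hval i j).symm

lemma isPSDKernelOn_energyKernel (h0 : 0 < γ) (h1 : γ < 1) :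
    IsPSDKernelOn (Set.univ : Set (E d)) (energyKernel γ) := by
  refine isPSDKernelOn_of_sum_nonneg (fun x _ y _ => ?_) fun N x _ a => ?_
  · rw [energyKernel, energyKernel, norm_sub_rev]; ring
  · refine nonneg_of_mul_nonneg_right ?_ (stableConst_pos h0 h1)
    rw [(energyKernel_form_eq h0 h1 x a).2]
    refine setIntegral_nonneg measurableSet_Ioi fun u hu => ?_
    exact mul_nonneg (energyIntegrand_form_nonneg (le_of_lt hu) x a)
      (Real.rpow_nonneg (le_of_lt hu) _)

/-- In the integral representation only `u` in `(1, 2]` is kept, and for these `u` only the power `M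
+ 1` of the inner product. Its matrix has diagonal at least `(1/2)^(M+1)` and off-diagonal entries
at most `δ^(M+1)`, which by the assumption on `N` leaves `(1/2)^(M+2)`. The factor `e^(-8)` bounds
`e^(-2u‖x‖²)` below for `u, ‖x‖² ≤ 2`, and `1/4` bounds `u^(-1-γ)`. -/
lemma energyKernel_form_ge (h0 : 0 < γ) (h1 : γ < 1) (M : ℕ) {N : ℕ} {x : Fin N → E d} {δ : ℝ}
    (hδ : δ ≤ 1 / 2) (hN : N * δ ^ (M + 1) ≤ (1 / 2) ^ (M + 2))
    (hx : ∀ i, |‖x i‖ ^ 2 - 1| ≤ δ) (hw : ∀ i j, i ≠ j → |inner ℝ (x i) (x j)| ≤ δ)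
    (hδ0 : 0 ≤ δ) (a : Fin N → ℝ) :
    (1 / 2) ^ (M + 2) * Real.exp (-8) / (M + 1).factorial / 4 * ∑ i, a i ^ 2 ≤
      stableConst γ * ∑ i, ∑ j, a i * a j * energyKernel γ (x i) (x j) := by
  obtain ⟨hint, heq⟩ := energyKernel_form_eq h0 h1 x a
  rw [heq]
  have ha0 : 0 ≤ ∑ i, a i ^ 2 := Finset.sum_nonneg fun i _ => sq_nonneg _
  set κ : ℝ := (1 / 2) ^ (M + 2) * Real.exp (-8) / (M + 1).factorial with hκ
  have hκ0 : 0 ≤ κ := by positivity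
  have hlow : ∀ u ∈ Set.Ioc (1 : ℝ) 2, κ / 4 * ∑ i, a i ^ 2 ≤
      (∑ i, ∑ j, a i * a j * energyIntegrand u (x i) (x j)) * u ^ (-1 - γ) := by
    intro u hu
    have hu0 : 0 < u := zero_lt_one.trans hu.1
    have hr : (1 / 4 : ℝ) ≤ u ^ (-1 - γ) := by
      calc (1 / 4 : ℝ) ≤ u ^ (-2 : ℝ) := by
            rw [Real.rpow_neg hu0.le, one_div, Real.rpow_two]
            apply inv_anti₀ (by positivity)
            nlinarith [hu.2]
        _ ≤ u ^ (-1 - γ) := Real.rpow_le_rpow_of_exponent_le hu.1.le (by linarith)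
    have hform := le_energyIntegrand_form hu0.le x a (Nat.succ_ne_zero M)
    set b : Fin N → ℝ := fun i => a i * Real.exp (-(u * ‖x i‖ ^ 2)) with hb
    have hg := le_form_of_diag_offDiag (K := fun i j => inner ℝ (x i) (x j) ^ (M + 1))
      (D := (1 / 2) ^ (M + 1)) (e := δ ^ (M + 1)) (by positivity)
      (fun i => by
        rw [real_inner_self_eq_norm_sq]
        have := (abs_le.1 (hx i)).1
        exact pow_le_pow_left₀ (by norm_num) (by linarith) _)
      (fun i j hij => by
        rw [abs_pow]
        exact pow_le_pow_left₀ (abs_nonneg _) (hw i j hij) _) b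
    have hbs : Real.exp (-8) * ∑ i, a i ^ 2 ≤ ∑ i, b i ^ 2 := by
      rw [Finset.mul_sum]
      refine Finset.sum_le_sum fun i _ => ?_
      rw [hb]
      simp only
      rw [mul_pow, mul_comm, ← Real.exp_nat_mul]
      refine mul_le_mul_of_nonneg_left (Real.exp_le_exp.2 ?_) (sq_nonneg _)
      have h2 := (abs_le.1 (hx i)).2
      have h3 : ‖x i‖ ^ 2 ≤ 2 := by linarith
      have h4 : 0 ≤ ‖x i‖ ^ 2 := by positivity
      push_cast
      nlinarith [hu.2, hu0]
    have hb0 : 0 ≤ ∑ i, b i ^ 2 := Finset.sum_nonneg fun i _ => sq_nonneg _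
    have hD : (1 / 2 : ℝ) ^ (M + 2) ≤ (1 / 2) ^ (M + 1) - N * δ ^ (M + 1) := by
      have : (1 / 2 : ℝ) ^ (M + 1) = (1 / 2) ^ (M + 2) + (1 / 2) ^ (M + 2) := by
        rw [pow_succ _ (M + 1)]; ring
      linarith
    have h2u : 1 / ((M + 1).factorial : ℝ) ≤ (2 * u) ^ (M + 1) / (M + 1).factorial := by
      have : (1 : ℝ) ≤ (2 * u) ^ (M + 1) := one_le_pow₀ (by linarith [hu.1])
      gcongr
    have hq : κ * ∑ i, a i ^ 2 ≤ ∑ i, ∑ j, a i * a j * energyIntegrand u (x i) (x j) := by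
      refine le_trans ?_ hform
      calc κ * ∑ i, a i ^ 2 = 1 / ((M + 1).factorial : ℝ) * ((1 / 2) ^ (M + 2) *
            (Real.exp (-8) * ∑ i, a i ^ 2)) := by rw [hκ]; ring
        _ ≤ (2 * u) ^ (M + 1) / (M + 1).factorial * ((1 / 2) ^ (M + 2) * ∑ i, b i ^ 2) := by
          gcongr
        _ ≤ (2 * u) ^ (M + 1) / (M + 1).factorial *
            (((1 / 2) ^ (M + 1) - N * δ ^ (M + 1)) * ∑ i, b i ^ 2) := by gcongr
        _ ≤ _ := by gcongr
    calc κ / 4 * ∑ i, a i ^ 2 = (κ * ∑ i, a i ^ 2) * (1 / 4) := by ring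
      _ ≤ _ := by
        refine mul_le_mul hq hr (by norm_num) ?_
        exact energyIntegrand_form_nonneg hu0.le x a
  have hsub : Set.Ioc (1 : ℝ) 2 ⊆ Set.Ioi 0 := fun u hu => zero_lt_one.trans hu.1
  calc κ / 4 * ∑ i, a i ^ 2 = ∫ _ in Set.Ioc (1 : ℝ) 2, κ / 4 * ∑ i, a i ^ 2 := by
        rw [setIntegral_const]; norm_num
    _ ≤ ∫ u in Set.Ioc (1 : ℝ) 2, (∑ i, ∑ j, a i * a j * energyIntegrand u (x i) (x j)) *
        u ^ (-1 - γ) := by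
        refine setIntegral_mono_on (integrableOn_const (by simp) enorm_ne_top) (hint.mono_set hsub) measurableSet_Ioc hlow
    _ ≤ _ := by
        refine setIntegral_mono_set hint ?_ (Eventually.of_forall hsub)
        refine (ae_restrict_iff' measurableSet_Ioi).2 (ae_of_all _ fun u hu => ?_)
        exact mul_nonneg (energyIntegrand_form_nonneg (le_of_lt hu) x a)
          (Real.rpow_nonneg (le_of_lt hu) _)

lemma exp_neg_eq_energyKernel (x x' : E d) : Real.exp (-(‖x - x'‖ ^ 2) ^ γ) =
    Real.exp (-(‖x‖ ^ 2) ^ γ) * Real.exp (-(‖x'‖ ^ 2) ^ γ) * Real.exp (energyKernel γ x x') := by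
  rw [← Real.exp_add, ← Real.exp_add, energyKernel]
  congr 1
  ring

/-- Up to the factors `e^(-‖x‖^(2γ))`, absorbed into the vector, the kernel is the exponential of
the energy kernel and dominates the linear term of its series. -/
lemma energyKernel_form_le_exp (h0 : 0 < γ) (h1 : γ < 1) {N : ℕ} (x : Fin N → E d)
    (v : Fin N → ℝ) :
    ∑ i, ∑ j, (v i * Real.exp (-(‖x i‖ ^ 2) ^ γ)) * (v j * Real.exp (-(‖x j‖ ^ 2) ^ γ)) *
      energyKernel γ (x i) (x j) ≤ ∑ i, ∑ j, v i * v j * Real.exp (-(‖x i - x j‖ ^ 2) ^ γ) := by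
  refine ((isPSDKernelOn_energyKernel h0 h1).le_exp (x := x) (fun i => Set.mem_univ _) _).trans
    (le_of_eq ?_)
  refine Finset.sum_congr rfl fun i _ => Finset.sum_congr rfl fun j _ => ?_
  rw [exp_neg_eq_energyKernel]
  ring

/-- Binomial expansion, regrouped along the diagonals `k + l = m`. -/
lemma sum_mul_add_pow_eq (b : ℕ → ℝ) (M : ℕ) (y z : ℝ) :
    ∑ l ∈ Finset.range (M + 1), b l * (y - 2 * z) ^ l =
      ∑ k ∈ Finset.range (M + 1), ∑ l ∈ Finset.range (M + 1),
        (if k + l ≤ M then b (k + l) * ((k + l).choose k) * (-2) ^ k else 0) * y ^ l * z ^ k := by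
  have h := Finset.sum_range_diag_flip (M + 1)
    (fun k l => b (k + l) * ((k + l).choose k) * (-2) ^ k * y ^ l * z ^ k)
  have h1 : ∀ m ∈ Finset.range (M + 1), b m * (y - 2 * z) ^ m = ∑ k ∈ Finset.range (m + 1),
      b (k + (m - k)) * ((k + (m - k)).choose k) * (-2) ^ k * y ^ (m - k) * z ^ k := by
    intro m _
    rw [show y - 2 * z = -2 * z + y by ring, add_pow, Finset.mul_sum]
    refine Finset.sum_congr rfl fun k hk => ?_
    rw [Nat.add_sub_cancel' (Nat.lt_succ_iff.1 (Finset.mem_range.1 hk)), mul_pow]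
    ring
  rw [Finset.sum_congr rfl h1, h]
  refine Finset.sum_congr rfl fun k _ => ?_
  refine Finset.sum_subset_zero_on_sdiff (fun l hl => ?_) (fun l hl => ?_) fun l hl => ?_
  · rw [Finset.mem_range] at hl ⊢; omega
  · rw [Finset.mem_sdiff, Finset.mem_range, Finset.mem_range] at hl
    rw [if_neg (by omega)]
    ring
  · rw [Finset.mem_range] at hl
    rw [if_pos (by omega)]

/-- The kernel is a smooth function of `‖x - x'‖²` near the value `2`, which is `(‖x‖² - 2xᵀx') +
‖x'‖²`. A single Taylor expansion in the bracket therefore gives the polynomial, and the energy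
kernel gives coercivity. -/
theorem IsAlphaExponential.barrierKernel {g : ℝ → ℝ → ℝ → ℝ} {α : ℝ}
    (h : IsAlphaExponential g α) (hα0 : 0 < α) (hα2 : α < 2) (M : ℕ) :
    BarrierKernel g M (2 * M) Set.univ := by
  set γ := α / 2 with hγ
  have h0 : 0 < γ := by positivity
  have h1 : γ < 1 := by rw [hγ]; linarith
  have hg : ∀ (d : ℕ) (x x' : E d), rotKernel g x x' = Real.exp (-(‖x - x'‖ ^ 2) ^ γ) := by
    intro d x x'
    rw [h d x x', ← Real.rpow_natCast, ← Real.rpow_mul (norm_nonneg _), hγ]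
    congr 3
    push_cast
    ring
  refine ⟨fun d => ?_, ?_, ?_⟩
  · refine isPSDKernelOn_of_sum_nonneg (fun x _ y _ => ?_) fun N x _ v => ?_
    · rw [hg, hg, norm_sub_rev]
    · simp only [hg]
      exact ((isPSDKernelOn_energyKernel h0 h1).sum_nonneg (fun i => Set.mem_univ _) _).trans
        (energyKernel_form_le_exp h0 h1 x v)
  · have hf : ContDiffAt ℝ (M + 1 : ℕ) (fun p : ℝ × ℝ => Real.exp (-(p.1 + p.2) ^ γ)) (1, 1) :=
      (((contDiffAt_fst.add contDiffAt_snd).rpow_const_of_ne (by norm_num)).neg).exp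
    obtain ⟨b, C, hC, hb⟩ := exists_taylor_fst (M + 1) _ hf
    -- The bracket `‖x‖² - 2xᵀx'` deviates from `1` by up to `3δ`.
    have h3 : Tendsto (fun δ : ℝ => 3 * δ) (𝓝[>] 0) (𝓝[>] 0) := by
      refine tendsto_nhdsWithin_iff.2 ⟨?_, ?_⟩
      · have : Tendsto (fun δ : ℝ => 3 * δ) (𝓝 0) (𝓝 (3 * 0)) := by
          exact (continuous_const.mul continuous_id).tendsto 0
        rw [mul_zero] at this
        exact this.mono_left nhdsWithin_le_nhds
      · filter_upwards [self_mem_nhdsWithin] with δ hδ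
        have : (0 : ℝ) < δ := hδ
        exact mul_pos (by norm_num) this
    set D := C * (∑ k ∈ Finset.range (M + 1), ∑ l ∈ Finset.range (M + 1),
      ((k + l).choose k : ℝ) * 2 ^ k) with hD
    have hD0 : 0 ≤ D := mul_nonneg hC (Finset.sum_nonneg fun k _ => Finset.sum_nonneg fun l _ =>
      by positivity)
    refine ⟨fun k l t => if k + l ≤ M then b (k + l) t * ((k + l).choose k) * (-2) ^ k else 0,
      D + C * 3 ^ (M + 1), by positivity, ?_, ?_⟩
    · intro k l t hne
      by_contra hcon
      exact hne (if_neg (by omega))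
    · filter_upwards [h3.eventually hb, self_mem_nhdsWithin] with δ hδ hpos
      have hδ0 : (0 : ℝ) < δ := hpos
      refine ⟨fun k hk l hl t ht => ?_, fun d x x' _ _ hs ht hw => ?_⟩
      · have hC3 : 0 ≤ C * 3 ^ (M + 1) := by positivity
        split_ifs
        · rw [abs_mul, abs_mul, abs_pow, abs_neg, abs_two, Nat.abs_cast, mul_assoc]
          have h4 := hδ.1 (k + l) t (ht.trans (by linarith))
          have h5 : ((k + l).choose k : ℝ) * 2 ^ k ≤ ∑ k ∈ Finset.range (M + 1),
              ∑ l ∈ Finset.range (M + 1), ((k + l).choose k : ℝ) * 2 ^ k := by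
            have h6 := Finset.single_le_sum
              (f := fun k => ∑ l ∈ Finset.range (M + 1), ((k + l).choose k : ℝ) * 2 ^ k)
              (fun k _ => Finset.sum_nonneg fun l _ => by positivity)
              (Finset.mem_range.2 (Nat.lt_succ_of_le hk))
            have h7 := Finset.single_le_sum
              (f := fun l => ((k + l).choose k : ℝ) * 2 ^ k) (fun l _ => by positivity)
              (Finset.mem_range.2 (Nat.lt_succ_of_le hl))
            exact h7.trans h6
          have h8 : |b (k + l) t| * (((k + l).choose k : ℝ) * 2 ^ k) ≤ D := by
            rw [hD]; gcongr
          linarith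
        · rw [abs_zero]; positivity
      · have hy : ‖x - x'‖ ^ 2 = (‖x‖ ^ 2 - 2 * inner ℝ x x') + ‖x'‖ ^ 2 := by
          rw [norm_sub_sq_real]
        have hs' : |‖x‖ ^ 2 - 2 * inner ℝ x x' - 1| ≤ 3 * δ := by
          rw [abs_le] at hs hw ⊢
          constructor <;> linarith [hs.1, hs.2, hw.1, hw.2]
        have h4 := hδ.2 _ _ hs' (ht.trans (by linarith))
        rw [← sum_mul_add_pow_eq (fun l => b l (‖x'‖ ^ 2)), hg, hy]
        have e : ‖x‖ ^ 2 - 2 * inner ℝ x x' - 1 = ‖x‖ ^ 2 - 1 - 2 * inner ℝ x x' := by ring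
        rw [e] at h4 hs'
        refine h4.trans ?_
        calc C * |‖x‖ ^ 2 - 1 - 2 * inner ℝ x x'| ^ (M + 1) ≤ C * (3 * δ) ^ (M + 1) := by gcongr
          _ = C * 3 ^ (M + 1) * δ ^ (M + 1) := by rw [mul_pow]; ring
          _ ≤ _ := by gcongr; linarith
  · have hst := stableConst_pos h0 h1
    set κ : ℝ := (1 / 2) ^ (M + 2) * Real.exp (-8) / (M + 1).factorial / 4 with hκ
    -- `e^(-4)` is the loss from the squared factors `e^(-‖x‖^(2γ))`, since `‖x‖^(2γ) ≤ 2`.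
    refine ⟨κ / stableConst γ * Real.exp (-4), (1 / 2) ^ (M + 2), by positivity, by positivity, ?_⟩
    filter_upwards [Ioo_mem_nhdsGT (show (0 : ℝ) < 1 / 2 by norm_num)] with δ hδ d N x hN hx hw v
    simp only [hg]
    refine le_trans ?_ (energyKernel_form_le_exp h0 h1 x v)
    set b : Fin N → ℝ := fun i => v i * Real.exp (-(‖x i‖ ^ 2) ^ γ) with hb
    have h2 := energyKernel_form_ge h0 h1 M hδ.2.le hN (fun i => (hx i).2) hw hδ.1.le b
    have hbs : Real.exp (-4) * ∑ i, v i ^ 2 ≤ ∑ i, b i ^ 2 := by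
      rw [Finset.mul_sum]
      refine Finset.sum_le_sum fun i _ => ?_
      rw [hb]
      simp only
      rw [mul_pow, mul_comm, ← Real.exp_nat_mul]
      refine mul_le_mul_of_nonneg_left (Real.exp_le_exp.2 ?_) (sq_nonneg _)
      have h3 := (abs_le.1 (hx i).2).2
      have h4 : ‖x i‖ ^ 2 ≤ 2 := by linarith [hδ.2]
      have h5 : (‖x i‖ ^ 2) ^ γ ≤ 2 := by
        calc (‖x i‖ ^ 2) ^ γ ≤ 2 ^ γ := Real.rpow_le_rpow (by positivity) h4 h0.le
          _ ≤ 2 ^ (1 : ℝ) := Real.rpow_le_rpow_of_exponent_le (by norm_num) h1.le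
          _ = 2 := Real.rpow_one 2
      push_cast
      linarith
    rw [← hκ] at h2
    have h6 : κ / stableConst γ * ∑ i, b i ^ 2 ≤
        ∑ i, ∑ j, b i * b j * energyKernel γ (x i) (x j) := by
      rw [div_mul_eq_mul_div, div_le_iff₀ hst, mul_comm _ (stableConst γ)]
      exact h2
    refine le_trans ?_ h6
    rw [mul_assoc]
    gcongr

end Alpha

/-- Every admissible kernel satisfies the assumptions of the polynomial barrier. -/
theorem DataModel.AdmissibleKernel.barrierKernel {model : DataModel} {β : ℝ}
    {g : ℝ → ℝ → ℝ → ℝ} (h : model.AdmissibleKernel β g) :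
    BarrierKernel g ⌊2 / β⌋₊ (model.degree β) model.shells := by
  cases model with
  | covariance =>
    rcases h with ⟨gc, h⟩ | ⟨α, h0, h2, h⟩
    · exact h.barrierKernel
    · exact h.barrierKernel h0 h2 _
  | sphere =>
    rcases h with ⟨a, h⟩ | ⟨α, h0, h2, h⟩
    · exact h.barrierKernel
    · exact (h.barrierKernel h0 h2 _).sphere

/-! ### The averaged estimate for typical inputs -/

section Deterministic

lemma norm_sq_inv_sqrt_smul {r : ℝ} (hr : 0 < r) {d : ℕ} (z : E d) :
    ‖(√r)⁻¹ • z‖ ^ 2 = ‖z‖ ^ 2 / r := by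
  rw [norm_smul, mul_pow, norm_inv, inv_pow, Real.norm_of_nonneg (Real.sqrt_nonneg r),
    Real.sq_sqrt hr.le, inv_mul_eq_div]

lemma inner_inv_sqrt_smul {r : ℝ} (hr : 0 < r) {d : ℕ} (z z' : E d) :
    inner ℝ ((√r)⁻¹ • z) ((√r)⁻¹ • z') = inner ℝ z z' / r := by
  rw [real_inner_smul_left, real_inner_smul_right, ← mul_assoc, ← mul_inv,
    Real.mul_self_sqrt hr.le, inv_mul_eq_div]

lemma scaledKernel_eq_rotKernel (g : ℝ → ℝ → ℝ → ℝ) {r : ℝ} (hr : 0 < r) {d : ℕ} (x x' : E d) :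
    scaledKernel g r x x' = rotKernel g ((√r)⁻¹ • x) ((√r)⁻¹ • x') := by
  rw [rotKernel, norm_sq_inv_sqrt_smul hr, norm_sq_inv_sqrt_smul hr, inner_inv_sqrt_smul hr,
    scaledKernel]

/-- The rescaled points lie close to the unit sphere and are almost orthogonal. -/
structure IsTypical (T : Set ℝ) (r δ : ℝ) {d n : ℕ} (xs : Fin n → E d) : Prop where
  shell : ∀ i, ‖xs i‖ ^ 2 / r ∈ T ∧ |‖xs i‖ ^ 2 / r - 1| ≤ δ
  orthogonal : ∀ i j, i ≠ j → |inner ℝ (xs i) (xs j) / r| ≤ δ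

/-- The polynomial `(‖x‖²/r - 1)^l (⟨x, y⟩/r)^k` in `x`. -/
def shellMonomial (r : ℝ) {d : ℕ} (y : E d) (k l : ℕ) : MvPolynomial (Fin d) ℝ :=
  (MvPolynomial.C r⁻¹ * ∑ i, MvPolynomial.X i ^ 2 - MvPolynomial.C 1) ^ l *
    (∑ i, MvPolynomial.C (y i / r) * MvPolynomial.X i) ^ k

lemma eval_shellMonomial (r : ℝ) {d : ℕ} (x y : E d) (k l : ℕ) :
    MvPolynomial.eval (fun i => x i) (shellMonomial r y k l) =
      (‖x‖ ^ 2 / r - 1) ^ l * (inner ℝ x y / r) ^ k := by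
  simp only [shellMonomial, map_mul, map_pow, map_sub, map_sum, MvPolynomial.eval_C,
    MvPolynomial.eval_X]
  rw [EuclideanSpace.real_norm_sq_eq, PiLp.inner_apply, div_eq_inv_mul]
  congr 3
  · rw [Finset.sum_div]
    refine Finset.sum_congr rfl fun i _ => ?_
    simp only [Real.inner_apply]
    ring

lemma totalDegree_shellMonomial_le (r : ℝ) {d : ℕ} (y : E d) (k l : ℕ) :
    (shellMonomial r y k l).totalDegree ≤ k + 2 * l := by
  refine (MvPolynomial.totalDegree_mul _ _).trans ?_
  have h1 : (MvPolynomial.C r⁻¹ * ∑ i : Fin d, MvPolynomial.X i ^ 2 -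
      MvPolynomial.C 1 : MvPolynomial (Fin d) ℝ).totalDegree ≤ 2 := by
    refine (MvPolynomial.totalDegree_sub _ _).trans (max_le ?_ (by simp))
    refine (MvPolynomial.totalDegree_mul _ _).trans ?_
    rw [MvPolynomial.totalDegree_C, zero_add]
    refine MvPolynomial.totalDegree_finsetSum_le fun i _ => ?_
    simp
  have h2 : (∑ i, MvPolynomial.C (y i / r) * MvPolynomial.X i :
      MvPolynomial (Fin d) ℝ).totalDegree ≤ 1 := by
    refine MvPolynomial.totalDegree_finsetSum_le fun i _ => ?_
    refine (MvPolynomial.totalDegree_mul _ _).trans ?_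
    simp
  have h3 := (MvPolynomial.totalDegree_pow (MvPolynomial.C r⁻¹ * ∑ i : Fin d, MvPolynomial.X i ^ 2 -
      MvPolynomial.C 1 : MvPolynomial (Fin d) ℝ) l).trans (Nat.mul_le_mul_left l h1)
  have h4 := (MvPolynomial.totalDegree_pow (∑ i, MvPolynomial.C (y i / r) * MvPolynomial.X i :
      MvPolynomial (Fin d) ℝ) k).trans (Nat.mul_le_mul_left k h2)
  omega

/-- A crude bound valid at every `x`, typical or not; on the atypical set it reduces everything to
moments of `‖x‖²/r`. -/
lemma abs_shellMonomial_le {r : ℝ} (hr : 0 < r) {d : ℕ} (x y : E d) (hy : ‖y‖ ^ 2 / r ≤ 2)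
    {M k l : ℕ} (hk : k ≤ M) (hl : l ≤ M) :
    |(‖x‖ ^ 2 / r - 1) ^ l * (inner ℝ x y / r) ^ k| ≤ (1 + ‖x‖ ^ 2 / r) ^ (2 * M) := by
  have hs : 0 ≤ ‖x‖ ^ 2 / r := by positivity
  have h1 : |‖x‖ ^ 2 / r - 1| ≤ 1 + ‖x‖ ^ 2 / r := by
    rw [abs_le]
    constructor <;> linarith
  have h2 : |inner ℝ x y / r| ≤ 1 + ‖x‖ ^ 2 / r := by
    rw [abs_div, abs_of_pos hr, div_le_iff₀ hr]
    have h3 := abs_real_inner_le_norm x y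
    rw [div_le_iff₀ hr] at hy
    have h4 : (1 + ‖x‖ ^ 2 / r) * r = r + ‖x‖ ^ 2 := by field_simp
    rw [h4]
    nlinarith [sq_nonneg (‖x‖ - ‖y‖)]
  rw [abs_mul, abs_pow, abs_pow]
  calc |‖x‖ ^ 2 / r - 1| ^ l * |inner ℝ x y / r| ^ k
      ≤ (1 + ‖x‖ ^ 2 / r) ^ l * (1 + ‖x‖ ^ 2 / r) ^ k := by gcongr
    _ = (1 + ‖x‖ ^ 2 / r) ^ (l + k) := by rw [pow_add]
    _ ≤ _ := pow_le_pow_right₀ (by linarith) (by omega)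

/-- For typical inputs the averaged estimate is, at typical points, close to a polynomial. -/
lemma BarrierKernel.exists_polynomial {g : ℝ → ℝ → ℝ → ℝ} {M m : ℕ} {T : Set ℝ}
    (hg : BarrierKernel g M m T) : ∃ K η : ℝ, 0 ≤ K ∧ 0 < η ∧ ∀ᶠ δ in 𝓝[>] 0,
    ∀ (d n : ℕ) (r : ℝ) (_ : 0 < r) (xs : Fin n → E d) (_ : IsTypical T r δ xs)
      (_ : n * δ ^ (M + 1) ≤ η) (lam : ℝ) (_ : 0 ≤ lam) (κ : Kernel (E d) ℝ) (_ : IsMarkovKernel κ)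
      (_ : ∀ i, Integrable (fun y : ℝ => y) (κ (xs i))) (A : ℝ) (_ : 0 ≤ A)
      (_ : ∀ i, |groundTruth κ (xs i)| ≤ A),
      ∃ p : MvPolynomial (Fin d) ℝ, p.totalDegree ≤ m ∧
        (∀ x : E d, |MvPolynomial.eval (fun i => x i) p| ≤ K * A * n * (1 + ‖x‖ ^ 2 / r) ^ (2 * M)) ∧
        (∀ x : E d, ‖x‖ ^ 2 / r ∈ T ∧ |‖x‖ ^ 2 / r - 1| ≤ δ → (∀ i, |inner ℝ x (xs i) / r| ≤ δ) →
          |averagedEstimate (scaledKernel g r) lam κ xs x - MvPolynomial.eval (fun i => x i) p| ≤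
            K * A * (n * δ ^ (M + 1))) ∧
        ∃ α : Fin n → ℝ, ∑ i, |α i| ≤ K * A * n ∧
          ∀ x, averagedEstimate (scaledKernel g r) lam κ xs x =
            ∑ i, α i * scaledKernel g r x (xs i) := by
  obtain ⟨a, C, hC, hdeg, happ⟩ := hg.approx
  obtain ⟨c, η, hc, hη, hcoer⟩ := hg.coercive
  -- One constant for three bounds: `(M + 1)² C` for the size of the polynomial, `C` for the
  -- approximation error and `1` for `∑ |αᵢ|`.
  set K : ℝ := c⁻¹ * ((M + 1) ^ 2 * C + C + 1) with hK
  have hM1 : (0 : ℝ) ≤ (M + 1 : ℝ) ^ 2 * C := by positivity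
  refine ⟨K, η, by positivity, hη, ?_⟩
  filter_upwards [happ, hcoer, Ioo_mem_nhdsGT one_pos] with δ ⟨haC, happ⟩ hcoer ⟨hδ0, hδ1⟩
  intro d n r hr xs hxs hn lam hlam κ _ hint A hA hfA
  have hnorm := norm_sq_inv_sqrt_smul hr (d := d)
  have hinner := inner_inv_sqrt_smul hr (d := d)
  have hpsd : IsPSDKernelOn Set.univ (scaledKernel g r (d := d)) := by
    have h := (hg.posSemidef d).comp fun x : E d => (√r)⁻¹ • x
    simpa only [← scaledKernel_eq_rotKernel g hr, Set.preimage_univ] using h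
  obtain ⟨α, hα, hα2⟩ := exists_averagedEstimate_eq hpsd hlam κ hint hc (fun v => by
    simp only [scaledKernel_eq_rotKernel g hr]
    refine hcoer d n _ hn (fun i => ?_) (fun i j hij => ?_) v
    · rw [hnorm]; exact hxs.shell i
    · rw [hinner]; exact hxs.orthogonal i j hij)
  -- `‖α‖₁ ≤ √n ‖α‖₂`, and `c ‖α‖₂ ≤ √n A`.
  have hα1 : ∑ i, |α i| ≤ c⁻¹ * (A * n) := by
    rw [inv_mul_eq_div, le_div_iff₀ hc]
    refine abs_le_of_sq_le_sq' ?_ (by positivity) |>.2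
    have h1 : (∑ i, |α i|) ^ 2 ≤ n * ∑ i, α i ^ 2 := by
      simpa using sq_sum_le_card_mul_sum_sq (s := Finset.univ) (f := fun i => |α i|)
    have h2 : ∑ i, groundTruth κ (xs i) ^ 2 ≤ n * A ^ 2 := by
      calc ∑ i, groundTruth κ (xs i) ^ 2 ≤ ∑ _i : Fin n, A ^ 2 :=
            Finset.sum_le_sum fun i _ => sq_le_sq' (by linarith [abs_le.1 (hfA i)])
              (abs_le.1 (hfA i)).2
        _ = n * A ^ 2 := by simp
    calc ((∑ i, |α i|) * c) ^ 2 = (∑ i, |α i|) ^ 2 * c ^ 2 := by ring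
      _ ≤ (n * ∑ i, α i ^ 2) * c ^ 2 := by gcongr
      _ = n * (c ^ 2 * ∑ i, α i ^ 2) := by ring
      _ ≤ n * (n * A ^ 2) := mul_le_mul_of_nonneg_left (hα2.trans h2) n.cast_nonneg
      _ = (A * n) ^ 2 := by ring
  set p : MvPolynomial (Fin d) ℝ := ∑ i, MvPolynomial.C (α i) *
    ∑ k ∈ Finset.range (M + 1), ∑ l ∈ Finset.range (M + 1),
      MvPolynomial.C (a k l (‖xs i‖ ^ 2 / r)) * shellMonomial r (xs i) k l with hp
  have heval (x : E d) : MvPolynomial.eval (fun i => x i) p = ∑ i, α i *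
      ∑ k ∈ Finset.range (M + 1), ∑ l ∈ Finset.range (M + 1),
        a k l (‖xs i‖ ^ 2 / r) * ((‖x‖ ^ 2 / r - 1) ^ l * (inner ℝ x (xs i) / r) ^ k) := by
    simp only [hp, map_sum, map_mul, MvPolynomial.eval_C, eval_shellMonomial]
  have hAn : 0 ≤ A * n := by positivity
  refine ⟨p, ?_, fun x => ?_, fun x hx hxi => ?_, α, ?_, hα⟩
  · refine MvPolynomial.totalDegree_finsetSum_le fun i _ => ?_
    refine (MvPolynomial.totalDegree_mul _ _).trans ?_
    rw [MvPolynomial.totalDegree_C, zero_add]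
    refine MvPolynomial.totalDegree_finsetSum_le fun k _ => ?_
    refine MvPolynomial.totalDegree_finsetSum_le fun l _ => ?_
    by_cases h : a k l (‖xs i‖ ^ 2 / r) = 0
    · simp [h]
    · refine (MvPolynomial.totalDegree_mul _ _).trans ?_
      rw [MvPolynomial.totalDegree_C, zero_add]
      exact (totalDegree_shellMonomial_le _ _ _ _).trans (hdeg _ _ _ h)
  · rw [heval]
    set Y := (1 + ‖x‖ ^ 2 / r) ^ (2 * M) with hY
    have hY0 : 0 ≤ Y := by positivity
    have h1 (i : Fin n) : |∑ k ∈ Finset.range (M + 1), ∑ l ∈ Finset.range (M + 1),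
        a k l (‖xs i‖ ^ 2 / r) * ((‖x‖ ^ 2 / r - 1) ^ l * (inner ℝ x (xs i) / r) ^ k)| ≤
        (M + 1) ^ 2 * C * Y := by
      calc _ ≤ ∑ k ∈ Finset.range (M + 1), ∑ l ∈ Finset.range (M + 1), C * Y := by
            refine (Finset.abs_sum_le_sum_abs _ _).trans (Finset.sum_le_sum fun k hk => ?_)
            refine (Finset.abs_sum_le_sum_abs _ _).trans (Finset.sum_le_sum fun l hl => ?_)
            rw [abs_mul]
            have hk' := Finset.mem_range_succ_iff.1 hk
            have hl' := Finset.mem_range_succ_iff.1 hl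
            refine mul_le_mul (haC k hk' l hl' _ (hxs.shell i).2) ?_ (abs_nonneg _) hC
            refine abs_shellMonomial_le hr _ _ ?_ hk' hl'
            linarith [(abs_le.1 (hxs.shell i).2).2]
        _ = (M + 1) ^ 2 * C * Y := by simp; ring
    calc _ ≤ ∑ i, |α i| * ((M + 1) ^ 2 * C * Y) := by
          refine (Finset.abs_sum_le_sum_abs _ _).trans (Finset.sum_le_sum fun i _ => ?_)
          rw [abs_mul]
          exact mul_le_mul_of_nonneg_left (h1 i) (abs_nonneg _)
      _ = (∑ i, |α i|) * ((M + 1) ^ 2 * C * Y) := by rw [Finset.sum_mul]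
      _ ≤ c⁻¹ * (A * n) * (((M + 1) ^ 2 * C + C + 1) * Y) := by
          gcongr
          linarith
      _ = K * A * n * Y := by rw [hK]; ring
  · rw [heval, hα, ← Finset.sum_sub_distrib]
    have h1 (i : Fin n) : |scaledKernel g r x (xs i) -
        ∑ k ∈ Finset.range (M + 1), ∑ l ∈ Finset.range (M + 1), a k l (‖xs i‖ ^ 2 / r) *
          ((‖x‖ ^ 2 / r - 1) ^ l * (inner ℝ x (xs i) / r) ^ k)| ≤ C * δ ^ (M + 1) := by
      have h := happ d ((√r)⁻¹ • x) ((√r)⁻¹ • xs i)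
      rw [hnorm, hnorm, hinner, ← scaledKernel_eq_rotKernel g hr] at h
      simpa only [mul_assoc] using h hx.1 (hxs.shell i).1 hx.2 (hxs.shell i).2 (hxi i)
    calc _ ≤ ∑ i, |α i| * (C * δ ^ (M + 1)) := by
          refine (Finset.abs_sum_le_sum_abs _ _).trans (Finset.sum_le_sum fun i _ => ?_)
          rw [← mul_sub, abs_mul]
          exact mul_le_mul_of_nonneg_left (h1 i) (abs_nonneg _)
      _ = (∑ i, |α i|) * (C * δ ^ (M + 1)) := by rw [Finset.sum_mul]
      _ ≤ c⁻¹ * (A * n) * (((M + 1) ^ 2 * C + C + 1) * δ ^ (M + 1)) := by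
          gcongr
          linarith
      _ = _ := by rw [hK]; ring
  · calc _ ≤ c⁻¹ * (A * n) * 1 := by rw [mul_one]; exact hα1
      _ ≤ c⁻¹ * (A * n) * ((M + 1) ^ 2 * C + C + 1) := by
          gcongr
          linarith
      _ = _ := by rw [hK]; ring

end Deterministic

/-! ### Choice of the threshold -/

section Rates

/-- A threshold tending to zero slowly enough for concentration, but fast enough that it beats the
sample size to the power `M + 1`. -/
lemma exists_threshold {β c : ℝ} (hβ : 0 < β) (hc : 0 < c) {r : ℕ → ℝ}
    (hr : Tendsto (fun n : ℕ => r n / (n : ℝ) ^ β) atTop (𝓝 c)) {M : ℕ} (hM : 2 / β < M + 1)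
    (q₀ : ℕ) : ∃ (δ : ℕ → ℝ) (q : ℕ), q₀ ≤ q ∧ Tendsto δ atTop (𝓝[>] 0) ∧
      Tendsto (fun n : ℕ => n * δ n ^ (M + 1)) atTop (𝓝 0) ∧
      ∀ C : ℝ, ∀ᶠ n : ℕ in atTop, C / (δ n ^ 2 * r n) ^ q ≤ 1 / (n : ℝ) ^ 8 := by
  have hM0 : (0 : ℝ) < M + 1 := by positivity
  have hlt : 1 / (M + 1 : ℝ) < β / 2 := by
    rw [div_lt_iff₀ hβ] at hM
    rw [div_lt_div_iff₀ hM0 two_pos]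
    linarith
  obtain ⟨θ, h1, h2⟩ := exists_between hlt
  have hθ : 0 < θ := lt_trans (by positivity) h1
  have h1' : 1 < θ * (M + 1) := by rwa [div_lt_iff₀ hM0] at h1
  -- `δ² r` grows like `n^(β - 2θ)`, so its `q`-th power beats `n^8` once `q (β - 2θ) > 8`.
  obtain ⟨q₁, hq₁⟩ := exists_nat_gt (8 / (β - 2 * θ))
  have hξ : 0 < β - 2 * θ := by linarith
  refine ⟨fun n => (n : ℝ) ^ (-θ), max q₀ (q₁ + 1), le_max_left _ _, ?_, ?_, fun C => ?_⟩
  · refine tendsto_nhdsWithin_iff.2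
      ⟨(tendsto_rpow_neg_atTop hθ).comp tendsto_natCast_atTop_atTop, ?_⟩
    filter_upwards [eventually_gt_atTop 0] with n hn
    exact Real.rpow_pos_of_pos (Nat.cast_pos.2 hn) _
  · have h : Tendsto (fun n : ℕ => (n : ℝ) ^ (-(θ * (M + 1) - 1))) atTop (𝓝 0) :=
      (tendsto_rpow_neg_atTop (by linarith)).comp tendsto_natCast_atTop_atTop
    refine h.congr' ?_
    filter_upwards [eventually_gt_atTop 0] with n hn
    have hn' : (0 : ℝ) < n := Nat.cast_pos.2 hn
    rw [← Real.rpow_natCast, ← Real.rpow_mul hn'.le]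
    nth_rw 2 [← Real.rpow_one (n : ℝ)]
    rw [← Real.rpow_add hn']
    push_cast
    ring_nf
  · set q := max q₀ (q₁ + 1)
    have hq : 8 < (β - 2 * θ) * q := by
      rw [div_lt_iff₀ hξ] at hq₁
      have : (q₁ : ℝ) ≤ q := by
        have : q₁ ≤ q := (Nat.le_succ _).trans (le_max_right _ _)
        exact_mod_cast this
      nlinarith
    have h : Tendsto (fun n : ℕ => (r n / (n : ℝ) ^ β) ^ q * (n : ℝ) ^ ((β - 2 * θ) * q - 8))
        atTop atTop :=
      (hr.pow q).pos_mul_atTop (pow_pos hc q)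
        ((tendsto_rpow_atTop (by linarith)).comp tendsto_natCast_atTop_atTop)
    filter_upwards [h.eventually_ge_atTop (max C 1), eventually_gt_atTop 0] with n h3 hn
    have hn' : (0 : ℝ) < n := Nat.cast_pos.2 hn
    have e : ((n : ℝ) ^ (-θ)) ^ 2 * r n = (r n / (n : ℝ) ^ β) * (n : ℝ) ^ (β - 2 * θ) := by
      rw [← Real.rpow_natCast, ← Real.rpow_mul hn'.le, Real.rpow_sub hn',
        show -θ * ((2 : ℕ) : ℝ) = -(2 * θ) by push_cast; ring, Real.rpow_neg hn'.le]
      field_simp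
    have e2 : (((n : ℝ) ^ (-θ)) ^ 2 * r n) ^ q =
        (r n / (n : ℝ) ^ β) ^ q * (n : ℝ) ^ ((β - 2 * θ) * q - 8) * (n : ℝ) ^ 8 := by
      rw [e, mul_pow, ← Real.rpow_natCast ((n : ℝ) ^ (β - 2 * θ)), ← Real.rpow_mul hn'.le,
        mul_assoc, ← Real.rpow_natCast (n : ℝ) 8, ← Real.rpow_add hn']
      push_cast
      ring_nf
    rw [e2]
    have h4 := (le_max_right C 1).trans h3
    have h5 := (le_max_left C 1).trans h3
    rw [div_le_div_iff₀ (by positivity) (by positivity), one_mul]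
    gcongr

end Rates

/-! ### Probability of atypical inputs and atypical points -/

section Sampling

variable {d n : ℕ} {Ω : Type*} [MeasurableSpace Ω] {μ : Measure Ω} [IsProbabilityMeasure μ]
  {Q : Measure (E d)} {T : Set ℝ} {r δ : ℝ} {ρ : ℝ≥0∞}

/-- Union bound over points and ordered pairs. By independence and Fubini a pair is handled by
fixing its second point; the bound for inner products applies only when that point is in the ball,
which is why the bad event for pairs includes this condition. -/
lemma measure_not_isTypical_le [IsProbabilityMeasure Q] (hδ : δ ≤ 1)
    (h1 : Q {x | ¬(‖x‖ ^ 2 / r ∈ T ∧ |‖x‖ ^ 2 / r - 1| ≤ δ)} ≤ ρ)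
    (h2 : ∀ x', ‖x'‖ ^ 2 / r ≤ 2 → Q {x | δ < |inner ℝ x x' / r|} ≤ ρ)
    {xs : Fin n → Ω → E d} (hlaw : ∀ i, HasLaw (xs i) Q μ) (hind : iIndepFun xs μ) :
    μ {ω | ¬IsTypical T r δ fun i => xs i ω} ≤ n * ρ + n * (n * ρ) := by
  have hsub : {ω | ¬IsTypical T r δ fun i => xs i ω} ⊆
      (⋃ i, xs i ⁻¹' {x | ¬(‖x‖ ^ 2 / r ∈ T ∧ |‖x‖ ^ 2 / r - 1| ≤ δ)}) ∪
      ⋃ i, ⋃ j, {ω | i ≠ j ∧ ‖xs j ω‖ ^ 2 / r ≤ 2 ∧ δ < |inner ℝ (xs i ω) (xs j ω) / r|} := by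
    intro ω hω
    by_contra hcon
    simp only [Set.mem_union, Set.mem_iUnion, not_or, not_exists, Set.mem_preimage,
      Set.mem_ofPred_eq, not_not] at hcon
    refine hω ⟨hcon.1, fun i j hij => ?_⟩
    by_contra hlt
    refine hcon.2 i j ⟨hij, ?_, not_le.1 hlt⟩
    linarith [(abs_le.1 (hcon.1 j).2).2]
  have hsingle (i : Fin n) :
      μ (xs i ⁻¹' {x | ¬(‖x‖ ^ 2 / r ∈ T ∧ |‖x‖ ^ 2 / r - 1| ≤ δ)}) ≤ ρ := by
    refine (Measure.le_map_apply (hlaw i).aemeasurable _).trans ?_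
    rwa [(hlaw i).map_eq]
  have hpair (i j : Fin n) :
      μ {ω | i ≠ j ∧ ‖xs j ω‖ ^ 2 / r ≤ 2 ∧ δ < |inner ℝ (xs i ω) (xs j ω) / r|} ≤ ρ := by
    by_cases hij : i = j
    · simp [hij]
    set D : Set (E d × E d) := {z | ‖z.2‖ ^ 2 / r ≤ 2 ∧ δ < |inner ℝ z.1 z.2 / r|} with hD
    have hDm : MeasurableSet D := by
      refine MeasurableSet.inter ?_ ?_
      · exact measurableSet_le (f := fun z : E d × E d => ‖z.2‖ ^ 2 / r) (by fun_prop)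
          measurable_const
      · exact measurableSet_lt (g := fun z : E d × E d => |inner ℝ z.1 z.2 / r|) measurable_const
          (by fun_prop)
    have hprod : μ.map (fun ω => (xs i ω, xs j ω)) = Q.prod Q := by
      rw [(indepFun_iff_map_prod_eq_prod_map_map (hlaw i).aemeasurable (hlaw j).aemeasurable).1
        (hind.indepFun hij), (hlaw i).map_eq, (hlaw j).map_eq]
    calc _ ≤ μ ((fun ω => (xs i ω, xs j ω)) ⁻¹' D) := measure_mono fun ω hω => hω.2
      _ ≤ (Q.prod Q) D := by
          rw [← hprod]
          exact Measure.le_map_apply ((hlaw i).aemeasurable.prodMk (hlaw j).aemeasurable) _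
      _ = ∫⁻ y, Q ((fun x => (x, y)) ⁻¹' D) ∂Q := Measure.prod_apply_symm hDm
      _ ≤ ∫⁻ _, ρ ∂Q := by
          refine lintegral_mono fun y => ?_
          by_cases hy : ‖y‖ ^ 2 / r ≤ 2
          · exact (measure_mono fun x hx => hx.2).trans (h2 y hy)
          · have : (fun x : E d => (x, y)) ⁻¹' D = ∅ := by
              ext x
              simp [hD, hy]
            simp [this]
      _ = ρ := by simp
  refine (measure_mono hsub).trans ((measure_union_le _ _).trans (add_le_add ?_ ?_))
  · refine (measure_iUnion_fintype_le _ _).trans ((Finset.sum_le_sum fun i _ => hsingle i).trans ?_)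
    simp
  · refine (measure_iUnion_fintype_le _ _).trans ((Finset.sum_le_sum fun i _ =>
      (measure_iUnion_fintype_le _ _).trans (Finset.sum_le_sum fun j _ => hpair i j)).trans ?_)
    simp

lemma measure_not_typical_point_le
    (h1 : Q {x | ¬(‖x‖ ^ 2 / r ∈ T ∧ |‖x‖ ^ 2 / r - 1| ≤ δ)} ≤ ρ)
    (h2 : ∀ x', ‖x'‖ ^ 2 / r ≤ 2 → Q {x | δ < |inner ℝ x x' / r|} ≤ ρ)
    {xs : Fin n → E d} (hxs : ∀ i, ‖xs i‖ ^ 2 / r ≤ 2) :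
    Q {x | ¬((‖x‖ ^ 2 / r ∈ T ∧ |‖x‖ ^ 2 / r - 1| ≤ δ) ∧ ∀ i, |inner ℝ x (xs i) / r| ≤ δ)} ≤
      ρ + n * ρ := by
  have hsub : {x | ¬((‖x‖ ^ 2 / r ∈ T ∧ |‖x‖ ^ 2 / r - 1| ≤ δ) ∧
      ∀ i, |inner ℝ x (xs i) / r| ≤ δ)} ⊆
      {x | ¬(‖x‖ ^ 2 / r ∈ T ∧ |‖x‖ ^ 2 / r - 1| ≤ δ)} ∪
        ⋃ i, {x | δ < |inner ℝ x (xs i) / r|} := by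
    intro x hx
    by_contra hcon
    simp only [Set.mem_union, Set.mem_iUnion, not_or, not_exists, Set.mem_ofPred_eq, not_not,
      not_lt] at hcon
    exact hx hcon
  refine (measure_mono hsub).trans ((measure_union_le _ _).trans (add_le_add h1 ?_))
  refine (measure_iUnion_fintype_le _ _).trans
    ((Finset.sum_le_sum fun i _ => h2 (xs i) (hxs i)).trans ?_)
  simp

/-- The part of a moment that comes from a set of small measure. -/
lemma setLIntegral_le_of_moment {Y : E d → ℝ} {t C : ℝ}
    (ht : 0 < t) (hC : ∫⁻ x, ENNReal.ofReal (Y x ^ 2) ∂Q ≤ ENNReal.ofReal C) (N : Set (E d)) :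
    ∫⁻ x in N, ENNReal.ofReal (Y x) ∂Q ≤
      ENNReal.ofReal (t * C) + ENNReal.ofReal t⁻¹ * Q N := by
  calc ∫⁻ x in N, ENNReal.ofReal (Y x) ∂Q
      ≤ ∫⁻ x in N, (ENNReal.ofReal t * ENNReal.ofReal (Y x ^ 2) + ENNReal.ofReal t⁻¹) ∂Q := by
        refine lintegral_mono fun x => ?_
        rw [← ENNReal.ofReal_mul ht.le, ← ENNReal.ofReal_add (by positivity) (by positivity)]
        refine ENNReal.ofReal_le_ofReal ?_
        have h1 : 0 < t⁻¹ := by positivity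
        have h2 : t * t⁻¹ = 1 := mul_inv_cancel₀ ht.ne'
        nlinarith [mul_nonneg ht.le (sq_nonneg (Y x - t⁻¹)), mul_nonneg ht.le (sq_nonneg (Y x))]
    _ = (∫⁻ x in N, ENNReal.ofReal t * ENNReal.ofReal (Y x ^ 2) ∂Q) + ENNReal.ofReal t⁻¹ * Q N := by
        rw [lintegral_add_right _ measurable_const]
        simp
    _ ≤ _ := by
        gcongr
        refine (setLIntegral_le_lintegral _ _).trans ?_
        rw [lintegral_const_mul' _ _ ENNReal.ofReal_ne_top, ENNReal.ofReal_mul ht.le]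
        gcongr

end Sampling

/-! ### Comparing squared distances off a small set -/

section Splitting

variable {X : Type*} [MeasurableSpace X] {Q : Measure X}

lemma eLpNorm_two_sq (f : X → ℝ) :
    eLpNorm f 2 Q ^ 2 = ∫⁻ x, ENNReal.ofReal (f x ^ 2) ∂Q := by
  have h := eLpNorm_nnreal_pow_eq_lintegral (f := f) (μ := Q) (p := 2) two_ne_zero
  simp only [NNReal.coe_ofNat, ENNReal.rpow_ofNat, ENNReal.coe_ofNat] at h
  rw [h]
  refine lintegral_congr fun x => ?_
  rw [← ofReal_norm, ← ENNReal.ofReal_pow (norm_nonneg _), Real.norm_eq_abs, sq_abs]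

/-- If `h` and `p` are close off a small set, then the distance of `f` to `p` exceeds the distance
of `f` to `h` only slightly. -/
lemma lintegral_sub_sq_le [IsProbabilityMeasure Q] {f h p : X → ℝ} {N : Set X}
    (hN : MeasurableSet N) {A e t : ℝ} (ht : 0 < t) (hf : ∀ᵐ x ∂Q, |f x| ≤ A)
    (hhp : ∀ x ∉ N, |h x - p x| ≤ e) :
    ∫⁻ x, ENNReal.ofReal ((f x - p x) ^ 2) ∂Q ≤
      ENNReal.ofReal (1 + t) * ∫⁻ x, ENNReal.ofReal ((h x - f x) ^ 2) ∂Q +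
        ENNReal.ofReal ((1 + t⁻¹) * e ^ 2) + (ENNReal.ofReal (2 * A ^ 2) * Q N +
        2 * ∫⁻ x in N, ENNReal.ofReal (p x ^ 2) ∂Q) := by
  rw [← lintegral_add_compl (fun x => ENNReal.ofReal ((f x - p x) ^ 2)) hN,
    add_comm (∫⁻ x in N, _ ∂Q)]
  have hti : 0 < t⁻¹ := by positivity
  refine add_le_add ?_ ?_
  · calc _ ≤ ∫⁻ x in Nᶜ, (ENNReal.ofReal (1 + t) * ENNReal.ofReal ((h x - f x) ^ 2) +
          ENNReal.ofReal ((1 + t⁻¹) * e ^ 2)) ∂Q := by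
          refine setLIntegral_mono' hN.compl fun x hx => ?_
          rw [← ENNReal.ofReal_mul (by positivity), ← ENNReal.ofReal_add (by positivity)
            (by positivity)]
          refine ENNReal.ofReal_le_ofReal ?_
          have h1 : (h x - p x) ^ 2 ≤ e ^ 2 := sq_le_sq' (abs_le.1 (hhp x hx)).1
            (abs_le.1 (hhp x hx)).2
          have h2 : (1 + t⁻¹) * (h x - p x) ^ 2 ≤ (1 + t⁻¹) * e ^ 2 := by gcongr
          have h3 : t * t⁻¹ = 1 := mul_inv_cancel₀ ht.ne'
          refine le_trans ?_ (add_le_add_right h2 _)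
          -- Completing the square in `(a + b)² ≤ (1 + t) a² + (1 + t⁻¹) b²`; the last summand
          -- vanishes because `t * t⁻¹ = 1`.
          have h4 : (1 + t) * (h x - f x) ^ 2 + (1 + t⁻¹) * (h x - p x) ^ 2 - (f x - p x) ^ 2 =
              t * ((h x - f x) + t⁻¹ * (h x - p x)) ^ 2 +
              (1 - t * t⁻¹) * (2 * (h x - f x) * (h x - p x) + t⁻¹ * (h x - p x) ^ 2) := by ring
          rw [h3, sub_self, zero_mul, add_zero] at h4
          have h5 : 0 ≤ t * ((h x - f x) + t⁻¹ * (h x - p x)) ^ 2 := by positivity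
          linarith
      _ ≤ ∫⁻ x, (ENNReal.ofReal (1 + t) * ENNReal.ofReal ((h x - f x) ^ 2) +
          ENNReal.ofReal ((1 + t⁻¹) * e ^ 2)) ∂Q := setLIntegral_le_lintegral _ _
      _ = _ := by
          rw [lintegral_add_right _ measurable_const,
            lintegral_const_mul' _ _ ENNReal.ofReal_ne_top]
          simp
  · calc _ ≤ ∫⁻ x in N, (ENNReal.ofReal (2 * A ^ 2) + 2 * ENNReal.ofReal (p x ^ 2)) ∂Q := by
          refine lintegral_mono_ae (ae_restrict_of_ae ?_)
          filter_upwards [hf] with x hx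
          rw [show (2 : ℝ≥0∞) = ENNReal.ofReal 2 by simp, ← ENNReal.ofReal_mul (by positivity),
            ← ENNReal.ofReal_add (by positivity) (by positivity)]
          refine ENNReal.ofReal_le_ofReal ?_
          have h1 : f x ^ 2 ≤ A ^ 2 := sq_le_sq' (abs_le.1 hx).1 (abs_le.1 hx).2
          nlinarith [sq_nonneg (f x + p x)]
      _ = _ := by
          rw [lintegral_add_left measurable_const, lintegral_const_mul' _ _ (by simp)]
          simp

lemma polyDistSq_le {d : ℕ} {P : Measure (E d)} {f : E d → ℝ} {m : ℕ}
    {p : MvPolynomial (Fin d) ℝ} (hp : p.totalDegree ≤ m) :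
    polyDistSq P f m ≤
      ∫⁻ x, ENNReal.ofReal ((f x - MvPolynomial.eval (fun i => x i) p) ^ 2) ∂P := by
  rw [← eLpNorm_two_sq]
  exact iInf₂_le p hp

lemma polyDistSq_le_sq {d : ℕ} {P : Measure (E d)} [IsProbabilityMeasure P] {f : E d → ℝ} {m : ℕ}
    {A : ℝ} (hf : ∀ᵐ x ∂P, |f x| ≤ A) : polyDistSq P f m ≤ ENNReal.ofReal (A ^ 2) := by
  refine (polyDistSq_le (p := 0) (by simp)).trans ?_
  calc _ ≤ ∫⁻ _, ENNReal.ofReal (A ^ 2) ∂P := by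
        refine lintegral_mono_ae ?_
        filter_upwards [hf] with x hx
        refine ENNReal.ofReal_le_ofReal ?_
        rw [map_zero, sub_zero]
        exact sq_le_sq' (abs_le.1 hx).1 (abs_le.1 hx).2
    _ = _ := by simp

end Splitting

/-! ### Almost sure approximation by polynomials -/

lemma ofReal_mul_natCast_le {a : ℝ} {n : ℕ} (hn : 1 ≤ n) (h : a ≤ 1 / (n : ℝ) ^ 8) :
    ENNReal.ofReal a + n * ENNReal.ofReal a ≤ ENNReal.ofReal (2 / (n : ℝ) ^ 7) := by
  have hn' : (1 : ℝ) ≤ n := by exact_mod_cast hn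
  have e : (1 : ℝ) / n ^ 8 + n * (1 / n ^ 8) ≤ 2 / n ^ 7 := by
    have : (1 : ℝ) / n ^ 8 + n * (1 / n ^ 8) = (1 / n + 1) / n ^ 7 := by field_simp
    rw [this]
    gcongr
    have : 1 / (n : ℝ) ≤ 1 := by rw [div_le_one (by positivity)]; exact hn'
    linarith
  refine le_trans ?_ (ENNReal.ofReal_le_ofReal e)
  rw [ENNReal.ofReal_add (by positivity) (by positivity),
    ENNReal.ofReal_mul (p := (n : ℝ)) (by positivity), ENNReal.ofReal_natCast]
  gcongr

/-- Almost surely the averaged estimates are eventually close to polynomials off small sets. -/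
theorem exists_polynomial_eventually (model : DataModel) (β c : ℝ) (hβ : 0 < β) (hc : 0 < c)
    (g : ℝ → ℝ → ℝ → ℝ) (hg : model.AdmissibleKernel β g)
    (d : ℕ → ℕ) (S R : ∀ n, Matrix (Fin (d n)) (Fin (d n)) ℝ)
    (hR : ∀ n, (R n).PosSemidef) (hRS : ∀ n, R n * R n = S n) (hnorm : ∀ n, opNorm (S n) = 1)
    (hdim : Tendsto (fun n : ℕ => effDim (S n) / (n : ℝ) ^ β) atTop (𝓝 c))
    (B : ℝ) (ν : ℕ → Measure ℝ) [∀ n, IsProbabilityMeasure (ν n)] (hν : ∀ n, IsEntryLaw B (ν n))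
    (P : ∀ n, Measure (E (d n))) (hP : ∀ n, P n = model.law (ν n) (S n) (R n))
    (κ : ∀ n, Kernel (E (d n)) ℝ) [∀ n, IsMarkovKernel (κ n)]
    (hκ : ∀ n, ∀ᵐ x ∂(P n), Integrable (fun y : ℝ => y) (κ n x))
    (A : ℝ) (hA0 : 0 ≤ A) (hA : ∀ n, ∀ᵐ x ∂(P n), |groundTruth (κ n) x| ≤ A)
    {Ω : Type*} [MeasurableSpace Ω] (μ : Measure Ω) [IsProbabilityMeasure μ]
    (x : ∀ n, Fin n → Ω → E (d n))
    (hlaw : ∀ n i, HasLaw (x n i) (P n) μ) (hindep : ∀ n, iIndepFun (x n) μ)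
    (lam : ℕ → ℝ) (hlam : ∀ n, 0 ≤ lam n) :
    ∃ (C : ℝ) (e : ℕ → ℝ), 0 ≤ C ∧ Tendsto e atTop (𝓝 0) ∧ ∀ᵐ ω ∂μ, ∀ᶠ n : ℕ in atTop,
      ∃ p : MvPolynomial (Fin (d n)) ℝ, p.totalDegree ≤ model.degree β ∧
      ∃ N : Set (E (d n)), MeasurableSet N ∧ P n N ≤ ENNReal.ofReal (2 / (n : ℝ) ^ 7) ∧
        (∀ z ∉ N, |averagedEstimate (scaledKernel g (effDim (S n))) (lam n) (κ n)
          (fun i => x n i ω) z - MvPolynomial.eval (fun i => z i) p| ≤ e n) ∧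
        ∫⁻ z in N, ENNReal.ofReal (MvPolynomial.eval (fun i => z i) p ^ 2) ∂(P n) ≤
          ENNReal.ofReal (C / n) ∧
        ∃ α : Fin n → ℝ, ∑ i, |α i| ≤ C * n ∧
          ∀ z, averagedEstimate (scaledKernel g (effDim (S n))) (lam n) (κ n)
            (fun i => x n i ω) z = ∑ i, α i * scaledKernel g (effDim (S n)) z (x n i ω) := by
  have hprob (n : ℕ) : IsProbabilityMeasure (P n) := by rw [hP]; infer_instance
  obtain ⟨K, η, hK, hη, hpoly⟩ := hg.barrierKernel.exists_polynomial
  set M := ⌊2 / β⌋₊ with hM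
  -- `q ≥ 4M` because the square of the polynomial is of order `(1 + ‖x‖²/r)^(4M)`, and the second
  -- moment of that power is required.
  obtain ⟨δ, q, hq, hδ, hδM, hrate⟩ :=
    exists_threshold hβ hc hdim (Nat.lt_floor_add_one (2 / β)) (4 * M)
  obtain ⟨C, hC, hconc⟩ := DataModel.exists_concentration B q
  have hr : Tendsto (fun n => effDim (S n)) atTop atTop := by
    refine (hdim.pos_mul_atTop hc
      ((tendsto_rpow_atTop hβ).comp tendsto_natCast_atTop_atTop)).congr' ?_
    filter_upwards [eventually_gt_atTop 0] with n hn
    have : (0 : ℝ) < (n : ℝ) ^ β := Real.rpow_pos_of_pos (Nat.cast_pos.2 hn) _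
    simp only [Function.comp_apply]
    field_simp
  have hev : ∀ᶠ n : ℕ in atTop, (0 < δ n ∧ δ n ≤ 1 / 2) ∧ 1 ≤ effDim (S n) ∧ 1 ≤ n ∧
      C / (δ n ^ 2 * effDim (S n)) ^ q ≤ 1 / (n : ℝ) ^ 8 ∧ n * δ n ^ (M + 1) ≤ η := by
    filter_upwards [hδ.eventually (Ioc_mem_nhdsGT (show (0 : ℝ) < 1 / 2 by norm_num)),
      hr.eventually_ge_atTop 1, eventually_ge_atTop 1, hrate C, hδM.eventually (ge_mem_nhds hη)]
      with n h1 h2 h3 h4 h5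
    exact ⟨h1, h2, h3, h4, h5⟩
  -- eventually the inputs are typical
  have htyp : ∀ᵐ ω ∂μ, ∀ᶠ n in atTop,
      IsTypical model.shells (effDim (S n)) (δ n) fun i => x n i ω := by
    -- Borel–Cantelli. Restricting the events to `n ≥ n₀` makes the earlier ones empty; the later
    -- ones have probability at most `2/n^6`.
    obtain ⟨n₀, hn₀⟩ := eventually_atTop.1 hev
    have hle (n : ℕ) : μ {ω | n₀ ≤ n ∧ ¬IsTypical model.shells (effDim (S n)) (δ n)
        fun i => x n i ω} ≤ ENNReal.ofReal (2 * (1 / (n : ℝ) ^ 2)) := by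
      by_cases hn : n₀ ≤ n
      swap
      · simp [hn]
      obtain ⟨⟨h1, h2⟩, h3, h4, h5, h6⟩ := hn₀ n hn
      obtain ⟨hc1, hc2, -⟩ := hconc model (d n) (S n) (R n) (ν n) (hν n) (hR n) (hRS n) (hnorm n) h3
      rw [← hP] at hc1 hc2
      have hn1 : (1 : ℝ) ≤ n := by exact_mod_cast h4
      calc _ ≤ μ {ω | ¬IsTypical model.shells (effDim (S n)) (δ n) fun i => x n i ω} :=
            measure_mono fun ω hω => hω.2
        _ ≤ _ := measure_not_isTypical_le (by linarith) (hc1 _ h1 h2) (hc2 _ h1 h2)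
            (hlaw n) (hindep n)
        _ = n * (ENNReal.ofReal (C / (δ n ^ 2 * effDim (S n)) ^ q) +
            n * ENNReal.ofReal (C / (δ n ^ 2 * effDim (S n)) ^ q)) := by rw [mul_add]
        _ ≤ n * ENNReal.ofReal (2 / (n : ℝ) ^ 7) := by
            gcongr
            exact ofReal_mul_natCast_le h4 h5
        _ = ENNReal.ofReal (n * (2 / (n : ℝ) ^ 7)) := by
            rw [ENNReal.ofReal_mul (p := (n : ℝ)) (by positivity), ENNReal.ofReal_natCast]
        _ ≤ _ := by
            refine ENNReal.ofReal_le_ofReal ?_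
            have e : (n : ℝ) * (2 / (n : ℝ) ^ 7) = 2 * (1 / (n : ℝ) ^ 6) := by field_simp
            rw [e]
            gcongr 2 * (1 / ?_)
            exact pow_le_pow_right₀ hn1 (by norm_num)
    have hsum : ∑' n, μ {ω | n₀ ≤ n ∧ ¬IsTypical model.shells (effDim (S n)) (δ n)
        fun i => x n i ω} ≠ ∞ := by
      refine ne_top_of_le_ne_top ?_ (ENNReal.tsum_le_tsum hle)
      exact ((Real.summable_one_div_nat_pow.2 one_lt_two).mul_left 2).tsum_ofReal_ne_top
    filter_upwards [ae_eventually_notMem hsum] with ω hω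
    filter_upwards [hω, eventually_ge_atTop n₀] with n h1 h2
    by_contra h3
    exact h1 ⟨h2, h3⟩
  have hobs : ∀ᵐ ω ∂μ, ∀ n (i : Fin n), Integrable (fun y : ℝ => y) (κ n (x n i ω)) ∧
      |groundTruth (κ n) (x n i ω)| ≤ A := by
    refine ae_all_iff.2 fun n => ae_all_iff.2 fun i => ?_
    refine ae_of_ae_map (f := x n i) (p := fun z => Integrable (fun y : ℝ => y) (κ n z) ∧
      |groundTruth (κ n) z| ≤ A) (hlaw n i).aemeasurable ?_
    rw [(hlaw n i).map_eq]
    exact (hκ n).and (hA n)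
  -- The first summand bounds `∑ |αᵢ|`, the second the integral of `p²` over the atypical set.
  refine ⟨K * A + (K * A) ^ 2 * (C + 2), fun n => K * A * (n * δ n ^ (M + 1)), by positivity,
    by simpa using hδM.const_mul (K * A), ?_⟩
  filter_upwards [htyp, hobs] with ω hω hω'
  filter_upwards [hω, hev, hδ.eventually hpoly] with n htyp hn hpoly
  obtain ⟨⟨h1, h2⟩, h3, h4, h5, h6⟩ := hn
  have hn1 : (1 : ℝ) ≤ n := by exact_mod_cast h4
  obtain ⟨hc1, hc2, hmom⟩ := hconc model (d n) (S n) (R n) (ν n) (hν n) (hR n) (hRS n) (hnorm n) h3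
  rw [← hP] at hc1 hc2 hmom
  have hr0 : 0 < effDim (S n) := by linarith
  obtain ⟨p, hp, hpbound, hpclose, α, hα, hαeq⟩ := hpoly (d n) n (effDim (S n)) hr0
    (fun i => x n i ω) htyp h6 (lam n) (hlam n) (κ n) inferInstance (fun i => (hω' n i).1) A hA0
    (fun i => (hω' n i).2)
  set G : Set (E (d n)) := {z | ¬((‖z‖ ^ 2 / effDim (S n) ∈ model.shells ∧
    |‖z‖ ^ 2 / effDim (S n) - 1| ≤ δ n) ∧ ∀ i, |inner ℝ z (x n i ω) / effDim (S n)| ≤ δ n)} with hG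
  have hN : P n (toMeasurable (P n) G) ≤ ENNReal.ofReal (2 / (n : ℝ) ^ 7) := by
    rw [measure_toMeasurable]
    refine (measure_not_typical_point_le (hc1 _ h1 h2) (hc2 _ h1 h2) fun i => ?_).trans
      (ofReal_mul_natCast_le h4 h5)
    linarith [(abs_le.1 (htyp.shell i).2).2]
  refine ⟨p, hp, toMeasurable (P n) G, measurableSet_toMeasurable _ _, hN, fun z hz => ?_, ?_,
    α, ?_, hαeq⟩
  · have h7 : z ∉ G := fun h => hz (subset_toMeasurable _ _ h)
    rw [hG, Set.mem_ofPred_eq, not_not] at h7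
    exact hpclose z h7.1 h7.2
  · have hs (z : E (d n)) : 0 ≤ ‖z‖ ^ 2 / effDim (S n) := by positivity
    have hmom' : ∫⁻ z, ENNReal.ofReal (((1 + ‖z‖ ^ 2 / effDim (S n)) ^ (4 * M)) ^ 2) ∂(P n) ≤
        ENNReal.ofReal C := by
      refine (lintegral_mono fun z => ENNReal.ofReal_le_ofReal ?_).trans hmom
      rw [← pow_mul]
      exact pow_le_pow_right₀ (by linarith [hs z]) (by omega)
    -- With `p²` of order `n²`, the choice `t = n^(-4)` gives `n² (n^(-4) + n^4 n^(-7))`, which is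
    -- `O(1/n)`.
    have h7 := setLIntegral_le_of_moment (t := ((n : ℝ) ^ 4)⁻¹) (by positivity) hmom'
      (toMeasurable (P n) G)
    calc _ ≤ ∫⁻ z in toMeasurable (P n) G, ENNReal.ofReal ((K * A * n) ^ 2) *
          ENNReal.ofReal ((1 + ‖z‖ ^ 2 / effDim (S n)) ^ (4 * M)) ∂(P n) := by
          refine lintegral_mono fun z => ?_
          rw [← ENNReal.ofReal_mul (by positivity)]
          refine ENNReal.ofReal_le_ofReal ?_
          have h8 := hpbound z
          rw [← sq_abs]
          refine (pow_le_pow_left₀ (abs_nonneg _) h8 2).trans (le_of_eq ?_)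
          rw [mul_pow, ← pow_mul]
          ring_nf
      _ ≤ ENNReal.ofReal ((K * A * n) ^ 2) * (ENNReal.ofReal (((n : ℝ) ^ 4)⁻¹ * C) +
          ENNReal.ofReal (((n : ℝ) ^ 4)⁻¹)⁻¹ * ENNReal.ofReal (2 / (n : ℝ) ^ 7)) := by
          rw [lintegral_const_mul' _ _ ENNReal.ofReal_ne_top]
          gcongr
          exact h7.trans (by gcongr)
      _ = ENNReal.ofReal ((K * A * n) ^ 2 * (((n : ℝ) ^ 4)⁻¹ * C +
          (((n : ℝ) ^ 4)⁻¹)⁻¹ * (2 / (n : ℝ) ^ 7))) := by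
          rw [← ENNReal.ofReal_mul (by positivity), ← ENNReal.ofReal_add (by positivity)
            (by positivity), ← ENNReal.ofReal_mul (by positivity)]
      _ ≤ _ := by
          refine ENNReal.ofReal_le_ofReal ?_
          have e1 : (K * A * n) ^ 2 * (((n : ℝ) ^ 4)⁻¹ * C +
              (((n : ℝ) ^ 4)⁻¹)⁻¹ * (2 / (n : ℝ) ^ 7)) =
              (K * A) ^ 2 * (C / n + 2) / n := by
            field_simp
          rw [e1]
          have h8 : C / n ≤ C := div_le_self hC hn1
          have h9 : 0 ≤ K * A := by positivity
          gcongr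
          nlinarith [mul_le_mul_of_nonneg_left h8 (sq_nonneg (K * A))]
  · refine hα.trans ?_
    have : 0 ≤ (K * A) ^ 2 * (C + 2) := by positivity
    gcongr
    linarith

/-! ### From approximation off small sets to the two conclusions -/

lemma exists_seq_tendsto {α : ℕ → Type*} {Q : ∀ n, α n → Prop} (hQ : ∀ n, ∃ p, Q n p)
    {u : ∀ n, α n → ℝ≥0∞} {b : ℕ → ℝ} (hb : Tendsto b atTop (𝓝 0))
    (h : ∀ᶠ n in atTop, ∃ p, Q n p ∧ u n p ^ 2 ≤ ENNReal.ofReal (b n)) :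
    ∃ p : ∀ n, α n, (∀ n, Q n (p n)) ∧ Tendsto (fun n => u n (p n)) atTop (𝓝 0) := by
  have h' (n : ℕ) : ∃ p, Q n p ∧ ((∃ p, Q n p ∧ u n p ^ 2 ≤ ENNReal.ofReal (b n)) →
      u n p ^ 2 ≤ ENNReal.ofReal (b n)) := by
    by_cases hn : ∃ p, Q n p ∧ u n p ^ 2 ≤ ENNReal.ofReal (b n)
    · obtain ⟨p, hp, hu⟩ := hn
      exact ⟨p, hp, fun _ => hu⟩
    · obtain ⟨p, hp⟩ := hQ n
      exact ⟨p, hp, fun hc => absurd hc hn⟩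
  choose p hp hu using h'
  refine ⟨p, hp, ?_⟩
  have h1 : Tendsto (fun n => u n (p n) ^ 2) atTop (𝓝 0) := by
    have h2 : Tendsto (fun n => ENNReal.ofReal (b n)) atTop (𝓝 0) := by
      simpa using ENNReal.tendsto_ofReal hb
    exact tendsto_of_tendsto_of_tendsto_of_le_of_le' tendsto_const_nhds h2
      (Eventually.of_forall fun n => zero_le) (h.mono hu)
  have h3 := h1.ennrpow_const (1 / 2)
  rw [ENNReal.zero_rpow_of_pos (by norm_num)] at h3
  refine h3.congr fun n => ?_
  rw [← ENNReal.rpow_natCast, ← ENNReal.rpow_mul]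
  norm_num

/-- If the bias `I` is at least `A²`, comparison with the zero polynomial suffices; this also covers
an infinite bias. Otherwise `t = ε/(2(A² + 1))` makes the excess `t I` in `lintegral_sub_sq_le` at
most `ε/2`. -/
lemma polyDistSq_le_add {d m : ℕ} {P : Measure (E d)} [IsProbabilityMeasure P] {f h : E d → ℝ}
    {A e ε a b : ℝ} (hε : 0 < ε) (hb : 0 ≤ b) (hf : ∀ᵐ x ∂P, |f x| ≤ A)
    {p : MvPolynomial (Fin d) ℝ} (hp : p.totalDegree ≤ m) {N : Set (E d)} (hN : MeasurableSet N)
    (hPN : P N ≤ ENNReal.ofReal a)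
    (hhp : ∀ x ∉ N, |h x - MvPolynomial.eval (fun i => x i) p| ≤ e)
    (hpN : ∫⁻ x in N, ENNReal.ofReal (MvPolynomial.eval (fun i => x i) p ^ 2) ∂P ≤
      ENNReal.ofReal b) (ha : 0 ≤ a)
    (hsmall : (1 + (ε / (2 * (A ^ 2 + 1)))⁻¹) * e ^ 2 + (2 * A ^ 2 * a + 2 * b) ≤ ε / 2) :
    polyDistSq P f m ≤ ∫⁻ x, ENNReal.ofReal ((h x - f x) ^ 2) ∂P + ENNReal.ofReal ε := by
  set t : ℝ := ε / (2 * (A ^ 2 + 1)) with ht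
  have ht0 : 0 < t := by positivity
  set I := ∫⁻ x, ENNReal.ofReal ((h x - f x) ^ 2) ∂P with hI
  rcases le_total I (ENNReal.ofReal (A ^ 2)) with hle | hle
  swap
  · exact (polyDistSq_le_sq hf).trans (hle.trans le_self_add)
  refine (polyDistSq_le hp).trans ((lintegral_sub_sq_le hN ht0 hf hhp).trans ?_)
  rw [← hI, ENNReal.ofReal_add zero_le_one ht0.le, ENNReal.ofReal_one, add_mul, one_mul, add_assoc,
    add_assoc]
  gcongr
  calc _ ≤ ENNReal.ofReal t * ENNReal.ofReal (A ^ 2) + (ENNReal.ofReal ((1 + t⁻¹) * e ^ 2) +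
        (ENNReal.ofReal (2 * A ^ 2) * ENNReal.ofReal a + ENNReal.ofReal 2 * ENNReal.ofReal b)) := by
        rw [ENNReal.ofReal_ofNat]
        gcongr
    _ = ENNReal.ofReal (t * A ^ 2 + ((1 + t⁻¹) * e ^ 2 + (2 * A ^ 2 * a + 2 * b))) := by
        rw [← ENNReal.ofReal_mul ht0.le, ← ENNReal.ofReal_mul (by positivity),
          ← ENNReal.ofReal_mul zero_le_two, ← ENNReal.ofReal_add (by positivity) (by positivity),
          ← ENNReal.ofReal_add (by positivity) (by positivity),
          ← ENNReal.ofReal_add (by positivity) (by positivity)]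
    _ ≤ _ := by
        refine ENNReal.ofReal_le_ofReal ?_
        have h1 : t * A ^ 2 ≤ ε / 2 := by
          rw [ht, div_mul_eq_mul_div, div_le_div_iff₀ (by positivity) two_pos]
          nlinarith
        linarith

/-- This is `lintegral_sub_sq_le` with `f = h`, so that the main term vanishes and the a priori
bound `H` is used only on the small set. -/
lemma eLpNorm_sub_sq_le {X : Type*} [MeasurableSpace X] {Q : Measure X} [IsProbabilityMeasure Q]
    {h p : X → ℝ} {N : Set X} (hN : MeasurableSet N) {H e a b : ℝ} (ha : 0 ≤ a) (hb : 0 ≤ b)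
    (hh : ∀ᵐ x ∂Q, |h x| ≤ H) (hhp : ∀ x ∉ N, |h x - p x| ≤ e) (hQN : Q N ≤ ENNReal.ofReal a)
    (hpN : ∫⁻ x in N, ENNReal.ofReal (p x ^ 2) ∂Q ≤ ENNReal.ofReal b) :
    eLpNorm (fun x => h x - p x) 2 Q ^ 2 ≤
      ENNReal.ofReal (2 * e ^ 2 + (2 * H ^ 2 * a + 2 * b)) := by
  have h1 := lintegral_sub_sq_le hN one_pos hh hhp
  rw [eLpNorm_two_sq]
  refine h1.trans ?_
  simp only [sub_self, ne_eq, OfNat.ofNat_ne_zero, not_false_eq_true, zero_pow,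
    ENNReal.ofReal_zero, lintegral_zero, mul_zero, zero_add]
  rw [ENNReal.ofReal_add (by positivity) (by positivity), ENNReal.ofReal_add (by positivity)
    (by positivity), ENNReal.ofReal_mul (p := 2 * H ^ 2) (by positivity),
    ENNReal.ofReal_mul (p := 2) (q := b) zero_le_two, ENNReal.ofReal_ofNat]
  gcongr
  norm_num

end PolyBarrier

end

theorem theorem1
    -- the type of input distribution, and the kernel
    (model : PolyBarrier.DataModel) (β c : ℝ) (hβ : 0 < β) (hc : 0 < c)
    (g : ℝ → ℝ → ℝ → ℝ) (hg : model.AdmissibleKernel β g)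
    -- covariance matrices, their square roots, and the growth of the effective dimension
    (d : ℕ → ℕ) (S R : ∀ n, Matrix (Fin (d n)) (Fin (d n)) ℝ)
    (hS : ∀ n, (S n).PosSemidef) (hR : ∀ n, (R n).PosSemidef) (hRS : ∀ n, R n * R n = S n)
    (hnorm : ∀ n, PolyBarrier.opNorm (S n) = 1)
    (hdim : Tendsto (fun n : ℕ => PolyBarrier.effDim (S n) / (n : ℝ) ^ β) atTop (𝓝 c))
    -- the coordinate laws and the input distributions
    (B : ℝ) (ν : ℕ → Measure ℝ) [∀ n, IsProbabilityMeasure (ν n)]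
    (hν : ∀ n, PolyBarrier.IsEntryLaw B (ν n))
    (P : ∀ n, Measure (PolyBarrier.E (d n))) (hP : ∀ n, P n = model.law (ν n) (S n) (R n))
    -- the conditional laws of the observations, with bounded ground truth
    (κ : ∀ n, Kernel (PolyBarrier.E (d n)) ℝ) [∀ n, IsMarkovKernel (κ n)]
    (hκ : ∀ n, ∀ᵐ x ∂(P n), Integrable (fun y : ℝ => y) (κ n x))
    (A : ℝ) (hA : ∀ n, ∀ᵐ x ∂(P n), |PolyBarrier.groundTruth (κ n) x| ≤ A)
    -- for every `n` a sample of `n` i.i.d. inputs of law `P n`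
    {Ω : Type*} [MeasurableSpace Ω] (μ : Measure Ω) [IsProbabilityMeasure μ]
    (x : ∀ n, Fin n → Ω → PolyBarrier.E (d n))
    (hlaw : ∀ n i, HasLaw (x n i) (P n) μ) (hindep : ∀ n, iIndepFun (x n) μ)
    -- the ridge parameters
    (lam : ℕ → ℝ) (hlam : ∀ n, 0 ≤ lam n) :
    (∀ᵐ ω ∂μ, ∀ ε : ℝ, 0 < ε → ∀ᶠ n : ℕ in atTop,
      PolyBarrier.polyDistSq (P n) (PolyBarrier.groundTruth (κ n)) (model.degree β) ≤
        PolyBarrier.bias (P n) (PolyBarrier.scaledKernel g (PolyBarrier.effDim (S n))) (lam n)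
          (κ n) (fun i => x n i ω) + ENNReal.ofReal ε) ∧
    ((∃ C : ℝ, ∀ n, ∀ z ∈ (P n).support, ∀ z' ∈ (P n).support,
        |PolyBarrier.scaledKernel g (PolyBarrier.effDim (S n)) z z'| ≤ C) →
      ∀ᵐ ω ∂μ, ∃ p : ∀ n, MvPolynomial (Fin (d n)) ℝ,
        (∀ n, (p n).totalDegree ≤ model.degree β) ∧
        Tendsto (fun n => eLpNorm (fun z =>
          PolyBarrier.averagedEstimate (PolyBarrier.scaledKernel g (PolyBarrier.effDim (S n)))
            (lam n) (κ n) (fun i => x n i ω) z - MvPolynomial.eval (fun i => z i) (p n))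
          2 (P n)) atTop (𝓝 0)) := by
  have hprob (n : ℕ) : IsProbabilityMeasure (P n) := by rw [hP]; infer_instance
  obtain ⟨A', hA0, hA'⟩ : ∃ A', 0 ≤ A' ∧
      ∀ n, ∀ᵐ z ∂(P n), |PolyBarrier.groundTruth (κ n) z| ≤ A' :=
    ⟨|A|, abs_nonneg A, fun n => (hA n).mono fun z hz => hz.trans (le_abs_self A)⟩
  obtain ⟨C, e, hC, he, hmain⟩ := PolyBarrier.exists_polynomial_eventually model β c hβ hc g hg d S R
    hR hRS hnorm hdim B ν hν P hP κ hκ A' hA0 hA' μ x hlaw hindep lam hlam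
  have hinv (k : ℕ) (hk : k ≠ 0) : Tendsto (fun n : ℕ => ((n : ℝ) ^ k)⁻¹) atTop (𝓝 0) :=
    ((tendsto_pow_atTop hk).comp tendsto_natCast_atTop_atTop).inv_tendsto_atTop
  refine ⟨?_, fun ⟨C', hC'⟩ => ?_⟩
  · filter_upwards [hmain] with ω hω ε hε
    have hlim : Tendsto (fun n : ℕ => (1 + (ε / (2 * (A' ^ 2 + 1)))⁻¹) * e n ^ 2 +
        (2 * A' ^ 2 * (2 * ((n : ℝ) ^ 7)⁻¹) + 2 * (C * ((n : ℝ) ^ 1)⁻¹))) atTop (𝓝 0) := by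
      simpa [-inv_div] using ((he.pow 2).const_mul (1 + (ε / (2 * (A' ^ 2 + 1)))⁻¹)).add
        ((((hinv 7 (by simp)).const_mul 2).const_mul (2 * A' ^ 2)).add
          (((hinv 1 (by simp)).const_mul C).const_mul 2))
    filter_upwards [hω, hlim.eventually (ge_mem_nhds (half_pos hε))] with n hn hnε
    obtain ⟨p, hp, N, hN, hPN, hclose, hpN, -⟩ := hn
    rw [PolyBarrier.bias, PolyBarrier.eLpNorm_two_sq]
    simp only [pow_one, ← div_eq_mul_inv] at hnε
    exact PolyBarrier.polyDistSq_le_add hε (by positivity) (hA' n) hp hN hPN hclose hpN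
      (by positivity) hnε
  -- The kernel is bounded only on the support, so the inputs must lie there as well as the
  -- evaluation point.
  · have hsupp : ∀ᵐ ω ∂μ, ∀ n (i : Fin n), x n i ω ∈ (P n).support := by
      refine ae_all_iff.2 fun n => ae_all_iff.2 fun i => ?_
      refine ae_of_ae_map (f := x n i) (p := fun z => z ∈ (P n).support)
        (hlaw n i).aemeasurable ?_
      rw [(hlaw n i).map_eq]
      exact Measure.support_mem_ae
    filter_upwards [hmain, hsupp] with ω hω hωs
    -- The a priori bound `‖α‖₁ sup |k|` grows linearly, so its square times the mass `2/n^7` still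
    -- tends to `0`.
    set H : ℕ → ℝ := fun n => C * n * C' with hH
    set b : ℕ → ℝ := fun n => 2 * e n ^ 2 + (2 * H n ^ 2 * (2 / (n : ℝ) ^ 7) + 2 * (C / n)) with hb
    have hblim : Tendsto b atTop (𝓝 0) := by
      have h1 : Tendsto (fun n : ℕ => 2 * e n ^ 2 + ((4 * (C * C') ^ 2) * ((n : ℝ) ^ 5)⁻¹ +
          2 * (C * ((n : ℝ) ^ 1)⁻¹))) atTop (𝓝 0) := by
        simpa using ((he.pow 2).const_mul 2).add
          (((hinv 5 (by simp)).const_mul (4 * (C * C') ^ 2)).add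
            (((hinv 1 (by simp)).const_mul C).const_mul 2))
      refine h1.congr' ?_
      filter_upwards [eventually_gt_atTop 0] with n hn
      have hn' : (n : ℝ) ≠ 0 := by exact_mod_cast hn.ne'
      rw [hb, hH]
      field_simp
      ring
    have hbound : ∀ᶠ n in atTop, ∃ p : MvPolynomial (Fin (d n)) ℝ,
        p.totalDegree ≤ model.degree β ∧ eLpNorm (fun z =>
          PolyBarrier.averagedEstimate (PolyBarrier.scaledKernel g (PolyBarrier.effDim (S n)))
            (lam n) (κ n) (fun i => x n i ω) z - MvPolynomial.eval (fun i => z i) p) 2 (P n) ^ 2 ≤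
          ENNReal.ofReal (b n) := by
      filter_upwards [hω] with n ⟨p, hp, N, hN, hPN, hclose, hpN, α, hα, hαeq⟩
      refine ⟨p, hp, ?_⟩
      have hbdd : ∀ᵐ z ∂(P n), |PolyBarrier.averagedEstimate
          (PolyBarrier.scaledKernel g (PolyBarrier.effDim (S n))) (lam n) (κ n)
            (fun i => x n i ω) z| ≤ H n := by
        filter_upwards [(Measure.support_mem_ae : (P n).support ∈ ae (P n))] with z hz
        rw [hαeq]
        -- Nonnegativity of `C'` is read off at a sample point, whence the separate case `n = 0`
        -- below.
        have hC0 (i : Fin n) : 0 ≤ C' := (abs_nonneg _).trans (hC' n z hz _ (hωs n i))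
        calc _ ≤ ∑ i, |α i| * C' := by
              refine (Finset.abs_sum_le_sum_abs _ _).trans (Finset.sum_le_sum fun i _ => ?_)
              rw [abs_mul]
              exact mul_le_mul_of_nonneg_left (hC' n z hz _ (hωs n i)) (abs_nonneg _)
          _ = (∑ i, |α i|) * C' := by rw [Finset.sum_mul]
          _ ≤ H n := by
              rcases Nat.eq_zero_or_pos n with rfl | hn
              · simp [hH]
              · exact mul_le_mul_of_nonneg_right hα (hC0 ⟨0, hn⟩)
      exact PolyBarrier.eLpNorm_sub_sq_le hN (by positivity) (by positivity) hbdd hclose hPN hpN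
    refine PolyBarrier.exists_seq_tendsto (Q := fun n p => p.totalDegree ≤ model.degree β)
      (fun n => ⟨0, by simp⟩) (u := fun n p => eLpNorm (fun z =>
        PolyBarrier.averagedEstimate (PolyBarrier.scaledKernel g (PolyBarrier.effDim (S n)))
          (lam n) (κ n) (fun i => x n i ω) z - MvPolynomial.eval (fun i => z i) p) 2 (P n))
      hblim hbound
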